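/- Let $d\ge1$ be an integer and let $\beta,\gamma$ be real numbers such that $$\gamma-2<\beta<\frac{d-2}{d}\,\gamma<d .$$ Set $n:=\frac{2(d-\gamma)}{\beta+2-\gamma}$ and $\|f\|_{2,a}^2:=\int_{\mathbb R^d}|f|^2\,|x|^{-a}\,dx$, and let $\mathrm L^2_a(\mathbb R^d)$ be the space of measurable functions $f$ with $\|f\|_{2,a}<\infty$. Let $\mathrm H^1_{\beta,\gamma}(\mathbb R^d)$ be the space of the real-valued functions $f\in\mathrm L^2_\gamma(\mathbb R^d)$ whose weak gradient satisfies $\nabla f\in\mathrm L^2_\beta(\mathbb R^d)$. Here the weak gradient is defined by $\int_{\mathbb R^d} f\,\nabla\varphi\,dx=-\int_{\mathbb R^d}\varphi\,\nabla f\,dx$ for all $\varphi\in C^\infty_c(\mathbb R^d)$ such that $\varphi\in\mathrm L^2_{-\beta}(\mathbb R^d)$ and $\nabla\varphi\in\mathrm L^2_{-\gamma}(\mathbb R^d)$; these two conditions make both integrals well defined, and they are void if $\beta>-d$ and $\gamma>-d$. Then there is a smallest real constant $\mathscr C_{\beta,\gamma}$ such that, for all $f\in\mathrm H^1_{\beta,\gamma}(\mathbb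 R^d)\setminus\{0\}$, $$\int_{\mathbb R^d}\frac{|f|^2}{\|f\|_{2,\gamma}^2}\,\log\left(\frac{|f|^2}{\|f\|_{2,\gamma}^2}\right)|x|^{-\gamma}\,dx\le\mathscr C_{\beta,\gamma}+\frac n2\,\log\left(\frac{\|\nabla f\|_{2,\beta}^2}{\|f\|_{2,\gamma}^2}\right),$$ where the positive part of the integrand on the left-hand side is always integrable, so that the integral is well defined in $[-\infty,\infty)$. Moreover, with this constant $\mathscr C_{\beta,\gamma}$, equality (between finite quantities) is achieved by some function $u\in\mathrm H^1_{\beta,\gamma}(\mathbb R^d)\setminus\{0\}$. -/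

import Mathlib

open MeasureTheory
open scoped ContDiff

namespace WLS

/-- The measure `|x|^(-a) dx` on `ℝ^d`. (The value of the weight at the origin is irrelevant,
since the origin is a null set for `d ≥ 1`.) -/
noncomputable def powerMeasure (d : ℕ) (a : ℝ) : Measure (EuclideanSpace ℝ (Fin d)) :=
  volume.withDensity fun x => ENNReal.ofReal (‖x‖ ^ (-a))

/-- The squared weighted norm `‖f‖_{2,a}² = ∫ |f|² |x|^(-a) dx`, for scalar or vector valued `f`. -/
noncomputable def sqNorm {F : Type*} [NormedAddCommGroup F] (d : ℕ) (a : ℝ)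
    (f : EuclideanSpace ℝ (Fin d) → F) : ℝ :=
  ∫ x, ‖f x‖ ^ 2 ∂(powerMeasure d a)

/-- Test functions for the weak gradient of functions in `L²_γ` with gradient in `L²_β`:
smooth compactly supported functions `φ` on `ℝ^d` such that `φ` belongs to `L²(|x|^β dx)`, the dual
space of `L²_β`, and `∇φ` belongs to `L²(|x|^γ dx)`, the dual space of `L²_γ`. These two conditions
say exactly that the two integrals in the integration by parts formula make sense for all functions
in these spaces. They hold for every `φ ∈ C_c^∞(ℝ^d)` if `β > -d` and `γ > -d`, that is, as soon as
`L²_β` and `L²_γ` consist of locally integrable functions, and always hold for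
`φ ∈ C_c^∞(ℝ^d ∖ {0})`. -/
structure IsTestFunction (d : ℕ) (β γ : ℝ) (φ : EuclideanSpace ℝ (Fin d) → ℝ) : Prop where
  contDiff : ContDiff ℝ ∞ φ
  hasCompactSupport : HasCompactSupport φ
  memLp : MemLp φ 2 (powerMeasure d (-β))
  memLp_fderiv : MemLp (fderiv ℝ φ) 2 (powerMeasure d (-γ))

/-- `f` belongs to `H¹_{β,γ}(ℝ^d)`, and `G` is its weak gradient: `f ∈ L²_γ`, `G = ∇f ∈ L²_β`,
and `∫ f ∂_v φ dx = - ∫ φ G·v dx` for all test functions `φ` and all directions `v`.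
The gradient `G` is determined by `f` up to almost everywhere equality. -/
structure HasH1Gradient (d : ℕ) (β γ : ℝ) (f : EuclideanSpace ℝ (Fin d) → ℝ)
    (G : EuclideanSpace ℝ (Fin d) → EuclideanSpace ℝ (Fin d)) : Prop where
  memLp : MemLp f 2 (powerMeasure d γ)
  memLp_gradient : MemLp G 2 (powerMeasure d β)
  integral_eq : ∀ φ : EuclideanSpace ℝ (Fin d) → ℝ, IsTestFunction d β γ φ →
    ∀ v : EuclideanSpace ℝ (Fin d),
      ∫ x, f x * fderiv ℝ φ x v = - ∫ x, φ x * inner ℝ (G x) v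

/-- The admissible range of parameters, `γ - 2 < β < ((d - 2) / d) γ < d`. -/
def InRange (d : ℕ) (β γ : ℝ) : Prop :=
  γ - 2 < β ∧ β < ((d : ℝ) - 2) / d * γ ∧ ((d : ℝ) - 2) / d * γ < d

/-- The artificial dimension `n = 2 (d - γ) / (β + 2 - γ)`. -/
noncomputable def artificialDim (d : ℕ) (β γ : ℝ) : ℝ :=
  2 * ((d : ℝ) - γ) / (β + 2 - γ)

/-- The entropy density `(|f|² / ‖f‖²) log (|f|² / ‖f‖²)` with `‖f‖ = ‖f‖_{2,γ}`
(equal to `0` where `f = 0`), to be integrated against `|x|^(-γ) dx`. -/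
noncomputable def entropyDensity (d : ℕ) (γ : ℝ) (f : EuclideanSpace ℝ (Fin d) → ℝ)
    (x : EuclideanSpace ℝ (Fin d)) : ℝ :=
  |f x| ^ 2 / sqNorm d γ f * Real.log (|f x| ^ 2 / sqNorm d γ f)

/-- The right-hand side `C + (n / 2) log (‖∇f‖_{2,β}² / ‖f‖_{2,γ}²)`, where `G` stands for `∇f`. -/
noncomputable def rightHandSide (d : ℕ) (β γ C : ℝ) (f : EuclideanSpace ℝ (Fin d) → ℝ)
    (G : EuclideanSpace ℝ (Fin d) → EuclideanSpace ℝ (Fin d)) : ℝ :=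
  C + artificialDim d β γ / 2 * Real.log (sqNorm d β G / sqNorm d γ f)

/-- The weighted logarithmic Sobolev inequality with constant `C`, for all nonzero functions in
`H¹_{β,γ}(ℝ^d)`. The entropy is an integral in `[-∞, ∞]`: the inequality says that the integral of
the positive part of the density is finite, and that the bound holds unless the integral of the
negative part is infinite; in this last case the entropy is `-∞` and the bound is void. -/
def InequalityHolds (d : ℕ) (β γ C : ℝ) : Prop :=
  ∀ (f : EuclideanSpace ℝ (Fin d) → ℝ) (G : EuclideanSpace ℝ (Fin d) → EuclideanSpace ℝ (Fin d)),
    HasH1Gradient d β γ f G → ¬ (f =ᵐ[volume] 0) →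
      ∫⁻ x, ENNReal.ofReal (entropyDensity d γ f x) ∂(powerMeasure d γ) ≠ ⊤ ∧
      (Integrable (entropyDensity d γ f) (powerMeasure d γ) →
        ∫ x, entropyDensity d γ f x ∂(powerMeasure d γ) ≤ rightHandSide d β γ C f G)

/-- The optimal constant: the infimum of the constants for which the inequality holds. -/
noncomputable def optimalConstant (d : ℕ) (β γ : ℝ) : ℝ :=
  sInf {C : ℝ | InequalityHolds d β γ C}

end WLS

namespace WLS

/-! The functional is invariant under `f ↦ s f(c x)`. Since `β + 2 - γ > 0`, both parameters can be
chosen so that mass and energy equal one (`exists_normalized`). The logarithmic term is then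
absorbed, and the problem becomes to maximize `∫ f² log f² |x|^(-γ) dx` among functions of mass one
and energy at most one. It has to be shown that this supremum is finite and attained.

No Sobolev inequality is invoked. The only regularity input is `affine_difference_le`, an `L²` bound
on `f((1+c)x + h) - f(x)` over a dyadic shell, where all weights are comparable to constants. It has
two uses.

With `c = 0`, averaging over `h` in a ball whose radius is adapted to the level `l` shows that the
part of `f²` above `l` on the shell of radius `ρ` is `O(l^(-4/d) ρ^(-τ))`, with `τ = (d-2)γ/d - β >
0` (`shell_levelSet_le`). This is summable over the shells at infinity.

With `c = 1`, `h = 0`, comparing a shell with its double gives a contraction because `γ < d`, so the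
mass near the origin decays like a power of the radius (`shell_mass_decay`).

Both together give a power decay of level sets in all of space (`levelSet_le`). Hence the positive
part of the entropy is uniformly integrable (`entropy_above_le`) and the optimal constant is finite.

For a maximizing sequence, the lower bound on the entropy controls its negative part. This prevents
the mass from spreading at infinity (`exists_radius_mass_le`), because small values of `f` are
penalized by `-log f²` and large ones are controlled by the outer level set estimate. With local
compactness, a weak limit is a strong `L²` limit (`tendsto_lintegral_sub_sq`), so it has mass one.
The entropy is upper semicontinuous along such a sequence: Fatou below a high level, uniform
smallness above it (`entropy_upper_semicontinuous`). The limit has energy at most one, and the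
inequality itself then forces equality. -/

/-- The Euclidean space `ℝ^d`. -/
abbrev Eu (d : ℕ) := EuclideanSpace ℝ (Fin d)

/-! ### Power weights: null sets, comparability on dyadic shells, homogeneity. -/

section Basics

open Filter Topology
open scoped ENNReal

variable {d : ℕ} {F : Type*} [NormedAddCommGroup F]

lemma memLp_two_iff_lintegral {X : Type*} [MeasurableSpace X] {μ : Measure X} {f : X → F}
    (hf : AEStronglyMeasurable f μ) : MemLp f 2 μ ↔ ∫⁻ x, ‖f x‖ₑ ^ 2 ∂μ < ⊤ := by
  have h := eLpNorm_lt_top_iff_lintegral_rpow_enorm_lt_top (f := f) (μ := μ)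
    (p := 2) (by norm_num) (by norm_num)
  simp only [ENNReal.toReal_ofNat, ENNReal.rpow_ofNat] at h
  exact ⟨fun h' => h.1 h'.2, fun h' => ⟨hf, h.2 h'⟩⟩

lemma ofReal_integral_norm_sq {X : Type*} [MeasurableSpace X] {μ : Measure X} {f : X → F}
    (hf : MemLp f 2 μ) : ENNReal.ofReal (∫ x, ‖f x‖ ^ 2 ∂μ) = ∫⁻ x, ‖f x‖ₑ ^ 2 ∂μ := by
  rw [ofReal_integral_eq_lintegral_ofReal ((memLp_two_iff_integrable_sq_norm hf.1).1 hf)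
    (Eventually.of_forall fun x => by positivity)]
  refine lintegral_congr fun x => ?_
  rw [ENNReal.ofReal_pow (norm_nonneg _), ofReal_norm]

lemma measurable_weight (d : ℕ) (a : ℝ) :
    Measurable fun x : Eu d => ENNReal.ofReal (‖x‖ ^ (-a)) := by fun_prop

instance sigmaFinite_powerMeasure (d : ℕ) (a : ℝ) : SigmaFinite (powerMeasure d a) := by
  unfold powerMeasure; infer_instance

lemma powerMeasure_absolutelyContinuous (d : ℕ) (a : ℝ) :
    powerMeasure d a ≪ (volume : Measure (Eu d)) :=
  withDensity_absolutelyContinuous _ _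

lemma absolutelyContinuous_powerMeasure (d : ℕ) [NeZero d] (a : ℝ) :
    (volume : Measure (Eu d)) ≪ powerMeasure d a := by
  refine withDensity_absolutelyContinuous' (measurable_weight d a).aemeasurable ?_
  filter_upwards [Measure.ae_ne (volume : Measure (Eu d)) 0] with x hx
  have : 0 < ‖x‖ := norm_pos_iff.2 hx
  simpa using Real.rpow_pos_of_pos this _

lemma ae_powerMeasure (d : ℕ) [NeZero d] (a : ℝ) :
    ae (powerMeasure d a) = ae (volume : Measure (Eu d)) :=
  le_antisymm (powerMeasure_absolutelyContinuous d a).ae_le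
    (absolutelyContinuous_powerMeasure d a).ae_le

lemma lintegral_powerMeasure (a : ℝ) (g : Eu d → ℝ≥0∞) :
    ∫⁻ x, g x ∂powerMeasure d a = ∫⁻ x, ENNReal.ofReal (‖x‖ ^ (-a)) * g x := by
  unfold powerMeasure
  rw [lintegral_withDensity_eq_lintegral_mul_non_measurable _ (measurable_weight d a)
    (Eventually.of_forall fun x => ENNReal.ofReal_lt_top)]
  rfl

lemma setLIntegral_powerMeasure (a : ℝ) (g : Eu d → ℝ≥0∞) {S : Set (Eu d)}
    (hS : MeasurableSet S) :
    ∫⁻ x in S, g x ∂powerMeasure d a = ∫⁻ x in S, ENNReal.ofReal (‖x‖ ^ (-a)) * g x := by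
  unfold powerMeasure
  rw [setLIntegral_withDensity_eq_setLIntegral_mul_non_measurable _ (measurable_weight d a) _ hS
    (Eventually.of_forall fun x => ENNReal.ofReal_lt_top)]
  rfl

lemma integral_powerMeasure [NormedSpace ℝ F] (a : ℝ) (g : Eu d → F) :
    ∫ x, g x ∂powerMeasure d a = ∫ x, ‖x‖ ^ (-a) • g x := by
  unfold powerMeasure
  rw [integral_withDensity_eq_integral_toReal_smul (measurable_weight d a)
    (Eventually.of_forall fun x => ENNReal.ofReal_lt_top)]
  refine integral_congr_ae (Eventually.of_forall fun x => ?_)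
  simp only
  rw [ENNReal.toReal_ofReal (by positivity)]

/-- The dyadic shell `ρ ≤ |x| < 2ρ`. -/
def shell (d : ℕ) (ρ : ℝ) : Set (Eu d) := {x | ρ ≤ ‖x‖ ∧ ‖x‖ < 2 * ρ}

/-- An enlarged shell. -/
def fatShell (d : ℕ) (ρ : ℝ) : Set (Eu d) := {x | ρ / 8 < ‖x‖ ∧ ‖x‖ < 8 * ρ}

lemma measurableSet_shell (ρ : ℝ) : MeasurableSet (shell d ρ) :=
  (measurableSet_le measurable_const measurable_norm).inter
    (measurableSet_lt measurable_norm measurable_const)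

lemma measurableSet_fatShell (ρ : ℝ) : MeasurableSet (fatShell d ρ) :=
  (measurableSet_lt measurable_const measurable_norm).inter
    (measurableSet_lt measurable_norm measurable_const)

lemma shell_subset_fatShell {ρ : ℝ} (hρ : 0 < ρ) : shell d ρ ⊆ fatShell d ρ := fun x hx =>
  ⟨by have := hx.1; linarith, by have := hx.2; linarith⟩

/-- On a fat shell `‖x‖ / ρ` and its inverse are at most 8. Weights can thus be frozen at `ρ` with a
constant independent of `ρ`, which keeps the exact powers of `ρ` in all local estimates. -/
lemma rpow_le_on_fatShell {ρ : ℝ} (hρ : 0 < ρ) (a : ℝ) {x : Eu d} (hx : x ∈ fatShell d ρ) :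
    ‖x‖ ^ a ≤ 8 ^ |a| * ρ ^ a := by
  have hx0 : 0 < ‖x‖ := lt_trans (by positivity) hx.1
  have h1 : ‖x‖ = (‖x‖ / ρ) * ρ := by field_simp
  have hs0 : 0 < ‖x‖ / ρ := by positivity
  have hs1 : ‖x‖ / ρ ≤ 8 := by rw [div_le_iff₀ hρ]; exact hx.2.le
  have hs2 : (‖x‖ / ρ)⁻¹ ≤ 8 := by
    rw [inv_div, div_le_iff₀ hx0]; have := hx.1; linarith
  rw [h1, Real.mul_rpow hs0.le hρ.le]
  refine mul_le_mul_of_nonneg_right ?_ (by positivity)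
  rcases le_total 0 a with ha | ha
  · rw [abs_of_nonneg ha]; exact Real.rpow_le_rpow hs0.le hs1 ha
  · rw [abs_of_nonpos ha]
    have : (‖x‖ / ρ) ^ a = ((‖x‖ / ρ)⁻¹) ^ (-a) := by
      rw [Real.rpow_neg (by positivity), Real.inv_rpow hs0.le, inv_inv]
    rw [this]
    exact Real.rpow_le_rpow (by positivity) hs2 (by linarith)

lemma setLIntegral_powerMeasure_le {ρ : ℝ} (hρ : 0 < ρ) (a : ℝ) {S : Set (Eu d)}
    (hS : MeasurableSet S) (hSρ : S ⊆ fatShell d ρ) (g : Eu d → ℝ≥0∞) :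
    ∫⁻ x in S, g x ∂powerMeasure d a ≤
      ENNReal.ofReal (8 ^ |a| * ρ ^ (-a)) * ∫⁻ x in S, g x := by
  rw [setLIntegral_powerMeasure a g hS, ← lintegral_const_mul' _ _ ENNReal.ofReal_ne_top]
  refine setLIntegral_mono' hS fun x hx => ?_
  gcongr
  simpa using rpow_le_on_fatShell hρ (-a) (hSρ hx)

lemma setLIntegral_le_powerMeasure {ρ : ℝ} (hρ : 0 < ρ) (a : ℝ) {S : Set (Eu d)}
    (hS : MeasurableSet S) (hSρ : S ⊆ fatShell d ρ) (g : Eu d → ℝ≥0∞) :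
    ∫⁻ x in S, g x ≤
      ENNReal.ofReal (8 ^ |a| * ρ ^ a) * ∫⁻ x in S, g x ∂powerMeasure d a := by
  rw [setLIntegral_powerMeasure a g hS, ← lintegral_const_mul' _ _ ENNReal.ofReal_ne_top]
  refine setLIntegral_mono' hS fun x hx => ?_
  have hx0 : 0 < ‖x‖ := lt_trans (by positivity) (hSρ hx).1
  rw [← mul_assoc, ← ENNReal.ofReal_mul (by positivity)]
  have h := rpow_le_on_fatShell hρ a (hSρ hx)
  have h2 : 1 ≤ 8 ^ |a| * ρ ^ a * ‖x‖ ^ (-a) := by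
    rw [Real.rpow_neg hx0.le, ← div_eq_mul_inv, le_div_iff₀ (by positivity)]
    linarith
  calc g x = 1 * g x := (one_mul _).symm
    _ ≤ _ := by gcongr; simpa using h2

lemma memLp_restrict_fatShell [NeZero d] {ρ : ℝ} (hρ : 0 < ρ) {a : ℝ} {f : Eu d → F}
    (hf : MemLp f 2 (powerMeasure d a)) : MemLp f 2 (volume.restrict (fatShell d ρ)) := by
  have hm : AEStronglyMeasurable f (volume : Measure (Eu d)) :=
    hf.1.mono_ac (absolutelyContinuous_powerMeasure d a)
  rw [memLp_two_iff_lintegral hm.restrict]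
  refine (setLIntegral_le_powerMeasure hρ a (measurableSet_fatShell ρ) subset_rfl _).trans_lt ?_
  refine ENNReal.mul_lt_top ENNReal.ofReal_lt_top ?_
  exact (setLIntegral_le_lintegral _ _).trans_lt ((memLp_two_iff_lintegral hf.1).1 hf)

lemma integrable_restrict_fatShell [NeZero d] {ρ : ℝ} (hρ : 0 < ρ) {a : ℝ} {f : Eu d → F}
    (hf : MemLp f 2 (powerMeasure d a)) : Integrable f (volume.restrict (fatShell d ρ)) := by
  have : IsFiniteMeasure (volume.restrict (fatShell d ρ)) := by
    refine ⟨?_⟩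
    rw [Measure.restrict_apply_univ]
    refine (measure_mono (t := Metric.ball 0 (8 * ρ)) fun x hx => ?_).trans_lt
      measure_ball_lt_top
    simpa using hx.2
  exact (memLp_restrict_fatShell hρ hf).integrable (by norm_num)

lemma map_smul_powerMeasure (a : ℝ) {c : ℝ} (hc : 0 < c) :
    Measure.map (fun x : Eu d => c • x) (powerMeasure d a) =
      ENNReal.ofReal (c ^ (a - d)) • powerMeasure d a := by
  have hm : Measurable fun x : Eu d => c • x := by fun_prop
  ext s hs
  rw [Measure.map_apply hm hs, Measure.smul_apply, smul_eq_mul]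
  have h0 : ∀ t : Set (Eu d), MeasurableSet t →
      powerMeasure d a t = ∫⁻ x, ENNReal.ofReal (‖x‖ ^ (-a)) * t.indicator 1 x := fun t ht => by
    rw [← lintegral_powerMeasure, lintegral_indicator_one ht]
  rw [h0 s hs, h0 _ (hm hs)]
  have h1 : ∀ x : Eu d, ENNReal.ofReal (‖x‖ ^ (-a)) * ((fun x => c • x) ⁻¹' s).indicator 1 x =
      ENNReal.ofReal (c ^ a) *
        (fun y : Eu d => ENNReal.ofReal (‖y‖ ^ (-a)) * s.indicator 1 y) (c • x) := fun x => by
    have : ‖x‖ ^ (-a) = c ^ a * ‖c • x‖ ^ (-a) := by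
      rw [norm_smul, Real.norm_of_nonneg hc.le, Real.mul_rpow hc.le (norm_nonneg _), ← mul_assoc,
        ← Real.rpow_add hc]
      simp
    rw [this, ENNReal.ofReal_mul (by positivity), mul_assoc]
    rfl
  simp_rw [h1]
  have hF : Measurable fun y : Eu d => ENNReal.ofReal (‖y‖ ^ (-a)) * s.indicator 1 y :=
    (measurable_weight d a).mul (measurable_one.indicator hs)
  rw [lintegral_const_mul' _ _ ENNReal.ofReal_ne_top, ← lintegral_map hF hm,
    Measure.map_addHaar_smul _ hc.ne', lintegral_smul_measure, smul_eq_mul, ← mul_assoc,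
    ← ENNReal.ofReal_mul (by positivity)]
  congr 2
  rw [finrank_euclideanSpace_fin, abs_of_pos (by positivity), Real.rpow_sub hc, Real.rpow_natCast,
    div_eq_mul_inv]

end Basics

end WLS

namespace WLS

/-! ### Difference quotients on shells, by mollification away from the origin. -/

section Mollification

open Filter Topology
open scoped ENNReal Convolution

variable {d : ℕ}

/-- Jensen's inequality for a subprobability density, from Hölder applied to `√w · (√w g)`. -/
lemma sq_lintegral_mul_le {X : Type*} [MeasurableSpace X] {μ : Measure X} {w g : X → ℝ≥0∞}
    (hw : AEMeasurable w μ) (hg : AEMeasurable g μ) (h1 : ∫⁻ x, w x ∂μ ≤ 1) :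
    (∫⁻ x, w x * g x ∂μ) ^ 2 ≤ ∫⁻ x, w x * g x ^ 2 ∂μ := by
  have hpq : (2 : ℝ).HolderConjugate 2 := Real.HolderConjugate.two_two
  have h := ENNReal.lintegral_mul_le_Lp_mul_Lq μ hpq (f := fun x => w x ^ (1 / 2 : ℝ))
    (g := fun x => w x ^ (1 / 2 : ℝ) * g x) (hw.pow_const _) ((hw.pow_const _).mul hg)
  have e1 : ∀ x, w x ^ (1 / 2 : ℝ) * w x ^ (1 / 2 : ℝ) = w x := fun x => by
    rw [← ENNReal.rpow_add_of_nonneg _ _ (by norm_num) (by norm_num)]; norm_num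
  have e2 : ∀ x, (w x ^ (1 / 2 : ℝ)) ^ (2 : ℝ) = w x := fun x => by
    rw [← ENNReal.rpow_mul]; norm_num
  have e3 : ∀ x, (w x ^ (1 / 2 : ℝ) * g x) ^ (2 : ℝ) = w x * g x ^ 2 := fun x => by
    rw [ENNReal.mul_rpow_of_nonneg _ _ (by norm_num), e2, ENNReal.rpow_ofNat]
  simp only [Pi.mul_apply, ← mul_assoc, e1, e2, e3] at h
  have h2 : (∫⁻ x, w x ∂μ) ^ (1 / 2 : ℝ) ≤ 1 := ENNReal.rpow_le_one h1 (by norm_num)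
  calc (∫⁻ x, w x * g x ∂μ) ^ 2
      ≤ (1 * (∫⁻ x, w x * g x ^ 2 ∂μ) ^ (1 / 2 : ℝ)) ^ 2 := by
        gcongr; exact h.trans (by gcongr)
    _ = _ := by
        rw [one_mul, ← ENNReal.rpow_ofNat, ← ENNReal.rpow_mul]; norm_num

lemma sq_setLIntegral_Icc_le {g : ℝ → ℝ≥0∞} (hg : Measurable g) :
    (∫⁻ t in Set.Icc (0 : ℝ) 1, g t) ^ 2 ≤ ∫⁻ t in Set.Icc (0 : ℝ) 1, g t ^ 2 := by
  have := sq_lintegral_mul_le (μ := volume.restrict (Set.Icc (0 : ℝ) 1)) (w := 1) (g := g)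
    aemeasurable_const hg.aemeasurable (by simp)
  simpa using this

/-- The weight can only be singular at the origin, and `g` vanishes in a neighborhood of it, so the
weighted integrand is continuous with compact support. -/
lemma memLp_powerMeasure_of_tsupport {F : Type*} [NormedAddCommGroup F]
    {g : Eu d → F} (hg : Continuous g) (hc : HasCompactSupport g) (h0 : (0 : Eu d) ∉ tsupport g)
    (a : ℝ) : MemLp g 2 (powerMeasure d a) := by
  rw [memLp_two_iff_lintegral hg.aestronglyMeasurable, lintegral_powerMeasure]
  have hcont : Continuous fun x : Eu d => ‖x‖ ^ (-a) * ‖g x‖ ^ 2 := by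
    rw [continuous_iff_continuousAt]
    intro x
    by_cases hx : x = 0
    · have h1 : ∀ᶠ y in 𝓝 x, y ∉ tsupport g :=
        (isClosed_tsupport g).isOpen_compl.mem_nhds (by simpa [hx] using h0)
      refine (continuousAt_const (y := (0 : ℝ))).congr ?_
      filter_upwards [h1] with y hy
      simp [image_eq_zero_of_notMem_tsupport hy]
    · exact (continuous_norm.continuousAt.rpow_const (Or.inl (norm_ne_zero_iff.2 hx))).mul
        (hg.norm.pow 2).continuousAt
  have hcs : HasCompactSupport fun x : Eu d => ‖x‖ ^ (-a) * ‖g x‖ ^ 2 :=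
    hc.mono fun x hx => by
      rw [Function.mem_support] at hx ⊢
      rintro h; exact hx (by simp [h])
  have := (hcont.integrable_of_hasCompactSupport (μ := volume) hcs).lintegral_lt_top
  refine lt_of_le_of_lt (le_of_eq (lintegral_congr fun x => ?_)) this
  rw [ENNReal.ofReal_mul (by positivity), ENNReal.ofReal_pow (norm_nonneg _), ofReal_norm]

lemma isTestFunction_of_tsupport {φ : Eu d → ℝ} (hφ : ContDiff ℝ ∞ φ)
    (hc : HasCompactSupport φ) (h0 : (0 : Eu d) ∉ tsupport φ) (β γ : ℝ) :
    IsTestFunction d β γ φ where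
  contDiff := hφ
  hasCompactSupport := hc
  memLp := memLp_powerMeasure_of_tsupport hφ.continuous hc h0 _
  memLp_fderiv := memLp_powerMeasure_of_tsupport (hφ.continuous_fderiv (by simp))
    (hc.fderiv (𝕜 := ℝ)) (fun h => h0 (tsupport_fderiv_subset ℝ h)) _

/-- Convolution of the restriction of `f` to a fat shell with a bump function. -/
noncomputable def mollify (ρ : ℝ) (φ : ContDiffBump (0 : Eu d)) (f : Eu d → ℝ) : Eu d → ℝ :=
  φ.normed volume ⋆[ContinuousLinearMap.lsmul ℝ ℝ, volume] (fatShell d ρ).indicator f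

/-- The derivative falls on the kernel. For `x` in this range, `y ↦ φ(x - y)` is supported inside
the fat shell, hence away from the origin, so it is an admissible test function and the weak
gradient identity moves the derivative onto `f`. -/
lemma mollify_fderiv_apply [NeZero d] {β γ ρ : ℝ} (hρ : 0 < ρ) {f : Eu d → ℝ}
    {G : Eu d → Eu d} (hf : HasH1Gradient d β γ f G) (φ : ContDiffBump (0 : Eu d))
    (hφ : φ.rOut < ρ / 4) :
    ContDiff ℝ 1 (mollify ρ φ f) ∧ ∀ x : Eu d, ρ / 2 ≤ ‖x‖ → ‖x‖ ≤ 5 * ρ → ∀ v : Eu d,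
      fderiv ℝ (mollify ρ φ f) x v =
        ∫ y, φ.normed volume (x - y) * inner ℝ ((fatShell d ρ).indicator G y) v := by
  have hint : Integrable ((fatShell d ρ).indicator f) volume :=
    (integrable_indicator_iff (measurableSet_fatShell ρ)).2 (integrable_restrict_fatShell hρ hf.memLp)
  have hk : ContDiff ℝ ∞ (φ.normed (volume : Measure (Eu d))) := φ.contDiff_normed
  have hkc : HasCompactSupport (φ.normed (volume : Measure (Eu d))) :=
    φ.hasCompactSupport_normed
  refine ⟨hkc.contDiff_convolution_left _ (hk.of_le (by simp)) hint.locallyIntegrable, ?_⟩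
  intro x hx1 hx2 v
  have hd := (hkc.hasFDerivAt_convolution_left (ContinuousLinearMap.lsmul ℝ ℝ)
    (hk.of_le (by simp)) hint.locallyIntegrable x).fderiv
  have hk' : Continuous (fderiv ℝ (φ.normed (volume : Measure (Eu d)))) :=
    hk.continuous_fderiv (by simp)
  have hconv : ConvolutionExistsAt (fderiv ℝ (φ.normed (volume : Measure (Eu d))))
      ((fatShell d ρ).indicator f) x
      ((ContinuousLinearMap.lsmul ℝ ℝ).precompL (Eu d)) volume :=
    (hkc.fderiv (𝕜 := ℝ)).convolutionExists_left _ hk' hint.locallyIntegrable x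
  have e1 : fderiv ℝ (mollify ρ φ f) x v =
      ∫ y, (fatShell d ρ).indicator f y * fderiv ℝ (φ.normed (volume : Measure (Eu d))) (x - y) v := by
    unfold mollify
    rw [hd, convolution_eq_swap, ContinuousLinearMap.integral_apply hconv.integrable_swap]
    refine integral_congr_ae (Eventually.of_forall fun y => ?_)
    simp [ContinuousLinearMap.precompL_apply, mul_comm]
  set ψ : Eu d → ℝ := fun y => φ.normed volume (x - y) with hψ
  have hψd : ∀ y, fderiv ℝ ψ y v = - fderiv ℝ (φ.normed (volume : Measure (Eu d))) (x - y) v := by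
    intro y
    have hb : HasFDerivAt (φ.normed (volume : Measure (Eu d)))
        (fderiv ℝ (φ.normed (volume : Measure (Eu d))) (x - y)) (x - y) :=
      (hk.differentiable (by simp) _).hasFDerivAt
    have := hb.comp y ((hasFDerivAt_id y).const_sub x)
    rw [show fderiv ℝ ψ y = _ from this.fderiv]
    simp
  have hsupp : tsupport ψ ⊆ Metric.closedBall x φ.rOut := by
    refine closure_minimal (fun y hy => ?_) Metric.isClosed_closedBall
    have : x - y ∈ Function.support (φ.normed (volume : Measure (Eu d))) := hy
    rw [φ.support_normed_eq] at this
    rw [Metric.mem_closedBall, dist_comm, dist_eq_norm]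
    simpa using (Metric.mem_ball.1 this).le
  -- The margins suffice: `ρ/2 - ρ/4 > ρ/8` and `5ρ + ρ/4 < 8ρ`.
  have hfat : tsupport ψ ⊆ fatShell d ρ := fun y hy => by
    have h1 := hsupp hy
    rw [Metric.mem_closedBall, dist_eq_norm] at h1
    have h2 : ‖x‖ ≤ ‖y‖ + ‖y - x‖ := by
      have := norm_sub_le y (y - x); simpa using this
    have h3 : ‖y‖ ≤ ‖x‖ + ‖y - x‖ := by
      have := norm_add_le x (y - x); simpa using this
    exact ⟨by linarith, by linarith⟩
  have hψs : ContDiff ℝ ∞ ψ := hk.comp (contDiff_const.sub contDiff_id)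
  have hψc : HasCompactSupport ψ :=
    HasCompactSupport.intro' (isCompact_closedBall x φ.rOut) Metric.isClosed_closedBall
      fun y hy => image_eq_zero_of_notMem_tsupport fun h => hy (hsupp h)
  have h0 : (0 : Eu d) ∉ tsupport ψ := fun h => by
    have := (hfat h).1
    rw [norm_zero] at this; linarith
  have hw := hf.integral_eq ψ (isTestFunction_of_tsupport hψs hψc h0 β γ) v
  have e2 : ∫ y, (fatShell d ρ).indicator f y *
      fderiv ℝ (φ.normed (volume : Measure (Eu d))) (x - y) v = - ∫ y, f y * fderiv ℝ ψ y v := by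
    rw [← integral_neg]
    refine integral_congr_ae (Eventually.of_forall fun y => ?_)
    by_cases hy : y ∈ fatShell d ρ
    · simp [hy, hψd]
    · have : fderiv ℝ ψ y = 0 :=
        image_eq_zero_of_notMem_tsupport fun h => hy (hfat (tsupport_fderiv_subset ℝ h))
      simp [hy, this]
  rw [e1, e2, hw, neg_neg]
  refine integral_congr_ae (Eventually.of_forall fun y => ?_)
  by_cases hy : y ∈ fatShell d ρ
  · simp [hy, hψ]
  · have : ψ y = 0 := image_eq_zero_of_notMem_tsupport fun h => hy (hfat h)
    simp [hy, this]

lemma lintegral_normed_bump [NeZero d] (φ : ContDiffBump (0 : Eu d)) :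
    ∫⁻ y, ENNReal.ofReal (φ.normed volume y) = 1 := by
  rw [← ofReal_integral_eq_lintegral_ofReal φ.integrable_normed
    (Eventually.of_forall fun x => φ.nonneg_normed x), φ.integral_normed, ENNReal.ofReal_one]

/-- The operator norm is tested on each direction `v`. Jensen's inequality applies because the
kernel is a probability density. -/
lemma mollify_fderiv_enorm_le [NeZero d] {β γ ρ : ℝ} (hρ : 0 < ρ) {f : Eu d → ℝ}
    {G : Eu d → Eu d} (hf : HasH1Gradient d β γ f G) (φ : ContDiffBump (0 : Eu d))
    (hφ : φ.rOut < ρ / 4) {x : Eu d} (hx1 : ρ / 2 ≤ ‖x‖) (hx2 : ‖x‖ ≤ 5 * ρ) :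
    ‖fderiv ℝ (mollify ρ φ f) x‖ₑ ^ 2 ≤ ∫⁻ y, ENNReal.ofReal (φ.normed volume (x - y)) *
      ‖(fatShell d ρ).indicator G y‖ₑ ^ 2 := by
  have hGint : Integrable ((fatShell d ρ).indicator G) volume :=
    (integrable_indicator_iff (measurableSet_fatShell ρ)).2
      (integrable_restrict_fatShell hρ hf.memLp_gradient)
  have hkm : Measurable fun y => ENNReal.ofReal (φ.normed volume (x - y)) :=
    (φ.continuous_normed.comp (continuous_const.sub continuous_id)).measurable.ennreal_ofReal
  set I := ∫⁻ y, ENNReal.ofReal (φ.normed volume (x - y)) *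
      ‖(fatShell d ρ).indicator G y‖ₑ with hI
  have hbound : ‖fderiv ℝ (mollify ρ φ f) x‖ₑ ≤ I := by
    by_cases hItop : I = ⊤
    · rw [hItop]; exact le_top
    rw [← ofReal_norm, ENNReal.ofReal_le_iff_le_toReal hItop]
    refine ContinuousLinearMap.opNorm_le_bound _ ENNReal.toReal_nonneg fun v => ?_
    rw [← ENNReal.toReal_ofReal (norm_nonneg v), ← ENNReal.toReal_mul,
      ← ENNReal.ofReal_le_iff_le_toReal (ENNReal.mul_ne_top hItop ENNReal.ofReal_ne_top),
      ofReal_norm, ofReal_norm, (mollify_fderiv_apply hρ hf φ hφ).2 x hx1 hx2 v, hI,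
      ← lintegral_mul_const' _ _ enorm_ne_top]
    refine (enorm_integral_le_lintegral_enorm _).trans (lintegral_mono fun y => ?_)
    rw [enorm_mul, Real.enorm_of_nonneg (φ.nonneg_normed _), mul_assoc]
    gcongr
    rw [← ofReal_norm, ← ofReal_norm, ← ofReal_norm, ← ENNReal.ofReal_mul (norm_nonneg _)]
    exact ENNReal.ofReal_le_ofReal (norm_inner_le_norm _ _)
  refine (pow_le_pow_left₀ zero_le hbound 2).trans ?_
  refine sq_lintegral_mul_le hkm.aemeasurable hGint.1.enorm ?_
  rw [lintegral_sub_left_eq_self (fun y => ENNReal.ofReal (φ.normed volume y)) x,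
    lintegral_normed_bump]

lemma setLIntegral_mollify_fderiv_le [NeZero d] {β γ ρ : ℝ} (hρ : 0 < ρ) {f : Eu d → ℝ}
    {G : Eu d → Eu d} (hf : HasH1Gradient d β γ f G) (φ : ContDiffBump (0 : Eu d))
    (hφ : φ.rOut < ρ / 4) :
    ∫⁻ x in {x : Eu d | ρ / 2 ≤ ‖x‖ ∧ ‖x‖ ≤ 5 * ρ}, ‖fderiv ℝ (mollify ρ φ f) x‖ₑ ^ 2 ≤
      ∫⁻ x in fatShell d ρ, ‖G x‖ₑ ^ 2 := by
  have hGm : AEStronglyMeasurable ((fatShell d ρ).indicator G) volume :=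
    ((integrable_indicator_iff (measurableSet_fatShell ρ)).2
      (integrable_restrict_fatShell hρ hf.memLp_gradient)).1
  have hS : MeasurableSet {x : Eu d | ρ / 2 ≤ ‖x‖ ∧ ‖x‖ ≤ 5 * ρ} :=
    (measurableSet_le measurable_const measurable_norm).inter
      (measurableSet_le measurable_norm measurable_const)
  have hkm : Measurable fun y => ENNReal.ofReal (φ.normed (volume : Measure (Eu d)) y) :=
    φ.continuous_normed.measurable.ennreal_ofReal
  calc _ ≤ ∫⁻ x in {x : Eu d | ρ / 2 ≤ ‖x‖ ∧ ‖x‖ ≤ 5 * ρ},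
        ∫⁻ y, ENNReal.ofReal (φ.normed volume (x - y)) *
          ‖(fatShell d ρ).indicator G y‖ₑ ^ 2 :=
        setLIntegral_mono' hS fun x hx => mollify_fderiv_enorm_le hρ hf φ hφ hx.1 hx.2
    _ ≤ ∫⁻ x, ∫⁻ y, ENNReal.ofReal (φ.normed volume (x - y)) *
          ‖(fatShell d ρ).indicator G y‖ₑ ^ 2 := setLIntegral_le_lintegral _ _
    _ = ∫⁻ y, ∫⁻ x, ENNReal.ofReal (φ.normed volume (x - y)) *
          ‖(fatShell d ρ).indicator G y‖ₑ ^ 2 := by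
        refine lintegral_lintegral_swap ?_
        have h1 : Measurable fun p : Eu d × Eu d =>
            ENNReal.ofReal (φ.normed volume (p.1 - p.2)) :=
          hkm.comp (measurable_fst.sub measurable_snd)
        have h2 : AEMeasurable (fun p : Eu d × Eu d => ‖(fatShell d ρ).indicator G p.2‖ₑ ^ 2)
            (volume.prod volume) :=
          (hGm.enorm.pow_const 2).comp_snd
        exact h1.aemeasurable.mul h2
    _ = ∫⁻ y, ‖(fatShell d ρ).indicator G y‖ₑ ^ 2 := by
        refine lintegral_congr fun y => ?_
        rw [lintegral_mul_const' _ _ (by finiteness),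
          lintegral_sub_right_eq_self (fun x => ENNReal.ofReal (φ.normed volume x)) y,
          lintegral_normed_bump, one_mul]
    _ = ∫⁻ x in fatShell d ρ, ‖G x‖ₑ ^ 2 := by
        rw [← lintegral_indicator (measurableSet_fatShell ρ)]
        refine lintegral_congr fun y => ?_
        by_cases hy : y ∈ fatShell d ρ <;> simp [hy]

/-- The whole segment from `x` to `(1+c)x + h` stays in the region where the gradient of the
mollification is known. -/
lemma affine_mem {ρ c t : ℝ} (hρ : 0 < ρ) (hc0 : 0 ≤ c) (hc1 : c ≤ 1) {h : Eu d}
    (hh : ‖h‖ ≤ ρ / 2) (ht : t ∈ Set.Icc (0 : ℝ) 1) {x : Eu d} (hx : x ∈ shell d ρ) :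
    ρ / 2 ≤ ‖(1 + t * c) • x + t • h‖ ∧ ‖(1 + t * c) • x + t • h‖ ≤ 5 * ρ := by
  have h0 : 0 ≤ t * c := mul_nonneg ht.1 hc0
  have h1 : t * c ≤ 1 := mul_le_one₀ ht.2 hc0 hc1
  have e1 : ‖(1 + t * c) • x‖ = (1 + t * c) * ‖x‖ := by
    rw [norm_smul, Real.norm_of_nonneg (by linarith)]
  have e2 : ‖t • h‖ ≤ ρ / 2 := by
    rw [norm_smul, Real.norm_of_nonneg ht.1]
    nlinarith [ht.1, ht.2, norm_nonneg h]
  have h3 := norm_add_le ((1 + t * c) • x) (t • h)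
  have h4 : ‖(1 + t * c) • x‖ ≤ ‖(1 + t * c) • x + t • h‖ + ‖t • h‖ := by
    have := norm_sub_le ((1 + t * c) • x + t • h) (t • h); simpa using this
  have hx1 := hx.1
  have hx2 := hx.2
  constructor
  · nlinarith
  · nlinarith

/-- The Jacobian factor `s^(-d)` is at most one. -/
lemma setLIntegral_affine_le {g : Eu d → ℝ≥0∞} (hg : Measurable g) {s : ℝ} (hs : 1 ≤ s)
    (h : Eu d) {S T : Set (Eu d)} (hS : MeasurableSet S)
    (hT : MeasurableSet T) (hST : ∀ x ∈ S, s • x + h ∈ T) :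
    ∫⁻ x in S, g (s • x + h) ≤ ∫⁻ x in T, g x := by
  have hs0 : 0 < s := by linarith
  calc _ ≤ ∫⁻ x, T.indicator g (s • x + h) := by
        rw [← lintegral_indicator hS]
        refine lintegral_mono fun x => ?_
        by_cases hx : x ∈ S
        · simp [hx, hST x hx]
        · simp [hx]
    _ = ∫⁻ y, T.indicator g (y + h) ∂(Measure.map (fun x => s • x) volume) := by
        rw [lintegral_map (by fun_prop (disch := measurability)) (by fun_prop)]
    _ = ENNReal.ofReal |(s ^ d)⁻¹| * ∫⁻ y, T.indicator g y := by
        rw [Measure.map_addHaar_smul _ hs0.ne', lintegral_smul_measure, smul_eq_mul,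
          lintegral_add_right_eq_self, finrank_euclideanSpace_fin]
    _ ≤ 1 * ∫⁻ y, T.indicator g y := by
        gcongr
        rw [abs_of_pos (by positivity)]
        simpa using inv_le_one_of_one_le₀ (one_le_pow₀ hs)
    _ = _ := by rw [one_mul, lintegral_indicator hT]

/-- The fundamental theorem of calculus along the segment, then Cauchy-Schwarz in `t`. -/
lemma enorm_sub_sq_le_of_contDiff {g : Eu d → ℝ} (hg : ContDiff ℝ 1 g) (x v : Eu d) :
    ‖g (x + v) - g x‖ₑ ^ 2 ≤
      ‖v‖ₑ ^ 2 * ∫⁻ t in Set.Icc (0 : ℝ) 1, ‖fderiv ℝ g (x + t • v)‖ₑ ^ 2 := by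
  have hc : Continuous (fderiv ℝ g) := hg.continuous_fderiv (by simp)
  have hder : ∀ t ∈ Set.uIcc (0 : ℝ) 1,
      HasDerivAt (fun t : ℝ => g (x + t • v)) (fderiv ℝ g (x + t • v) v) t := fun t _ => by
    have h1 : HasDerivAt (fun t : ℝ => x + t • v) v t := by
      simpa using ((hasDerivAt_id t).smul_const v).const_add x
    exact ((hg.differentiable (by simp) _).hasFDerivAt).comp_hasDerivAt t h1
  have hcont : Continuous fun t : ℝ => fderiv ℝ g (x + t • v) := by fun_prop
  have hI := intervalIntegral.integral_eq_sub_of_hasDerivAt hder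
    ((hcont.clm_apply continuous_const).intervalIntegrable 0 1)
  simp only [one_smul, zero_smul, add_zero] at hI
  have hm : Measurable fun t : ℝ => ‖fderiv ℝ g (x + t • v)‖ₑ := hcont.enorm.measurable
  have h2 : ‖g (x + v) - g x‖ₑ ≤
      ‖v‖ₑ * ∫⁻ t in Set.Icc (0 : ℝ) 1, ‖fderiv ℝ g (x + t • v)‖ₑ := by
    rw [← hI, intervalIntegral.integral_of_le zero_le_one, ← integral_Icc_eq_integral_Ioc,
      ← lintegral_const_mul _ hm]
    refine (enorm_integral_le_lintegral_enorm _).trans (lintegral_mono fun t => ?_)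
    rw [mul_comm]
    exact ContinuousLinearMap.le_opENorm _ _
  calc _ ≤ (‖v‖ₑ * ∫⁻ t in Set.Icc (0 : ℝ) 1, ‖fderiv ℝ g (x + t • v)‖ₑ) ^ 2 := by gcongr
    _ ≤ _ := by rw [mul_pow]; gcongr; exact sq_setLIntegral_Icc_le hm

lemma mollify_affine_difference_le [NeZero d] {β γ ρ c : ℝ} (hρ : 0 < ρ) {f : Eu d → ℝ}
    {G : Eu d → Eu d} (hf : HasH1Gradient d β γ f G) (φ : ContDiffBump (0 : Eu d))
    (hφ : φ.rOut < ρ / 4) (hc0 : 0 ≤ c) (hc1 : c ≤ 1) {h : Eu d} (hh : ‖h‖ ≤ ρ / 2) :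
    ∫⁻ x in shell d ρ, ‖mollify ρ φ f ((1 + c) • x + h) - mollify ρ φ f x‖ₑ ^ 2 ≤
      ENNReal.ofReal (2 * c * ρ + ‖h‖) ^ 2 * ∫⁻ x in fatShell d ρ, ‖G x‖ₑ ^ 2 := by
  have hC := (mollify_fderiv_apply hρ hf φ hφ).1
  set g := mollify ρ φ f
  have hcont : Continuous (fderiv ℝ g) := hC.continuous_fderiv (by simp)
  have hm : Measurable fun x => ‖fderiv ℝ g x‖ₑ ^ 2 := (hcont.enorm.measurable).pow_const 2
  have hT : MeasurableSet {x : Eu d | ρ / 2 ≤ ‖x‖ ∧ ‖x‖ ≤ 5 * ρ} :=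
    (measurableSet_le measurable_const measurable_norm).inter
      (measurableSet_le measurable_norm measurable_const)
  have e : ∀ (x : Eu d) (t : ℝ), x + t • (c • x + h) = (1 + t * c) • x + t • h := fun x t => by
    rw [smul_add, smul_smul, add_smul, one_smul, add_assoc]
  calc _ ≤ ∫⁻ x in shell d ρ, ENNReal.ofReal (2 * c * ρ + ‖h‖) ^ 2 *
        ∫⁻ t in Set.Icc (0 : ℝ) 1, ‖fderiv ℝ g ((1 + t * c) • x + t • h)‖ₑ ^ 2 := by
        refine setLIntegral_mono' (measurableSet_shell ρ) fun x hx => ?_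
        have h1 := enorm_sub_sq_le_of_contDiff hC x (c • x + h)
        simp only [e] at h1
        have e1 : x + (c • x + h) = (1 + c) • x + h := by
          rw [add_smul, one_smul, add_assoc]
        rw [e1] at h1
        refine h1.trans ?_
        gcongr
        rw [← ofReal_norm]
        refine ENNReal.ofReal_le_ofReal ((norm_add_le _ _).trans ?_)
        rw [norm_smul, Real.norm_of_nonneg hc0]
        nlinarith [hx.2]
    _ = ENNReal.ofReal (2 * c * ρ + ‖h‖) ^ 2 * ∫⁻ t in Set.Icc (0 : ℝ) 1,
          ∫⁻ x in shell d ρ, ‖fderiv ℝ g ((1 + t * c) • x + t • h)‖ₑ ^ 2 := by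
        rw [lintegral_const_mul' _ _ (by finiteness), lintegral_lintegral_swap]
        refine Measurable.aemeasurable ?_
        refine hm.comp (f := fun p : Eu d × ℝ => (1 + p.2 * c) • p.1 + p.2 • h) ?_
        fun_prop
    _ ≤ ENNReal.ofReal (2 * c * ρ + ‖h‖) ^ 2 * ∫⁻ t in Set.Icc (0 : ℝ) 1,
          ∫⁻ x in fatShell d ρ, ‖G x‖ₑ ^ 2 := by
        refine mul_le_mul le_rfl ?_ zero_le zero_le
        refine setLIntegral_mono' measurableSet_Icc fun t ht => ?_
        refine (setLIntegral_affine_le hm (by nlinarith [ht.1]) (t • h) (measurableSet_shell ρ) hT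
          fun x hx => affine_mem hρ hc0 hc1 hh ht hx).trans ?_
        exact setLIntegral_mollify_fderiv_le hρ hf φ hφ
    _ = _ := by simp

/-- The basic difference quotient estimate for functions with a weak gradient. -/
lemma affine_difference_le [NeZero d] {β γ ρ c : ℝ} (hρ : 0 < ρ) {f : Eu d → ℝ}
    {G : Eu d → Eu d} (hf : HasH1Gradient d β γ f G)
    (hc0 : 0 ≤ c) (hc1 : c ≤ 1) {h : Eu d} (hh : ‖h‖ ≤ ρ / 2) :
    ∫⁻ x in shell d ρ, ‖f ((1 + c) • x + h) - f x‖ₑ ^ 2 ≤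
      ENNReal.ofReal (2 * c * ρ + ‖h‖) ^ 2 * ∫⁻ x in fatShell d ρ, ‖G x‖ₑ ^ 2 := by
  -- The radii shrink to zero with the fixed ratio `rOut = 2 rIn`, as needed for almost everywhere
  -- convergence of the mollifications.
  let φ : ℕ → ContDiffBump (0 : Eu d) := fun n =>
    { rIn := ρ / 8 / (n + 2)
      rOut := ρ / 4 / (n + 2)
      rIn_pos := by positivity
      rIn_lt_rOut := by gcongr; norm_num }
  have hφ : ∀ n, (φ n).rOut < ρ / 4 := fun n => by
    change ρ / 4 / ((n : ℝ) + 2) < ρ / 4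
    have : (0 : ℝ) ≤ n := Nat.cast_nonneg n
    exact div_lt_self (by positivity) (by linarith)
  have hφ0 : Tendsto (fun n => (φ n).rOut) atTop (𝓝 0) := by
    refine Tendsto.div_atTop (tendsto_const_nhds (x := ρ / 4)) ?_
    exact tendsto_atTop_add_const_right _ _ tendsto_natCast_atTop_atTop
  have hint : Integrable ((fatShell d ρ).indicator f) volume :=
    (integrable_indicator_iff (measurableSet_fatShell ρ)).2 (integrable_restrict_fatShell hρ hf.memLp)
  have hae : ∀ᵐ x : Eu d, Tendsto (fun n => mollify ρ (φ n) f x) atTop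
      (𝓝 ((fatShell d ρ).indicator f x)) :=
    ContDiffBump.ae_convolution_tendsto_right_of_locallyIntegrable (K := 2) hφ0
      (Eventually.of_forall fun n => by
        change ρ / 4 / ((n : ℝ) + 2) ≤ 2 * (ρ / 8 / ((n : ℝ) + 2))
        apply le_of_eq; ring) hint.locallyIntegrable
  -- Convergence is also needed at the displaced point; the affine map pulls null sets back to null
  -- sets.
  have hqmp : Measure.QuasiMeasurePreserving (fun x : Eu d => (1 + c) • x + h) volume volume := by
    have h1 : Measure.QuasiMeasurePreserving (fun x : Eu d => (1 + c) • x) volume volume := by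
      refine ⟨by fun_prop, ?_⟩
      rw [Measure.map_addHaar_smul _ (by linarith : (1 + c) ≠ 0)]
      exact Measure.smul_absolutelyContinuous
    exact (measurePreserving_add_right volume h).quasiMeasurePreserving.comp h1
  have hae2 := hqmp.ae hae
  have hlim : ∀ᵐ x ∂(volume.restrict (shell d ρ)),
      Tendsto (fun n => ‖mollify ρ (φ n) f ((1 + c) • x + h) - mollify ρ (φ n) f x‖ₑ ^ 2) atTop
        (𝓝 (‖f ((1 + c) • x + h) - f x‖ₑ ^ 2)) := by
    filter_upwards [ae_restrict_of_ae hae, ae_restrict_of_ae hae2,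
      ae_restrict_mem (measurableSet_shell ρ)] with x hx1 hx2 hx
    have m1 : x ∈ fatShell d ρ := shell_subset_fatShell hρ hx
    have m2 : (1 + c) • x + h ∈ fatShell d ρ := by
      have := affine_mem hρ hc0 hc1 hh (t := 1) (by simp) hx
      simp only [one_mul, one_smul] at this
      exact ⟨by linarith [this.1], by linarith [this.2]⟩
    rw [Set.indicator_of_mem m1] at hx1
    rw [Set.indicator_of_mem m2] at hx2
    exact ((ENNReal.continuous_pow 2).tendsto _).comp
      ((continuous_enorm.tendsto _).comp (hx2.sub hx1))
  -- Fatou's lemma passes the uniform bound for mollifications to `f`.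
  calc _ = ∫⁻ x in shell d ρ, liminf (fun n =>
        ‖mollify ρ (φ n) f ((1 + c) • x + h) - mollify ρ (φ n) f x‖ₑ ^ 2) atTop := by
        refine lintegral_congr_ae ?_
        filter_upwards [hlim] with x hx
        exact hx.liminf_eq.symm
    _ ≤ liminf (fun n => ∫⁻ x in shell d ρ,
        ‖mollify ρ (φ n) f ((1 + c) • x + h) - mollify ρ (φ n) f x‖ₑ ^ 2) atTop := by
        refine lintegral_liminf_le fun n => ?_
        have hcn := (mollify_fderiv_apply hρ hf (φ n) (hφ n)).1.continuous
        refine Measurable.pow_const (Measurable.enorm ?_) 2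
        exact ((hcn.comp (by fun_prop)).sub hcn).measurable
    _ ≤ _ := by
        refine liminf_le_of_frequently_le' (Frequently.of_forall fun n => ?_)
        exact mollify_affine_difference_le hρ hf (φ n) (hφ n) hc0 hc1 hh

end Mollification

end WLS

namespace WLS

/-! ### Decay of level sets on shells and at infinity. -/

section LevelSets

open Filter Topology
open scoped ENNReal

variable {d : ℕ}

/-- A measurable function with a weak gradient, with both norms at most one. -/
structure InUnitBall (d : ℕ) (β γ : ℝ) (f : Eu d → ℝ) (G : Eu d → Eu d) : Prop where
  grad : HasH1Gradient d β γ f G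
  meas : Measurable f
  mass_le : ∫⁻ x, ‖f x‖ₑ ^ 2 ∂powerMeasure d γ ≤ 1
  energy_le : ∫⁻ x, ‖G x‖ₑ ^ 2 ∂powerMeasure d β ≤ 1

/-- The mean square oscillation of `f` on the ball of radius `r` around `x`. -/
noncomputable def osc (r : ℝ) (f : Eu d → ℝ) (x : Eu d) : ℝ≥0∞ :=
  (volume (Metric.ball (0 : Eu d) r))⁻¹ *
    ∫⁻ h in Metric.ball (0 : Eu d) r, ‖f (x + h) - f x‖ₑ ^ 2

lemma volume_ball_ne_zero {r : ℝ} (hr : 0 < r) : volume (Metric.ball (0 : Eu d) r) ≠ 0 :=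
  (Metric.measure_ball_pos volume _ hr).ne'

lemma volume_ball_ne_top {r : ℝ} : volume (Metric.ball (0 : Eu d) r) ≠ ⊤ :=
  measure_ball_lt_top.ne

/-- The case `c = 0` of `affine_difference_le`, averaged over translations `‖h‖ < r`. Freezing the
weight of the gradient gives `ρ^β`, and restoring that of the mass gives `ρ^(-γ)`. -/
lemma setLIntegral_osc_le [NeZero d] {β γ ρ r : ℝ} (hρ : 0 < ρ) (hr : 0 < r) (hrρ : r ≤ ρ / 2)
    {f : Eu d → ℝ} {G : Eu d → Eu d} (hf : HasH1Gradient d β γ f G) (hm : Measurable f) :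
    ∫⁻ x in shell d ρ, osc r f x ∂powerMeasure d γ ≤
      ENNReal.ofReal (8 ^ |γ| * 8 ^ |β| * (r ^ 2 * ρ ^ (β - γ))) *
        ∫⁻ x, ‖G x‖ₑ ^ 2 ∂powerMeasure d β := by
  set E := ∫⁻ x, ‖G x‖ₑ ^ 2 ∂powerMeasure d β with hE
  have hmeas : Measurable fun p : Eu d × Eu d => ‖f (p.1 + p.2) - f p.1‖ₑ ^ 2 :=
    ((hm.comp (measurable_fst.add measurable_snd)).sub (hm.comp measurable_fst)).enorm.pow_const 2
  have h1 : ∫⁻ x in shell d ρ, osc r f x ≤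
      ENNReal.ofReal (r ^ 2) * (ENNReal.ofReal (8 ^ |β| * ρ ^ β) * E) := by
    unfold osc
    rw [lintegral_const_mul' _ _ (ENNReal.inv_ne_top.2 (volume_ball_ne_zero hr)),
      lintegral_lintegral_swap hmeas.aemeasurable]
    calc _ ≤ (volume (Metric.ball (0 : Eu d) r))⁻¹ * ∫⁻ h in Metric.ball (0 : Eu d) r,
          ENNReal.ofReal (r ^ 2) * (ENNReal.ofReal (8 ^ |β| * ρ ^ β) * E) := by
          refine mul_le_mul le_rfl ?_ zero_le zero_le
          refine setLIntegral_mono' measurableSet_ball fun h hh => ?_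
          have hh' : ‖h‖ < r := by simpa using hh
          have := affine_difference_le hρ hf le_rfl zero_le_one (h := h) (by linarith)
          simp only [add_zero, one_smul, mul_zero, zero_mul, zero_add] at this
          refine this.trans ?_
          gcongr
          · rw [← ENNReal.ofReal_pow (norm_nonneg _)]
            exact ENNReal.ofReal_le_ofReal (by gcongr)
          · refine (setLIntegral_le_powerMeasure hρ β (measurableSet_fatShell ρ) subset_rfl _).trans ?_
            gcongr
            exact setLIntegral_le_lintegral _ _
      _ = _ := by
          rw [setLIntegral_const, mul_comm _ (volume _), ← mul_assoc,
            ENNReal.inv_mul_cancel (volume_ball_ne_zero hr) volume_ball_ne_top, one_mul]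
  refine (setLIntegral_powerMeasure_le hρ γ (measurableSet_shell ρ)
    (shell_subset_fatShell hρ) _).trans ?_
  refine (mul_le_mul le_rfl h1 zero_le zero_le).trans (le_of_eq ?_)
  rw [← mul_assoc, ← mul_assoc, ← ENNReal.ofReal_mul (by positivity),
    ← ENNReal.ofReal_mul (by positivity)]
  congr 2
  rw [Real.rpow_neg hρ.le, Real.rpow_sub hρ]
  field_simp

/-- The ball around `x` stays in the fat shell because `r ≤ ρ/2`. Its average is thus at most the
total mass times the frozen weight, divided by the volume of the ball. -/
lemma ball_average_le [NeZero d] {γ ρ r : ℝ} (hρ : 0 < ρ) (hr : 0 < r) (hrρ : r ≤ ρ / 2)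
    (f : Eu d → ℝ) {x : Eu d} (hx : x ∈ shell d ρ) :
    (volume (Metric.ball (0 : Eu d) r))⁻¹ *
        ∫⁻ h in Metric.ball (0 : Eu d) r, ‖f (x + h)‖ₑ ^ 2 ≤
      ENNReal.ofReal ((volume (Metric.ball (0 : Eu d) 1)).toReal⁻¹ * 8 ^ |γ| * (ρ ^ γ / r ^ d)) *
        ∫⁻ x, ‖f x‖ₑ ^ 2 ∂powerMeasure d γ := by
  have h1 : ∫⁻ h in Metric.ball (0 : Eu d) r, ‖f (x + h)‖ₑ ^ 2 ≤
      ∫⁻ y in fatShell d ρ, ‖f y‖ₑ ^ 2 := by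
    rw [← lintegral_indicator measurableSet_ball, ← lintegral_indicator (measurableSet_fatShell ρ),
      ← lintegral_add_left_eq_self ((fatShell d ρ).indicator fun y => ‖f y‖ₑ ^ 2) x]
    refine lintegral_mono fun h => ?_
    by_cases hh : h ∈ Metric.ball (0 : Eu d) r
    · have hh' : ‖h‖ < r := by simpa using hh
      have e1 := norm_add_le x h
      have e2 : ‖x‖ ≤ ‖x + h‖ + ‖h‖ := by simpa using norm_sub_le (x + h) h
      have : x + h ∈ fatShell d ρ := ⟨by linarith [hx.1], by linarith [hx.2]⟩
      simp [hh', this]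
    · simp [Set.indicator_of_notMem hh]
  have hv : volume (Metric.ball (0 : Eu d) r) =
      ENNReal.ofReal (r ^ d * (volume (Metric.ball (0 : Eu d) 1)).toReal) := by
    rw [Measure.addHaar_ball _ _ hr.le, finrank_euclideanSpace_fin,
      ENNReal.ofReal_mul (by positivity), ENNReal.ofReal_toReal volume_ball_ne_top]
  have hv1 : 0 < (volume (Metric.ball (0 : Eu d) 1)).toReal :=
    ENNReal.toReal_pos (volume_ball_ne_zero one_pos) volume_ball_ne_top
  calc _ ≤ (volume (Metric.ball (0 : Eu d) r))⁻¹ * (ENNReal.ofReal (8 ^ |γ| * ρ ^ γ) *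
        ∫⁻ x, ‖f x‖ₑ ^ 2 ∂powerMeasure d γ) := by
        gcongr
        refine h1.trans ((setLIntegral_le_powerMeasure hρ γ (measurableSet_fatShell ρ)
          subset_rfl _).trans ?_)
        exact mul_le_mul le_rfl (setLIntegral_le_lintegral _ _) zero_le zero_le
    _ = _ := by
        rw [hv, ← ENNReal.ofReal_inv_of_pos (by positivity), ← mul_assoc,
          ← ENNReal.ofReal_mul (by positivity)]
        congr 2
        field_simp

/-- The square of `t`, cut to zero if `|t| ≤ l`. -/
noncomputable def sqAbove (l t : ℝ) : ℝ≥0∞ := if l < |t| then ‖t‖ₑ ^ 2 else 0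

lemma sqAbove_le (l t : ℝ) : sqAbove l t ≤ ‖t‖ₑ ^ 2 := by
  unfold sqAbove; split_ifs <;> simp

lemma measurable_sqAbove (l : ℝ) : Measurable (sqAbove l) := by
  unfold sqAbove
  exact Measurable.ite (measurableSet_lt measurable_const measurable_id.abs)
    (measurable_id.enorm.pow_const 2) measurable_const

lemma enorm_add_sq_le {F : Type*} [NormedAddCommGroup F] (a b : F) :
    ‖a + b‖ₑ ^ 2 ≤ 2 * ‖a‖ₑ ^ 2 + 2 * ‖b‖ₑ ^ 2 := by
  have h : ‖a + b‖ ^ 2 ≤ 2 * ‖a‖ ^ 2 + 2 * ‖b‖ ^ 2 := by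
    have := norm_add_le a b
    nlinarith [sq_nonneg (‖a‖ - ‖b‖), norm_nonneg (a + b), norm_nonneg a, norm_nonneg b]
  have := ENNReal.ofReal_le_ofReal h
  rwa [ENNReal.ofReal_add (by positivity) (by positivity), ENNReal.ofReal_mul (by norm_num),
    ENNReal.ofReal_mul (by norm_num), ENNReal.ofReal_pow (norm_nonneg _),
    ENNReal.ofReal_pow (norm_nonneg _), ENNReal.ofReal_pow (norm_nonneg _), ofReal_norm,
    ofReal_norm, ofReal_norm, ENNReal.ofReal_ofNat] at this

lemma sq_le_osc_add {r : ℝ} (hr : 0 < r) {f : Eu d → ℝ} (hm : Measurable f) (x : Eu d) :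
    ‖f x‖ₑ ^ 2 ≤ 2 * osc r f x + 2 * ((volume (Metric.ball (0 : Eu d) r))⁻¹ *
      ∫⁻ h in Metric.ball (0 : Eu d) r, ‖f (x + h)‖ₑ ^ 2) := by
  have hmx : Measurable fun h => f (x + h) := hm.comp (measurable_const.add measurable_id)
  set v := volume (Metric.ball (0 : Eu d) r)
  have hv0 : v ≠ 0 := volume_ball_ne_zero hr
  have hv1 : v ≠ ⊤ := volume_ball_ne_top
  calc ‖f x‖ₑ ^ 2 = v⁻¹ * ∫⁻ h in Metric.ball (0 : Eu d) r, ‖f x‖ₑ ^ 2 := by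
        rw [setLIntegral_const, mul_comm _ v, ← mul_assoc, ENNReal.inv_mul_cancel hv0 hv1, one_mul]
    _ ≤ v⁻¹ * ∫⁻ h in Metric.ball (0 : Eu d) r,
          (2 * ‖f (x + h) - f x‖ₑ ^ 2 + 2 * ‖f (x + h)‖ₑ ^ 2) := by
        refine mul_le_mul le_rfl (lintegral_mono fun h => ?_) zero_le zero_le
        have := enorm_add_sq_le (f x - f (x + h)) (f (x + h))
        rwa [sub_add_cancel, ← enorm_neg (f x - f (x + h)), neg_sub] at this
    _ = _ := by
        rw [lintegral_add_right _ (by fun_prop), lintegral_const_mul _ (by fun_prop),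
          lintegral_const_mul _ (by fun_prop), osc]
        ring

/-- If the local average is at most `l²`, then `|f x|² ≤ 2 osc + 2 l²`. When `|f x| > 2 l`, the last
term is below `|f x|² / 2` and is absorbed on the left. -/
lemma sqAbove_le_osc {r l : ℝ} (hr : 0 < r) (hl : 0 < l) {f : Eu d → ℝ} (hm : Measurable f)
    {x : Eu d} (hx : (volume (Metric.ball (0 : Eu d) r))⁻¹ *
      ∫⁻ h in Metric.ball (0 : Eu d) r, ‖f (x + h)‖ₑ ^ 2 ≤ ENNReal.ofReal (l ^ 2)) :
    sqAbove (2 * l) (f x) ≤ 4 * osc r f x := by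
  unfold sqAbove
  split_ifs with hlt
  swap
  · exact zero_le
  by_cases htop : osc r f x = ⊤
  · rw [htop]; simp
  have h1 : ‖f x‖ₑ ^ 2 ≤ 2 * osc r f x + 2 * ENNReal.ofReal (l ^ 2) :=
    (sq_le_osc_add hr hm x).trans (by gcongr)
  have h2 : ‖f x‖ₑ ^ 2 = ENNReal.ofReal (|f x| ^ 2) := by
    rw [ENNReal.ofReal_pow (abs_nonneg _), ← Real.norm_eq_abs, ofReal_norm]
  rw [h2] at h1 ⊢
  rw [← ENNReal.ofReal_toReal htop] at h1 ⊢
  set D := (osc r f x).toReal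
  have hD : 0 ≤ D := ENNReal.toReal_nonneg
  have e2 : (2 : ℝ≥0∞) = ENNReal.ofReal 2 := by simp
  have e4 : (4 : ℝ≥0∞) = ENNReal.ofReal 4 := by simp
  rw [e2, ← ENNReal.ofReal_mul (by norm_num), ← ENNReal.ofReal_mul (by norm_num),
    ← ENNReal.ofReal_add (by positivity) (by positivity),
    ENNReal.ofReal_le_ofReal_iff (by positivity)] at h1
  rw [e4, ← ENNReal.ofReal_mul (by norm_num)]
  refine ENNReal.ofReal_le_ofReal ?_
  nlinarith

lemma shell_levelSet_le_of_radius [NeZero d] {β γ ρ r l : ℝ} (hρ : 0 < ρ) (hr : 0 < r)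
    (hrρ : r ≤ ρ / 2) (hl : 0 < l)
    (hrl : (volume (Metric.ball (0 : Eu d) 1)).toReal⁻¹ * 8 ^ |γ| * (ρ ^ γ / r ^ d) ≤ l ^ 2)
    {f : Eu d → ℝ} {G : Eu d → Eu d} (hf : InUnitBall d β γ f G) :
    ∫⁻ x in shell d ρ, sqAbove (2 * l) (f x) ∂powerMeasure d γ ≤
      ENNReal.ofReal (4 * (8 ^ |γ| * 8 ^ |β| * (r ^ 2 * ρ ^ (β - γ)))) := by
  calc _ ≤ ∫⁻ x in shell d ρ, 4 * osc r f x ∂powerMeasure d γ := by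
        refine setLIntegral_mono' (measurableSet_shell ρ) fun x hx => ?_
        refine sqAbove_le_osc hr hl hf.meas ((ball_average_le hρ hr hrρ f (γ := γ) hx).trans ?_)
        calc _ ≤ ENNReal.ofReal (l ^ 2) * 1 := by
              gcongr
              exact hf.mass_le
          _ = _ := mul_one _
    _ = 4 * ∫⁻ x in shell d ρ, osc r f x ∂powerMeasure d γ :=
        lintegral_const_mul' _ _ (by norm_num)
    _ ≤ 4 * (ENNReal.ofReal (8 ^ |γ| * 8 ^ |β| * (r ^ 2 * ρ ^ (β - γ))) * 1) := by
        gcongr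
        refine (setLIntegral_osc_le hρ hr hrρ hf.grad hf.meas).trans ?_
        gcongr
        exact hf.energy_le
    _ = _ := by
        rw [ENNReal.ofReal_mul (by norm_num : (0 : ℝ) ≤ 4), mul_one, ENNReal.ofReal_ofNat]

/-- The decay exponent at infinity. -/
noncomputable def decayExp (d : ℕ) (β γ : ℝ) : ℝ := ((d : ℝ) - 2) / d * γ - β

/-- The radius `r` is chosen as small as `ball_average_le` permits for the level `l`, since the
oscillation costs `r²`. The lower bound on `l² ρ^(d-γ)` says that this radius fits in the shell. -/
lemma shell_levelSet_le (d : ℕ) [NeZero d] (β γ : ℝ) : ∃ C₀ > 0, ∃ C > 0, ∀ ρ l : ℝ, 0 < ρ →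
    0 < l → C₀ ≤ l ^ 2 * ρ ^ (d - γ) → ∀ (f : Eu d → ℝ) (G : Eu d → Eu d),
      InUnitBall d β γ f G → ∫⁻ x in shell d ρ, sqAbove (2 * l) (f x) ∂powerMeasure d γ ≤
        ENNReal.ofReal (C * (l ^ (-(4 / d : ℝ)) * ρ ^ (-decayExp d β γ))) := by
  have hd : (0 : ℝ) < d := by exact_mod_cast NeZero.pos d
  have hd0 : d ≠ 0 := NeZero.ne d
  set v := (volume (Metric.ball (0 : Eu d) 1)).toReal with hv
  have hv1 : 0 < v :=
    ENNReal.toReal_pos (volume_ball_ne_zero one_pos) volume_ball_ne_top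
  set K := v⁻¹ * 8 ^ |γ| with hK
  have hK0 : 0 < K := by positivity
  refine ⟨K * 2 ^ d, by positivity, 4 * (8 ^ |γ| * 8 ^ |β|) * K ^ (2 / d : ℝ), by positivity, ?_⟩
  intro ρ l hρ hl hC f G hf
  -- This solves `K ρ^γ / r^d = l²`. Then `r² ρ^(β-γ)` has `ρ`-exponent `2γ/d + β - γ`, which is
  -- `-decayExp d β γ`.
  set r := (K * (ρ ^ γ / l ^ 2)) ^ (1 / d : ℝ) with hr
  have hr0 : 0 < r := by positivity
  have hrd : r ^ d = K * (ρ ^ γ / l ^ 2) := by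
    rw [hr, ← Real.rpow_natCast, ← Real.rpow_mul (by positivity), one_div_mul_cancel hd.ne',
      Real.rpow_one]
  have hr2 : r ^ 2 * ρ ^ (β - γ) =
      K ^ (2 / d : ℝ) * (l ^ (-(4 / d : ℝ)) * ρ ^ (-decayExp d β γ)) := by
    have : r ^ 2 = (K * (ρ ^ γ / l ^ 2)) ^ (2 / d : ℝ) := by
      rw [hr, ← Real.rpow_natCast, ← Real.rpow_mul (by positivity)]; congr 1; push_cast; ring
    rw [this, Real.mul_rpow hK0.le (by positivity), Real.div_rpow (by positivity) (by positivity),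
      ← Real.rpow_mul hρ.le, ← Real.rpow_natCast l 2, ← Real.rpow_mul hl.le,
      div_eq_mul_inv (ρ ^ _), ← Real.rpow_neg hl.le]
    have e : ρ ^ (-decayExp d β γ) = ρ ^ (γ * (2 / d)) * ρ ^ (β - γ) := by
      rw [← Real.rpow_add hρ]; congr 1; unfold decayExp; field_simp; ring
    rw [e]
    have e' : -((2 : ℕ) * (2 / d) : ℝ) = -(4 / d) := by push_cast; ring
    rw [e']; ring
  have hrρ : r ≤ ρ / 2 := by
    refine le_of_pow_le_pow_left₀ hd0 (by positivity) ?_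
    rw [hrd, div_pow, ← mul_div_assoc, div_le_div_iff₀ (by positivity) (by positivity)]
    have e : ρ ^ d = ρ ^ ((d : ℝ) - γ) * ρ ^ γ := by
      rw [← Real.rpow_add hρ, ← Real.rpow_natCast]; congr 1; ring
    rw [e]
    have : 0 < ρ ^ γ := by positivity
    nlinarith
  refine (shell_levelSet_le_of_radius hρ hr0 hrρ hl ?_ hf).trans (ENNReal.ofReal_le_ofReal ?_)
  · rw [hrd, ← hv, ← hK]
    apply le_of_eq
    field_simp
  · rw [hr2]; apply le_of_eq; ring

lemma tsum_ofReal_geometric {a q : ℝ} (ha : 0 ≤ a) (hq0 : 0 ≤ q) (hq1 : q < 1) :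
    ∑' j : ℕ, ENNReal.ofReal (a * q ^ j) = ENNReal.ofReal (a * (1 - q)⁻¹) := by
  rw [← ENNReal.ofReal_tsum_of_nonneg (fun j => by positivity)
    ((summable_geometric_of_lt_one hq0 hq1).mul_left a), tsum_mul_left,
    tsum_geometric_of_lt_one hq0 hq1]

lemma outer_subset_iUnion_shell {ρ : ℝ} (hρ : 0 < ρ) :
    {x : Eu d | ρ ≤ ‖x‖} ⊆ ⋃ j : ℕ, shell d (ρ * 2 ^ j) := by
  intro x hx
  have hx' : 1 ≤ ‖x‖ / ρ := (one_le_div hρ).2 hx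
  obtain ⟨n, hn1, hn2⟩ := exists_nat_pow_near hx' (one_lt_two)
  rw [le_div_iff₀ hρ] at hn1
  rw [div_lt_iff₀ hρ] at hn2
  refine Set.mem_iUnion.2 ⟨n, ?_, ?_⟩
  · linarith
  · rw [pow_succ] at hn2; linarith

lemma inner_subset_iUnion_shell {ρ : ℝ} :
    {x : Eu d | x ≠ 0 ∧ ‖x‖ < ρ} ⊆ ⋃ j : ℕ, shell d (ρ / 2 * (1 / 2) ^ j) := by
  rintro x ⟨hx0, hx⟩
  have hx0' : 0 < ‖x‖ := norm_pos_iff.2 hx0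
  have hρ : 0 < ρ := hx0'.trans hx
  obtain ⟨n, hn1, hn2⟩ := exists_nat_pow_near_of_lt_one (x := ‖x‖ / ρ) (y := 1 / 2)
    (by positivity) ((div_lt_one hρ).2 hx).le (by norm_num) (by norm_num)
  rcases hn2.lt_or_eq with hn2 | hn2
  · rw [lt_div_iff₀ hρ] at hn1
    rw [div_lt_iff₀ hρ] at hn2
    refine Set.mem_iUnion.2 ⟨n, ?_, ?_⟩
    · rw [pow_succ] at hn1; linarith
    · linarith
  · rw [div_eq_iff hρ.ne'] at hn2
    rcases n with _ | n
    · simp at hn2; linarith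
    · refine Set.mem_iUnion.2 ⟨n, ?_, ?_⟩
      · rw [pow_succ] at hn2; linarith
      · rw [pow_succ] at hn2; linarith

/-- The shell bounds form a geometric series of ratio `2^(-τ)`. The constraint on `l` and `ρ`
persists on larger shells because `γ < d`. -/
lemma outer_levelSet_le (d : ℕ) [NeZero d] (β γ : ℝ) (hγ : γ < d) (hτ : 0 < decayExp d β γ) :
    ∃ C₀ > 0, ∃ C > 0, ∀ ρ l : ℝ, 0 < ρ →
    0 < l → C₀ ≤ l ^ 2 * ρ ^ (d - γ) → ∀ (f : Eu d → ℝ) (G : Eu d → Eu d),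
      InUnitBall d β γ f G →
      ∫⁻ x in {x | ρ ≤ ‖x‖}, sqAbove (2 * l) (f x) ∂powerMeasure d γ ≤
        ENNReal.ofReal (C * (l ^ (-(4 / d : ℝ)) * ρ ^ (-decayExp d β γ))) := by
  obtain ⟨C₀, hC₀, C, hC, H⟩ := shell_levelSet_le d β γ
  set τ := decayExp d β γ
  have hq0 : (0 : ℝ) < 2 ^ (-τ) := by positivity
  have hq1 : (2 : ℝ) ^ (-τ) < 1 := Real.rpow_lt_one_of_one_lt_of_neg one_lt_two (by linarith)
  refine ⟨C₀, hC₀, C * (1 - 2 ^ (-τ))⁻¹, mul_pos hC (inv_pos.2 (by linarith)), ?_⟩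
  intro ρ l hρ hl hρl f G hf
  calc _ ≤ ∫⁻ x in ⋃ j : ℕ, shell d (ρ * 2 ^ j), sqAbove (2 * l) (f x) ∂powerMeasure d γ :=
        lintegral_mono_set (outer_subset_iUnion_shell hρ)
    _ ≤ ∑' j : ℕ, ∫⁻ x in shell d (ρ * 2 ^ j), sqAbove (2 * l) (f x) ∂powerMeasure d γ :=
        lintegral_iUnion_le _ _
    _ ≤ ∑' j : ℕ, ENNReal.ofReal (C * (l ^ (-(4 / d : ℝ)) * ρ ^ (-τ)) * (2 ^ (-τ)) ^ j) := by
        refine ENNReal.tsum_le_tsum fun j => ?_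
        refine (H (ρ * 2 ^ j) l (by positivity) hl (hρl.trans ?_) f G hf).trans (le_of_eq ?_)
        · refine mul_le_mul_of_nonneg_left (Real.rpow_le_rpow hρ.le ?_ (by linarith)) (by positivity)
          exact le_mul_of_one_le_right hρ.le (one_le_pow₀ one_le_two)
        · congr 1
          rw [Real.mul_rpow hρ.le (by positivity), ← Real.rpow_natCast 2 j,
            ← Real.rpow_natCast (2 ^ (-τ)) j, ← Real.rpow_mul zero_le_two,
            ← Real.rpow_mul zero_le_two, mul_comm (j : ℝ)]
          ring
    _ = _ := by
        rw [tsum_ofReal_geometric (by positivity) hq0.le hq1]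
        congr 1; ring

end LevelSets

end WLS

namespace WLS

/-! ### Mass near the origin. -/

section MassNearOrigin

open Filter Topology
open scoped ENNReal

variable {d : ℕ}

/-- Young's inequality with a factor `s` close to 1 on the main term: the factor 2 of
`enorm_add_sq_le` could destroy the contraction in `shell_mass_le`, and would not suffice in
`mass_limit`. -/
lemma enorm_add_sq_le_of_one_lt {F : Type*} [NormedAddCommGroup F] {s : ℝ} (hs : 1 < s) (a b : F) :
    ‖a + b‖ₑ ^ 2 ≤ ENNReal.ofReal s * ‖a‖ₑ ^ 2 + ENNReal.ofReal (s / (s - 1)) * ‖b‖ₑ ^ 2 := by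
  have hs1 : 0 < s - 1 := by linarith
  have h : ‖a + b‖ ^ 2 ≤ s * ‖a‖ ^ 2 + s / (s - 1) * ‖b‖ ^ 2 := by
    have h1 : ‖a + b‖ ^ 2 ≤ (‖a‖ + ‖b‖) ^ 2 := by gcongr; exact norm_add_le a b
    have h2 : s * ‖a‖ ^ 2 + s / (s - 1) * ‖b‖ ^ 2 - (‖a‖ + ‖b‖) ^ 2 =
        ((s - 1) * ‖a‖ - ‖b‖) ^ 2 / (s - 1) := by field_simp; ring
    have h3 : 0 ≤ ((s - 1) * ‖a‖ - ‖b‖) ^ 2 / (s - 1) := by positivity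
    linarith
  have := ENNReal.ofReal_le_ofReal h
  rwa [ENNReal.ofReal_add (by positivity) (by positivity), ENNReal.ofReal_mul (by positivity),
    ENNReal.ofReal_mul (by positivity), ENNReal.ofReal_pow (norm_nonneg _),
    ENNReal.ofReal_pow (norm_nonneg _), ENNReal.ofReal_pow (norm_nonneg _), ofReal_norm,
    ofReal_norm, ofReal_norm] at this

lemma setLIntegral_dilation {γ ρ : ℝ} {g : Eu d → ℝ≥0∞} (hg : Measurable g) :
    ∫⁻ x in shell d ρ, g ((2 : ℝ) • x) ∂powerMeasure d γ =
      ENNReal.ofReal (2 ^ (γ - d)) * ∫⁻ x in shell d (2 * ρ), g x ∂powerMeasure d γ := by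
  have hm : Measurable fun x : Eu d => (2 : ℝ) • x := by fun_prop
  rw [← lintegral_indicator (measurableSet_shell _), ← lintegral_indicator (measurableSet_shell _),
    ← smul_eq_mul, ← lintegral_smul_measure, ← map_smul_powerMeasure γ two_pos,
    lintegral_map (hg.indicator (measurableSet_shell _)) hm]
  refine lintegral_congr fun x => ?_
  have : (2 : ℝ) • x ∈ shell d (2 * ρ) ↔ x ∈ shell d ρ := by
    simp only [shell, Set.mem_ofPred_eq, norm_smul, Real.norm_ofNat]
    constructor <;> rintro ⟨h1, h2⟩ <;> constructor <;> linarith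
  by_cases hx : x ∈ shell d ρ
  · rw [Set.indicator_of_mem hx, Set.indicator_of_mem (this.2 hx)]
  · rw [Set.indicator_of_notMem hx, Set.indicator_of_notMem (fun h => hx (this.1 h))]

/-- Compare `f x` with `f (2x)`, using `affine_difference_le` with `c = 1`, `h = 0`. The change of
variables produces `2^(γ-d) < 1`, and Young's inequality gives back only half of this gain. -/
lemma shell_mass_le (d : ℕ) [NeZero d] (β γ : ℝ) (hγ : γ < d) : ∃ K : ℝ, 0 < K ∧ ∀ ρ : ℝ, 0 < ρ →
    ∀ (f : Eu d → ℝ) (G : Eu d → Eu d), HasH1Gradient d β γ f G → Measurable f →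
      ∫⁻ x in shell d ρ, ‖f x‖ₑ ^ 2 ∂powerMeasure d γ ≤
        ENNReal.ofReal (2 ^ (-((d - γ) / 2))) *
          ∫⁻ x in shell d (2 * ρ), ‖f x‖ₑ ^ 2 ∂powerMeasure d γ +
        ENNReal.ofReal (K * ρ ^ (β + 2 - γ)) * ∫⁻ x, ‖G x‖ₑ ^ 2 ∂powerMeasure d β := by
  set s : ℝ := 2 ^ (((d : ℝ) - γ) / 2) with hs
  have hs1 : 1 < s := Real.one_lt_rpow one_lt_two (by linarith)
  have hs2 : 0 < s / (s - 1) := div_pos (by linarith) (by linarith)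
  refine ⟨s / (s - 1) * (4 * 8 ^ |γ| * 8 ^ |β|), by positivity, ?_⟩
  intro ρ hρ f G hf hm
  have hm2 : Measurable fun x : Eu d => f ((2 : ℝ) • x) := hm.comp (by fun_prop)
  have hdiff : ∫⁻ x in shell d ρ, ‖f ((2 : ℝ) • x) - f x‖ₑ ^ 2 ∂powerMeasure d γ ≤
      ENNReal.ofReal (4 * 8 ^ |γ| * 8 ^ |β| * ρ ^ (β + 2 - γ)) *
        ∫⁻ x, ‖G x‖ₑ ^ 2 ∂powerMeasure d β := by
    have h1 := affine_difference_le hρ hf zero_le_one le_rfl (h := 0) (by simp; linarith)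
    norm_num only [add_zero, norm_zero, one_add_one_eq_two] at h1
    calc _ ≤ ENNReal.ofReal (8 ^ |γ| * ρ ^ (-γ)) * (ENNReal.ofReal (2 * ρ) ^ 2 *
          (ENNReal.ofReal (8 ^ |β| * ρ ^ β) * ∫⁻ x, ‖G x‖ₑ ^ 2 ∂powerMeasure d β)) := by
          refine (setLIntegral_powerMeasure_le hρ γ (measurableSet_shell ρ)
            (shell_subset_fatShell hρ) _).trans ?_
          refine mul_le_mul le_rfl (h1.trans ?_) zero_le zero_le
          refine mul_le_mul le_rfl ?_ zero_le zero_le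
          refine (setLIntegral_le_powerMeasure hρ β (measurableSet_fatShell ρ) subset_rfl _).trans ?_
          exact mul_le_mul le_rfl (setLIntegral_le_lintegral _ _) zero_le zero_le
      _ = _ := by
          rw [← ENNReal.ofReal_pow (by positivity), ← mul_assoc, ← mul_assoc,
            ← ENNReal.ofReal_mul (by positivity), ← ENNReal.ofReal_mul (by positivity)]
          congr 2
          have : ρ ^ (β + 2 - γ) = ρ ^ (-γ) * ρ ^ 2 * ρ ^ β := by
            rw [← Real.rpow_natCast ρ 2, ← Real.rpow_add hρ, ← Real.rpow_add hρ]
            congr 1; push_cast; ring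
          rw [this]; ring
  calc _ ≤ ∫⁻ x in shell d ρ, (ENNReal.ofReal s * ‖f ((2 : ℝ) • x)‖ₑ ^ 2 +
        ENNReal.ofReal (s / (s - 1)) * ‖f ((2 : ℝ) • x) - f x‖ₑ ^ 2) ∂powerMeasure d γ := by
        refine lintegral_mono fun x => ?_
        have := enorm_add_sq_le_of_one_lt hs1 (f ((2 : ℝ) • x)) (f x - f ((2 : ℝ) • x))
        rwa [add_sub_cancel, ← enorm_neg (f x - f ((2 : ℝ) • x)), neg_sub] at this
    _ = ENNReal.ofReal s * ∫⁻ x in shell d ρ, ‖f ((2 : ℝ) • x)‖ₑ ^ 2 ∂powerMeasure d γ +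
        ENNReal.ofReal (s / (s - 1)) *
          ∫⁻ x in shell d ρ, ‖f ((2 : ℝ) • x) - f x‖ₑ ^ 2 ∂powerMeasure d γ := by
        rw [lintegral_add_left (by fun_prop), lintegral_const_mul _ (by fun_prop),
          lintegral_const_mul _ (by fun_prop)]
    _ ≤ _ := by
        refine add_le_add (le_of_eq ?_) ?_
        · rw [setLIntegral_dilation (g := fun x => ‖f x‖ₑ ^ 2) (by fun_prop), ← mul_assoc,
            ← ENNReal.ofReal_mul (by positivity), hs, ← Real.rpow_add two_pos]
          congr 3; ring
        · refine (mul_le_mul le_rfl hdiff zero_le zero_le).trans (le_of_eq ?_)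
          rw [← mul_assoc, ← ENNReal.ofReal_mul (by positivity)]
          congr 2; ring

/-- Without the gradient term, the mass of each shell is at most `q^j` times the finite total mass
for every `j`, with `q < 1`. -/
lemma ae_eq_zero_of_gradient_eq_zero [NeZero d] {β γ : ℝ} (hγ : γ < d) {f : Eu d → ℝ}
    {G : Eu d → Eu d} (hf : HasH1Gradient d β γ f G) (hm : Measurable f)
    (hG : ∫⁻ x, ‖G x‖ₑ ^ 2 ∂powerMeasure d β = 0) : f =ᵐ[volume] 0 := by
  obtain ⟨K, -, H⟩ := shell_mass_le d β γ hγ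
  set q : ℝ := 2 ^ (-(((d : ℝ) - γ) / 2)) with hq
  have hq1 : q < 1 := Real.rpow_lt_one_of_one_lt_of_neg one_lt_two (by linarith)
  set T := ∫⁻ x, ‖f x‖ₑ ^ 2 ∂powerMeasure d γ with hT
  have hTtop : T ≠ ⊤ := ((memLp_two_iff_lintegral hf.memLp.1).1 hf.memLp).ne
  have hstep : ∀ (j : ℕ) (ρ : ℝ), 0 < ρ →
      ∫⁻ x in shell d ρ, ‖f x‖ₑ ^ 2 ∂powerMeasure d γ ≤ ENNReal.ofReal q ^ j * T := by
    intro j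
    induction j with
    | zero => intro ρ hρ; simpa using setLIntegral_le_lintegral _ _
    | succ j ih =>
      intro ρ hρ
      refine (H ρ hρ f G hf hm).trans ?_
      rw [hG, mul_zero, add_zero, pow_succ', mul_assoc]
      exact mul_le_mul le_rfl (ih (2 * ρ) (by positivity)) zero_le zero_le
  have hzero : ∀ ρ : ℝ, 0 < ρ → ∫⁻ x in shell d ρ, ‖f x‖ₑ ^ 2 ∂powerMeasure d γ = 0 := by
    intro ρ hρ
    have hlim : Tendsto (fun j : ℕ => ENNReal.ofReal q ^ j * T) atTop (𝓝 (0 * T)) :=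
      ENNReal.Tendsto.mul_const (ENNReal.tendsto_pow_atTop_nhds_zero_of_lt_one
        (by rw [← ENNReal.ofReal_one]; exact (ENNReal.ofReal_lt_ofReal_iff one_pos).2 hq1))
        (Or.inr hTtop)
    rw [zero_mul] at hlim
    exact le_antisymm (ge_of_tendsto' hlim fun j => hstep j ρ hρ) zero_le
  have hU : ∫⁻ x in ({x | x ≠ 0 ∧ ‖x‖ < 1} ∪ {x | 1 ≤ ‖x‖}), ‖f x‖ₑ ^ 2 ∂powerMeasure d γ = 0 := by
    refine le_antisymm ?_ zero_le
    calc _ ≤ ∫⁻ x in ((⋃ j : ℕ, shell d (1 / 2 * (1 / 2) ^ j)) ∪ ⋃ j : ℕ, shell d (1 * 2 ^ j)),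
          ‖f x‖ₑ ^ 2 ∂powerMeasure d γ :=
          lintegral_mono_set (Set.union_subset_union inner_subset_iUnion_shell
            (outer_subset_iUnion_shell one_pos))
      _ ≤ ∑' j : ℕ, ∫⁻ x in shell d (1 / 2 * (1 / 2) ^ j), ‖f x‖ₑ ^ 2 ∂powerMeasure d γ +
          ∑' j : ℕ, ∫⁻ x in shell d (1 * 2 ^ j), ‖f x‖ₑ ^ 2 ∂powerMeasure d γ :=
          (lintegral_union_le _ _ _).trans
            (add_le_add (lintegral_iUnion_le _ _) (lintegral_iUnion_le _ _))
      _ = 0 := by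
          simp only [add_eq_zero, ENNReal.tsum_eq_zero]
          exact ⟨fun j => hzero _ (by positivity), fun j => hzero _ (by positivity)⟩
  have hS : MeasurableSet ({x : Eu d | x ≠ 0 ∧ ‖x‖ < 1} ∪ {x | 1 ≤ ‖x‖}) :=
    ((measurableSet_singleton 0).compl.inter (measurableSet_lt measurable_norm measurable_const)).union
      (measurableSet_le measurable_const measurable_norm)
  rw [lintegral_eq_zero_iff (by fun_prop), Filter.EventuallyEq, ae_restrict_iff' hS,
    ae_powerMeasure] at hU
  filter_upwards [hU, Measure.ae_ne (volume : Measure (Eu d)) 0] with x hx hx0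
  have := hx (by
    rcases lt_or_ge ‖x‖ 1 with h | h
    · exact Or.inl ⟨hx0, h⟩
    · exact Or.inr h)
  simpa using this

/-- Induction on scales towards the origin, starting from shells of radius at least 1, where the
total mass bound is enough. -/
lemma shell_mass_decay (d : ℕ) [NeZero d] (β γ : ℝ) (hγ : γ < d) (hα : 0 < β + 2 - γ) :
    ∃ σ : ℝ, 0 < σ ∧ ∃ D : ℝ, 0 < D ∧ ∀ (f : Eu d → ℝ) (G : Eu d → Eu d), InUnitBall d β γ f G →
      ∀ ρ : ℝ, 0 < ρ →
        ∫⁻ x in shell d ρ, ‖f x‖ₑ ^ 2 ∂powerMeasure d γ ≤ ENNReal.ofReal (D * ρ ^ σ) := by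
  obtain ⟨K, hK, H⟩ := shell_mass_le d β γ hγ
  -- The first bound makes `q · 2^σ < 1`, so the power law survives the recursion. The second makes
  -- the gradient term `O(ρ^σ)` for `ρ ≤ 1`.
  set σ : ℝ := min (((d : ℝ) - γ) / 4) (β + 2 - γ) with hσ
  have hσ0 : 0 < σ := lt_min (by linarith) hα
  have hσ1 : σ ≤ ((d : ℝ) - γ) / 4 := min_le_left _ _
  have hσ2 : σ ≤ β + 2 - γ := min_le_right _ _
  set q : ℝ := 2 ^ (-(((d : ℝ) - γ) / 2)) with hq
  have hq0 : 0 < q := by positivity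
  have hqσ : q * 2 ^ σ < 1 := by
    rw [hq, ← Real.rpow_add two_pos]
    exact Real.rpow_lt_one_of_one_lt_of_neg one_lt_two (by linarith)
  -- The fixed point of `D ↦ K + D q 2^σ`, raised to at least 1 so that shells with `ρ ≥ 1` are
  -- covered.
  set D : ℝ := max 1 (K / (1 - q * 2 ^ σ)) with hD
  have hD1 : 1 ≤ D := le_max_left _ _
  have hDK : K + D * (q * 2 ^ σ) ≤ D := by
    have : K / (1 - q * 2 ^ σ) ≤ D := le_max_right _ _
    rw [div_le_iff₀ (by linarith)] at this
    linarith
  refine ⟨σ, hσ0, D, by linarith, fun f G hf => ?_⟩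
  have large : ∀ ρ : ℝ, 1 ≤ ρ →
      ∫⁻ x in shell d ρ, ‖f x‖ₑ ^ 2 ∂powerMeasure d γ ≤ ENNReal.ofReal (D * ρ ^ σ) := by
    intro ρ hρ
    refine (setLIntegral_le_lintegral _ _).trans (hf.mass_le.trans ?_)
    rw [← ENNReal.ofReal_one]
    refine ENNReal.ofReal_le_ofReal ?_
    exact one_le_mul_of_one_le_of_one_le hD1 (Real.one_le_rpow hρ hσ0.le)
  have main : ∀ (n : ℕ) (ρ : ℝ), (1 / 2) ^ n ≤ ρ →
      ∫⁻ x in shell d ρ, ‖f x‖ₑ ^ 2 ∂powerMeasure d γ ≤ ENNReal.ofReal (D * ρ ^ σ) := by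
    intro n
    induction n with
    | zero => intro ρ hρ; exact large ρ (by simpa using hρ)
    | succ n ih =>
      intro ρ hρ
      have hρ0 : 0 < ρ := lt_of_lt_of_le (by positivity) hρ
      rcases le_or_gt 1 ρ with h1 | h1
      · exact large ρ h1
      refine (H ρ hρ0 f G hf.grad hf.meas).trans ?_
      have h2 := ih (2 * ρ) (by rw [pow_succ] at hρ; linarith)
      calc _ ≤ ENNReal.ofReal q * ENNReal.ofReal (D * (2 * ρ) ^ σ) +
            ENNReal.ofReal (K * ρ ^ σ) * 1 := by
            have h3 := Real.rpow_le_rpow_of_exponent_ge hρ0 h1.le hσ2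
            have h4 := hf.energy_le
            exact add_le_add (mul_le_mul le_rfl h2 zero_le zero_le)
              (mul_le_mul (ENNReal.ofReal_le_ofReal (by gcongr)) h4 zero_le zero_le)
        _ = ENNReal.ofReal ((K + D * (q * 2 ^ σ)) * ρ ^ σ) := by
            rw [mul_one, ← ENNReal.ofReal_mul hq0.le, ← ENNReal.ofReal_add (by positivity)
              (by positivity), Real.mul_rpow zero_le_two hρ0.le]
            congr 1; ring
        _ ≤ _ := ENNReal.ofReal_le_ofReal (by gcongr)
  intro ρ hρ
  obtain ⟨n, hn⟩ := exists_pow_lt_of_lt_one hρ (by norm_num : (1 / 2 : ℝ) < 1)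
  exact main n ρ hn.le

lemma inner_mass_le (d : ℕ) [NeZero d] (β γ : ℝ) (hγ : γ < d) (hα : 0 < β + 2 - γ) :
    ∃ σ : ℝ, 0 < σ ∧ ∃ D : ℝ, 0 < D ∧ ∀ (f : Eu d → ℝ) (G : Eu d → Eu d), InUnitBall d β γ f G →
      ∀ ρ : ℝ, 0 < ρ →
        ∫⁻ x in {x | ‖x‖ < ρ}, ‖f x‖ₑ ^ 2 ∂powerMeasure d γ ≤ ENNReal.ofReal (D * ρ ^ σ) := by
  obtain ⟨σ, hσ, D, hD, H⟩ := shell_mass_decay d β γ hγ hα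
  have hq0 : (0 : ℝ) < (1 / 2) ^ σ := by positivity
  have hq1 : (1 / 2 : ℝ) ^ σ < 1 := Real.rpow_lt_one (by norm_num) (by norm_num) hσ
  refine ⟨σ, hσ, D * (1 / 2) ^ σ * (1 - (1 / 2) ^ σ)⁻¹,
    mul_pos (by positivity) (inv_pos.2 (by linarith)), fun f G hf ρ hρ => ?_⟩
  have hae : ({x | ‖x‖ < ρ} : Set (Eu d)) =ᵐ[powerMeasure d γ] {x | x ≠ 0 ∧ ‖x‖ < ρ} := by
    have h0 : ∀ᵐ x ∂powerMeasure d γ, x ≠ 0 := by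
      rw [ae_powerMeasure]; exact Measure.ae_ne (volume : Measure (Eu d)) 0
    filter_upwards [h0] with x hx
    exact propext ⟨fun h => ⟨hx, h⟩, fun h => h.2⟩
  rw [setLIntegral_congr hae]
  calc _ ≤ ∫⁻ x in ⋃ j : ℕ, shell d (ρ / 2 * (1 / 2) ^ j), ‖f x‖ₑ ^ 2 ∂powerMeasure d γ :=
        lintegral_mono_set inner_subset_iUnion_shell
    _ ≤ ∑' j : ℕ, ∫⁻ x in shell d (ρ / 2 * (1 / 2) ^ j), ‖f x‖ₑ ^ 2 ∂powerMeasure d γ :=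
        lintegral_iUnion_le _ _
    _ ≤ ∑' j : ℕ, ENNReal.ofReal (D * (1 / 2) ^ σ * ρ ^ σ * ((1 / 2) ^ σ) ^ j) := by
        refine ENNReal.tsum_le_tsum fun j => (H f G hf _ (by positivity)).trans (le_of_eq ?_)
        congr 1
        rw [Real.mul_rpow (by positivity) (by positivity), div_eq_mul_one_div ρ,
          Real.mul_rpow hρ.le (by positivity), ← Real.rpow_natCast (1 / 2) j,
          ← Real.rpow_natCast ((1 / 2) ^ σ) j, ← Real.rpow_mul (by positivity),
          ← Real.rpow_mul (by positivity), mul_comm (j : ℝ)]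
        ring
    _ = _ := by
        rw [tsum_ofReal_geometric (by positivity) hq0.le hq1]
        congr 1; ring

/-! ### Uniform integrability of the entropy and tightness. -/

/-- Space is cut at a radius `ρ = l^(-c)` shrinking with the level: the whole mass inside is a power
of `ρ`, and outside the level set estimate loses only part of its factor `l^(-4/d)`. -/
lemma levelSet_le (d : ℕ) [NeZero d] (β γ : ℝ) (hγ : γ < d) (hα : 0 < β + 2 - γ)
    (hτ : 0 < decayExp d β γ) : ∃ L : ℝ, 1 ≤ L ∧ ∃ q : ℝ, 0 < q ∧ ∃ C : ℝ, 0 < C ∧ ∀ l : ℝ, L ≤ l →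
      ∀ (f : Eu d → ℝ) (G : Eu d → Eu d), InUnitBall d β γ f G →
        ∫⁻ x, sqAbove (2 * l) (f x) ∂powerMeasure d γ ≤ ENNReal.ofReal (C * l ^ (-q)) := by
  obtain ⟨σ, hσ, D, hD, H1⟩ := inner_mass_le d β γ hγ hα
  obtain ⟨C₀, hC₀, C, hC, H2⟩ := outer_levelSet_le d β γ hγ hτ
  have hd : (0 : ℝ) < d := by exact_mod_cast NeZero.pos d
  set τ := decayExp d β γ
  -- The bound `c (d - γ) ≤ 1` yields `l² ρ^(d-γ) ≥ l ≥ C₀`; the bound `c τ ≤ 2/d` leaves at least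
  -- `l^(-2/d)` outside.
  set c : ℝ := min (1 / (d - γ)) (2 / d / τ) with hc
  have hγ' : 0 < (d : ℝ) - γ := by linarith
  have hc0 : 0 < c := lt_min (by positivity) (by positivity)
  have hc1 : c * (d - γ) ≤ 1 := by
    have : c ≤ 1 / (d - γ) := min_le_left _ _
    rwa [le_div_iff₀ hγ'] at this
  have hc2 : c * τ ≤ 2 / d := by
    have : c ≤ 2 / d / τ := min_le_right _ _
    rwa [le_div_iff₀ hτ] at this
  set q : ℝ := min (2 / d) (c * σ) with hq
  refine ⟨max 1 C₀, le_max_left _ _, q, lt_min (by positivity) (by positivity), D + C,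
    by positivity, fun l hl f G hf => ?_⟩
  have hl1 : 1 ≤ l := (le_max_left _ _).trans hl
  have hl0 : 0 < l := by linarith
  set ρ := l ^ (-c) with hρ
  have hρ0 : 0 < ρ := by positivity
  have hcond : C₀ ≤ l ^ 2 * ρ ^ ((d : ℝ) - γ) := by
    refine ((le_max_right _ _).trans hl).trans ?_
    rw [hρ, ← Real.rpow_mul hl0.le, ← Real.rpow_natCast, ← Real.rpow_add hl0]
    conv_lhs => rw [← Real.rpow_one l]
    refine Real.rpow_le_rpow_of_exponent_le hl1 ?_
    push_cast; linarith
  have hS : MeasurableSet {x : Eu d | ‖x‖ < ρ} := measurableSet_lt measurable_norm measurable_const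
  have hSc : {x : Eu d | ‖x‖ < ρ}ᶜ = {x | ρ ≤ ‖x‖} := by ext x; simp
  rw [← lintegral_add_compl _ hS, hSc]
  calc _ ≤ ENNReal.ofReal (D * ρ ^ σ) + ENNReal.ofReal (C * (l ^ (-(4 / d : ℝ)) * ρ ^ (-τ))) :=
        add_le_add ((lintegral_mono fun x => sqAbove_le _ _).trans (H1 f G hf ρ hρ0))
          (H2 ρ l hρ0 hl0 hcond f G hf)
    _ ≤ ENNReal.ofReal (D * l ^ (-q)) + ENNReal.ofReal (C * l ^ (-q)) := by
        gcongr
        · rw [hρ, ← Real.rpow_mul hl0.le]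
          refine Real.rpow_le_rpow_of_exponent_le hl1 ?_
          have : q ≤ c * σ := min_le_right _ _
          linarith
        · rw [hρ, ← Real.rpow_mul hl0.le, ← Real.rpow_add hl0]
          refine Real.rpow_le_rpow_of_exponent_le hl1 ?_
          have : q ≤ 2 / d := min_le_left _ _
          have e : (4 / d : ℝ) = 2 * (2 / d) := by ring
          linarith
    _ = _ := by
        rw [← ENNReal.ofReal_add (by positivity) (by positivity)]; congr 1; ring

/-- The logarithm counts dyadic levels: `log (t²/M²)` is `2 log 2` times `log₂ (|t|/M)`, and the
number of `j` with `M 2^j < |t|` is at least that. -/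
lemma sq_mul_log_le_tsum_sqAbove {M : ℝ} (hM : 0 < M) (t : ℝ) :
    ‖t‖ₑ ^ 2 * ENNReal.ofReal (Real.log (t ^ 2 / M ^ 2)) ≤
      ∑' j : ℕ, ENNReal.ofReal (2 * Real.log 2) * sqAbove (M * 2 ^ j) t := by
  rcases le_or_gt |t| M with h | h
  · have : Real.log (t ^ 2 / M ^ 2) ≤ 0 := by
      refine Real.log_nonpos (by positivity) (div_le_one_of_le₀ ?_ (by positivity))
      rw [← sq_abs t]; gcongr
    rw [ENNReal.ofReal_of_nonpos this, mul_zero]; exact zero_le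
  have ht : 0 < |t| := hM.trans h
  have hlog2 : 0 < Real.log 2 := Real.log_pos one_lt_two
  set A := Real.log (|t| / M) / Real.log 2 with hA
  have hA0 : 0 < A := div_pos (Real.log_pos ((one_lt_div hM).2 h)) hlog2
  set N := ⌈A⌉₊ with hN
  have hterm : ∀ j ∈ Finset.range N, sqAbove (M * 2 ^ j) t = ‖t‖ₑ ^ 2 := by
    intro j hj
    have hjA : (j : ℝ) < A := Nat.lt_ceil.1 (Finset.mem_range.1 hj)
    have : M * 2 ^ j < |t| := by
      rw [hA, lt_div_iff₀ hlog2, ← Real.log_pow, Real.log_lt_log_iff (by positivity)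
        (by positivity), lt_div_iff₀ hM] at hjA
      linarith
    unfold sqAbove; rw [if_pos this]
  refine le_trans ?_ (ENNReal.sum_le_tsum (Finset.range N))
  rw [Finset.sum_congr rfl fun j hj => by rw [hterm j hj], Finset.sum_const, Finset.card_range,
    nsmul_eq_mul, mul_comm, ← mul_assoc, ← ENNReal.ofReal_natCast,
    ← ENNReal.ofReal_mul (by positivity)]
  gcongr
  have e : Real.log (t ^ 2 / M ^ 2) = A * (2 * Real.log 2) := by
    rw [hA, ← sq_abs t, ← div_pow, Real.log_pow]; field_simp; push_cast; ring
  rw [e]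
  gcongr
  exact Nat.le_ceil A

/-- Uniform integrability of the positive part of the entropy density. -/
lemma entropy_above_le (d : ℕ) [NeZero d] (β γ : ℝ) (hγ : γ < d) (hα : 0 < β + 2 - γ)
    (hτ : 0 < decayExp d β γ) : ∃ L : ℝ, 1 ≤ L ∧ ∃ q : ℝ, 0 < q ∧ ∃ C : ℝ, 0 < C ∧ ∀ M : ℝ, L ≤ M →
      ∀ (f : Eu d → ℝ) (G : Eu d → Eu d), InUnitBall d β γ f G →
        ∫⁻ x, ‖f x‖ₑ ^ 2 * ENNReal.ofReal (Real.log (f x ^ 2 / M ^ 2)) ∂powerMeasure d γ ≤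
          ENNReal.ofReal (C * M ^ (-q)) := by
  obtain ⟨L, hL, q, hq, C, hC, H⟩ := levelSet_le d β γ hγ hα hτ
  have hlog2 : 0 < Real.log 2 := Real.log_pos one_lt_two
  have hq0 : (0 : ℝ) < 2 ^ (-q) := by positivity
  have hq1 : (2 : ℝ) ^ (-q) < 1 := Real.rpow_lt_one_of_one_lt_of_neg one_lt_two (by linarith)
  -- The threshold is doubled because `levelSet_le` concerns the level `2 l`: it is applied with `l
  -- = (M/2) 2^j`.
  refine ⟨2 * L, by linarith, q, hq, 2 * Real.log 2 * C * 2 ^ q * (1 - 2 ^ (-q))⁻¹,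
    mul_pos (by positivity) (inv_pos.2 (by linarith)), fun M hM f G hf => ?_⟩
  have hM0 : 0 < M := by linarith
  calc _ ≤ ∫⁻ x, ∑' j : ℕ, ENNReal.ofReal (2 * Real.log 2) * sqAbove (M * 2 ^ j) (f x)
        ∂powerMeasure d γ := lintegral_mono fun x => sq_mul_log_le_tsum_sqAbove hM0 (f x)
    _ = ∑' j : ℕ, ENNReal.ofReal (2 * Real.log 2) *
        ∫⁻ x, sqAbove (M * 2 ^ j) (f x) ∂powerMeasure d γ := by
        have hmj : ∀ j : ℕ, Measurable fun x =>
            ENNReal.ofReal (2 * Real.log 2) * sqAbove (M * 2 ^ j) (f x) := fun j =>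
          ((measurable_sqAbove _).comp hf.meas).const_mul _
        rw [lintegral_tsum fun j => (hmj j).aemeasurable]
        refine tsum_congr fun j => ?_
        rw [lintegral_const_mul' _ _ ENNReal.ofReal_ne_top]
    _ ≤ ∑' j : ℕ, ENNReal.ofReal (2 * Real.log 2 * C * 2 ^ q * M ^ (-q) * (2 ^ (-q)) ^ j) := by
        refine ENNReal.tsum_le_tsum fun j => ?_
        have h1 : 1 ≤ (2 : ℝ) ^ j := one_le_pow₀ one_le_two
        have := H (M / 2 * 2 ^ j) (by nlinarith) f G hf
        rw [show 2 * (M / 2 * 2 ^ j) = M * 2 ^ j by ring] at this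
        refine (mul_le_mul le_rfl this zero_le zero_le).trans (le_of_eq ?_)
        rw [← ENNReal.ofReal_mul (by positivity)]
        congr 1
        rw [Real.mul_rpow (by positivity) (by positivity), Real.div_rpow hM0.le zero_le_two,
          ← Real.rpow_natCast 2 j, ← Real.rpow_natCast (2 ^ (-q)) j,
          ← Real.rpow_mul zero_le_two, ← Real.rpow_mul zero_le_two, mul_comm (j : ℝ),
          Real.rpow_neg zero_le_two q]
        field_simp
    _ = _ := by
        rw [tsum_ofReal_geometric (by positivity) hq0.le hq1]
        congr 1; ring

/-- For `0 < |t| ≤ 2 l < 1` the factor `-log t²` is at least `-log (2 l)² > 0`, so small values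
carry little mass when their negative entropy is bounded. -/
lemma enorm_sq_le_sqAbove_add {l : ℝ} (hl : 0 < l) (hl1 : 2 * l < 1) (t : ℝ) :
    ‖t‖ₑ ^ 2 ≤ sqAbove (2 * l) t +
      ENNReal.ofReal (-Real.log ((2 * l) ^ 2))⁻¹ * (‖t‖ₑ ^ 2 * ENNReal.ofReal (-Real.log (t ^ 2))) := by
  rcases eq_or_ne t 0 with rfl | ht
  · simp
  unfold sqAbove
  split_ifs with h
  · exact le_self_add
  have ht0 : 0 < t ^ 2 := by positivity
  have h1 : 0 < -Real.log ((2 * l) ^ 2) := by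
    have : (2 * l) ^ 2 < 1 := by nlinarith
    linarith [Real.log_neg (by positivity) this]
  have h2 : -Real.log ((2 * l) ^ 2) ≤ -Real.log (t ^ 2) := by
    have : t ^ 2 ≤ (2 * l) ^ 2 := by rw [← sq_abs t]; gcongr; exact not_lt.1 h
    linarith [Real.log_le_log ht0 this]
  rw [zero_add, mul_left_comm, ← ENNReal.ofReal_mul (by positivity)]
  refine le_mul_of_one_le_right zero_le ?_
  rw [ENNReal.one_le_ofReal, inv_mul_eq_div, one_le_div h1]
  exact h2

/-- Tightness at infinity of functions whose entropy is bounded from below. -/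
lemma exists_radius_mass_le (d : ℕ) [NeZero d] (β γ : ℝ) (hγ : γ < d)
    (hτ : 0 < decayExp d β γ) (N δ : ℝ) (hN : 0 < N) (hδ : 0 < δ) : ∃ R : ℝ, 0 < R ∧
      ∀ (f : Eu d → ℝ) (G : Eu d → Eu d), InUnitBall d β γ f G →
        ∫⁻ x, ‖f x‖ₑ ^ 2 * ENNReal.ofReal (-Real.log (f x ^ 2)) ∂powerMeasure d γ ≤
          ENNReal.ofReal N →
        ∫⁻ x in {x | R ≤ ‖x‖}, ‖f x‖ₑ ^ 2 ∂powerMeasure d γ ≤ ENNReal.ofReal δ := by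
  obtain ⟨C₀, hC₀, C, hC, H⟩ := outer_levelSet_le d β γ hγ hτ
  set τ := decayExp d β γ
  -- With this level `-log (2 l)² = 2 N / δ`, so values below it contribute at most `δ/2`; then `R`
  -- is taken large to make the rest at most `δ/2`.
  set l : ℝ := Real.exp (-(N / δ)) / 2 with hl
  have hl0 : 0 < l := by positivity
  have hl1 : 2 * l < 1 := by
    rw [hl, mul_div_cancel₀ _ two_ne_zero, Real.exp_lt_one_iff]
    have := div_pos hN hδ; linarith
  have hlog : -Real.log ((2 * l) ^ 2) = 2 * (N / δ) := by
    rw [hl, mul_div_cancel₀ _ two_ne_zero, Real.log_pow, Real.log_exp]; push_cast; ring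
  have t1 : Tendsto (fun R : ℝ => l ^ 2 * R ^ ((d : ℝ) - γ)) atTop atTop :=
    (tendsto_rpow_atTop (by linarith)).const_mul_atTop (by positivity)
  have t2 : Tendsto (fun R : ℝ => C * (l ^ (-(4 / d : ℝ)) * R ^ (-τ))) atTop
      (𝓝 (C * (l ^ (-(4 / d : ℝ)) * 0))) :=
    ((tendsto_rpow_neg_atTop hτ).const_mul _).const_mul _
  rw [mul_zero, mul_zero] at t2
  obtain ⟨R, hR1, hR2, hR0⟩ := ((t1.eventually_ge_atTop C₀).and
    ((t2.eventually_lt_const (half_pos hδ)).and (eventually_gt_atTop 0))).exists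
  refine ⟨R, hR0, fun f G hf hfN => ?_⟩
  have hm1 : Measurable fun x => sqAbove (2 * l) (f x) := (measurable_sqAbove _).comp hf.meas
  calc _ ≤ ∫⁻ x in {x | R ≤ ‖x‖}, (sqAbove (2 * l) (f x) +
        ENNReal.ofReal (-Real.log ((2 * l) ^ 2))⁻¹ *
          (‖f x‖ₑ ^ 2 * ENNReal.ofReal (-Real.log (f x ^ 2)))) ∂powerMeasure d γ :=
        lintegral_mono fun x => enorm_sq_le_sqAbove_add hl0 hl1 (f x)
    _ = ∫⁻ x in {x | R ≤ ‖x‖}, sqAbove (2 * l) (f x) ∂powerMeasure d γ +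
        ENNReal.ofReal (-Real.log ((2 * l) ^ 2))⁻¹ * ∫⁻ x in {x | R ≤ ‖x‖},
          ‖f x‖ₑ ^ 2 * ENNReal.ofReal (-Real.log (f x ^ 2)) ∂powerMeasure d γ := by
        rw [lintegral_add_left hm1, lintegral_const_mul' _ _ ENNReal.ofReal_ne_top]
    _ ≤ ENNReal.ofReal (δ / 2) + ENNReal.ofReal (-Real.log ((2 * l) ^ 2))⁻¹ * ENNReal.ofReal N := by
        refine add_le_add ((H R l hR0 hl0 hR1 f G hf).trans (ENNReal.ofReal_le_ofReal hR2.le)) ?_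
        exact mul_le_mul le_rfl ((setLIntegral_le_lintegral _ _).trans hfN) zero_le zero_le
    _ = ENNReal.ofReal δ := by
        rw [hlog, ← ENNReal.ofReal_mul (by positivity), ← ENNReal.ofReal_add (by positivity)
          (by positivity)]
        congr 1
        field_simp
        ring

end MassNearOrigin

end WLS

namespace WLS

/-! ### Weak compactness in the weighted `L²` spaces. -/

section WeakCompactness

open Filter Topology
open scoped ENNReal InnerProductSpace

variable {d : ℕ}

/-- Sequential Banach-Alaoglu, transported to `H` by the Riesz isomorphism. -/
lemma exists_weakly_convergent_subseq {H : Type*} [NormedAddCommGroup H] [InnerProductSpace ℝ H]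
    [CompleteSpace H] [TopologicalSpace.SeparableSpace H] (u : ℕ → H) (hu : ∀ n, ‖u n‖ ≤ 1) :
    ∃ (φ : ℕ → ℕ) (v : H), StrictMono φ ∧ ‖v‖ ≤ 1 ∧
      ∀ w, Tendsto (fun n => ⟪u (φ n), w⟫_ℝ) atTop (𝓝 ⟪v, w⟫_ℝ) := by
  let T : H → WeakDual ℝ H := fun x => StrongDual.toWeakDual (InnerProductSpace.toDual ℝ H x)
  obtain ⟨a, ha, φ, hφ, hlim⟩ := WeakDual.isSeqCompact_closedBall ℝ H 0 1
    (x := fun n => T (u n)) (fun n => by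
      simp only [Set.mem_preimage, Metric.mem_closedBall, dist_zero_right, T]
      change ‖InnerProductSpace.toDual ℝ H (u n)‖ ≤ 1
      simpa using hu n)
  refine ⟨φ, (InnerProductSpace.toDual ℝ H).symm (WeakDual.toStrongDual a), hφ, ?_, fun w => ?_⟩
  · rw [LinearIsometryEquiv.norm_map]
    simpa using ha
  · have h1 : Tendsto (fun n => (T (u (φ n))) w) atTop (𝓝 (a w)) :=
      ((WeakDual.eval_continuous w).tendsto a).comp hlim
    rw [InnerProductSpace.toDual_symm_apply]
    exact h1

lemma exists_weakly_convergent_subseq_memLp {X : Type*} [MeasurableSpace X]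
    [MeasurableSpace.CountablyGenerated X] {μ : Measure X} [SigmaFinite μ] {F : Type*}
    [NormedAddCommGroup F] [InnerProductSpace ℝ F] [CompleteSpace F]
    [TopologicalSpace.SeparableSpace F] (u : ℕ → X → F)
    (hu : ∀ n, MemLp (u n) 2 μ) (hu1 : ∀ n, ∫⁻ x, ‖u n x‖ₑ ^ 2 ∂μ ≤ 1) :
    ∃ (φ : ℕ → ℕ) (v : X → F), StrictMono φ ∧ StronglyMeasurable v ∧ MemLp v 2 μ ∧
      ∫⁻ x, ‖v x‖ₑ ^ 2 ∂μ ≤ 1 ∧ ∀ w, MemLp w 2 μ →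
        Tendsto (fun n => ∫ x, ⟪u (φ n) x, w x⟫_ℝ ∂μ) atTop (𝓝 (∫ x, ⟪v x, w x⟫_ℝ ∂μ)) := by
  have : Fact ((2 : ℝ≥0∞) ≠ ⊤) := ⟨by norm_num⟩
  have hnorm : ∀ f : Lp F 2 μ, ‖f‖ ≤ 1 ↔ ∫⁻ x, ‖f x‖ₑ ^ 2 ∂μ ≤ 1 := fun f => by
    have h1 : ‖f‖ ^ 2 = ∫ x, ‖f x‖ ^ 2 ∂μ := by
      rw [← real_inner_self_eq_norm_sq, L2.inner_def]
      simp
    rw [← ofReal_integral_norm_sq (Lp.memLp f), ← h1, ENNReal.ofReal_le_one, sq_le_one_iff₀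
      (norm_nonneg _)]
  obtain ⟨φ, v, hφ, hv, hlim⟩ := exists_weakly_convergent_subseq (fun n => (hu n).toLp (u n))
    (fun n => by
      rw [hnorm]
      refine le_trans (le_of_eq (lintegral_congr_ae ?_)) (hu1 n)
      filter_upwards [(hu n).coeFn_toLp] with x hx
      rw [hx])
  refine ⟨φ, v, hφ, Lp.stronglyMeasurable v, Lp.memLp v, (hnorm v).1 hv, fun w hw => ?_⟩
  have h := hlim (hw.toLp w)
  simp only [L2.inner_def] at h
  have e1 : ∀ n, ∫ x, ⟪(hu (φ n)).toLp (u (φ n)) x, hw.toLp w x⟫_ℝ ∂μ =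
      ∫ x, ⟪u (φ n) x, w x⟫_ℝ ∂μ := fun n => integral_congr_ae (by
    filter_upwards [(hu (φ n)).coeFn_toLp, hw.coeFn_toLp] with x hx1 hx2
    rw [hx1, hx2])
  have e2 : ∫ x, ⟪v x, hw.toLp w x⟫_ℝ ∂μ = ∫ x, ⟪v x, w x⟫_ℝ ∂μ := integral_congr_ae (by
    filter_upwards [hw.coeFn_toLp] with x hx2
    rw [hx2])
  simpa only [e1, e2] using h

/-- Multiplication by `‖x‖^a` identifies `L²_{-a}` with `L²_a`, so pairings with respect to Lebesgue
measure become inner products in `L²_a`. -/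
lemma memLp_weight_smul [NeZero d] {F : Type*} [NormedAddCommGroup F] [NormedSpace ℝ F] {a : ℝ}
    {ψ : Eu d → F} (hψ : MemLp ψ 2 (powerMeasure d (-a))) :
    MemLp (fun x => ‖x‖ ^ a • ψ x) 2 (powerMeasure d a) := by
  have hm : AEStronglyMeasurable ψ (volume : Measure (Eu d)) :=
    hψ.1.mono_ac (absolutelyContinuous_powerMeasure d (-a))
  have hw : AEStronglyMeasurable (fun x : Eu d => ‖x‖ ^ a) (volume : Measure (Eu d)) :=
    (measurable_norm.pow_const a).aestronglyMeasurable
  have h := (memLp_two_iff_lintegral hψ.1).1 hψ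
  have hms : AEStronglyMeasurable (fun x : Eu d => ‖x‖ ^ a • ψ x) (powerMeasure d a) :=
    (hw.smul hm).mono_ac (powerMeasure_absolutelyContinuous d a)
  rw [memLp_two_iff_lintegral hms]
  refine lt_of_le_of_lt (le_of_eq ?_) h
  rw [lintegral_powerMeasure, lintegral_powerMeasure]
  refine lintegral_congr_ae ?_
  filter_upwards [Measure.ae_ne (volume : Measure (Eu d)) 0] with x hx
  have hx0 : 0 < ‖x‖ := norm_pos_iff.2 hx
  rw [enorm_smul, mul_pow, ← mul_assoc, Real.enorm_of_nonneg (by positivity),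
    ← ENNReal.ofReal_pow (by positivity), ← ENNReal.ofReal_mul (by positivity)]
  congr 2
  rw [← Real.rpow_natCast, ← Real.rpow_mul hx0.le, ← Real.rpow_add hx0]
  congr 1; push_cast; ring

lemma integral_inner_weight [NeZero d] {F : Type*} [NormedAddCommGroup F] [InnerProductSpace ℝ F]
    (a : ℝ) (f ψ : Eu d → F) :
    ∫ x, ⟪f x, ‖x‖ ^ a • ψ x⟫_ℝ ∂powerMeasure d a = ∫ x, ⟪f x, ψ x⟫_ℝ := by
  rw [integral_powerMeasure]
  refine integral_congr_ae ?_
  filter_upwards [Measure.ae_ne (volume : Measure (Eu d)) 0] with x hx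
  have hx0 : 0 < ‖x‖ := norm_pos_iff.2 hx
  rw [inner_smul_right, smul_eq_mul, ← mul_assoc, ← Real.rpow_add hx0]
  simp

/-- The integrability conditions on a test function say that both sides of the weak gradient
identity are weakly continuous functionals, of `f` in `L²_γ` and of `G` in `L²_β`. -/
lemma hasH1Gradient_of_weak_limit [NeZero d] {β γ : ℝ} {f : ℕ → Eu d → ℝ} {G : ℕ → Eu d → Eu d}
    {f₀ : Eu d → ℝ} {G₀ : Eu d → Eu d} (h : ∀ n, HasH1Gradient d β γ (f n) (G n))
    (hf₀ : MemLp f₀ 2 (powerMeasure d γ)) (hG₀ : MemLp G₀ 2 (powerMeasure d β))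
    (hf : ∀ w, MemLp w 2 (powerMeasure d γ) → Tendsto (fun n => ∫ x, ⟪f n x, w x⟫_ℝ ∂powerMeasure d γ)
      atTop (𝓝 (∫ x, ⟪f₀ x, w x⟫_ℝ ∂powerMeasure d γ)))
    (hG : ∀ w, MemLp w 2 (powerMeasure d β) → Tendsto (fun n => ∫ x, ⟪G n x, w x⟫_ℝ ∂powerMeasure d β)
      atTop (𝓝 (∫ x, ⟪G₀ x, w x⟫_ℝ ∂powerMeasure d β))) :
    HasH1Gradient d β γ f₀ G₀ := by
  refine ⟨hf₀, hG₀, fun φ hφ v => ?_⟩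
  have m1 : MemLp (fun x => fderiv ℝ φ x v) 2 (powerMeasure d (-γ)) :=
    (ContinuousLinearMap.apply ℝ ℝ v).comp_memLp' hφ.memLp_fderiv
  have m2 : MemLp (fun x => φ x • v) 2 (powerMeasure d (-β)) :=
    (ContinuousLinearMap.toSpanSingleton ℝ v).comp_memLp' hφ.memLp
  have l1 := hf _ (memLp_weight_smul m1)
  have l2 := hG _ (memLp_weight_smul m2)
  simp only [integral_inner_weight] at l1 l2
  have e1 : ∀ g : Eu d → ℝ, ∫ x, ⟪g x, fderiv ℝ φ x v⟫_ℝ = ∫ x, g x * fderiv ℝ φ x v := fun g =>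
    integral_congr_ae (Eventually.of_forall fun x => by simp [mul_comm])
  have e2 : ∀ g : Eu d → Eu d, ∫ x, ⟪g x, φ x • v⟫_ℝ = ∫ x, φ x * ⟪g x, v⟫_ℝ := fun g =>
    integral_congr_ae (Eventually.of_forall fun x => by simp [inner_smul_right])
  simp only [e1] at l1
  simp only [e2] at l2
  refine tendsto_nhds_unique l1 ?_
  simp only [fun n => (h n).integral_eq φ hφ v]
  exact l2.neg

end WeakCompactness

/-! ### Local strong convergence through ball averages. -/

section StrongConvergence

open Filter Topology
open scoped ENNReal InnerProductSpace

variable {d : ℕ}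

/-- The average of `u` over the ball of radius `r` around `x`. -/
noncomputable def ballAverage (r : ℝ) (u : Eu d → ℝ) (x : Eu d) : ℝ :=
  (volume (Metric.ball (0 : Eu d) r)).toReal⁻¹ * ∫ h in Metric.ball (0 : Eu d) r, u (x + h)

lemma enorm_sq_average_le {r : ℝ} (hr : 0 < r) {g : Eu d → ℝ} (hg : Measurable g) :
    ‖(volume (Metric.ball (0 : Eu d) r)).toReal⁻¹ * ∫ h in Metric.ball (0 : Eu d) r, g h‖ₑ ^ 2 ≤
      (volume (Metric.ball (0 : Eu d) r))⁻¹ * ∫⁻ h in Metric.ball (0 : Eu d) r, ‖g h‖ₑ ^ 2 := by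
  set v := volume (Metric.ball (0 : Eu d) r)
  have hv0 : v ≠ 0 := volume_ball_ne_zero hr
  have hv1 : v ≠ ⊤ := volume_ball_ne_top
  have hv : ‖v.toReal⁻¹‖ₑ = v⁻¹ := by
    rw [Real.enorm_of_nonneg (by positivity), ENNReal.ofReal_inv_of_pos (ENNReal.toReal_pos hv0 hv1),
      ENNReal.ofReal_toReal hv1]
  rw [enorm_mul, hv]
  calc _ ≤ (v⁻¹ * ∫⁻ h in Metric.ball (0 : Eu d) r, ‖g h‖ₑ) ^ 2 := by
        refine pow_le_pow_left₀ zero_le (mul_le_mul le_rfl ?_ zero_le zero_le) 2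
        exact enorm_integral_le_lintegral_enorm _
    _ = (∫⁻ h in Metric.ball (0 : Eu d) r, v⁻¹ * ‖g h‖ₑ) ^ 2 := by
        rw [lintegral_const_mul' _ _ (ENNReal.inv_ne_top.2 hv0)]
    _ ≤ ∫⁻ h in Metric.ball (0 : Eu d) r, v⁻¹ * ‖g h‖ₑ ^ 2 := by
        refine sq_lintegral_mul_le aemeasurable_const hg.enorm.aemeasurable ?_
        rw [setLIntegral_const, ENNReal.inv_mul_cancel hv0 hv1]
    _ = _ := lintegral_const_mul' _ _ (ENNReal.inv_ne_top.2 hv0)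

lemma add_mem_fatShell {ρ r : ℝ} (hrρ : r ≤ ρ / 2) {x h : Eu d}
    (hx : x ∈ shell d ρ) (hh : h ∈ Metric.ball (0 : Eu d) r) : x + h ∈ fatShell d ρ := by
  have hh' : ‖h‖ < r := by simpa using hh
  have e1 := norm_add_le x h
  have e2 : ‖x‖ ≤ ‖x + h‖ + ‖h‖ := by simpa using norm_sub_le (x + h) h
  have hρ : 0 < ρ := by linarith [hx.1, hx.2]
  exact ⟨by linarith [hx.1], by linarith [hx.2]⟩

lemma integrableOn_ball_add [NeZero d] {γ ρ r : ℝ} (hρ : 0 < ρ) (hrρ : r ≤ ρ / 2) {u : Eu d → ℝ}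
    (hu : MemLp u 2 (powerMeasure d γ)) {x : Eu d} (hx : x ∈ shell d ρ) :
    IntegrableOn (fun h => u (x + h)) (Metric.ball (0 : Eu d) r) volume := by
  have h1 : Integrable ((fatShell d ρ).indicator u) volume :=
    (integrable_indicator_iff (measurableSet_fatShell ρ)).2 (integrable_restrict_fatShell hρ hu)
  refine ((h1.comp_add_left x).integrableOn (s := Metric.ball (0 : Eu d) r)).congr_fun
    (fun h hh => ?_) measurableSet_ball
  simp [Set.indicator_of_mem (add_mem_fatShell hrρ hx hh)]

/-- Unlike `sq_le_osc_add`, the square is taken outside the average. The average is then a linear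
functional of `u`, so weak convergence applies to it. -/
lemma sq_le_osc_add_average [NeZero d] {γ ρ r : ℝ} (hρ : 0 < ρ) (hr : 0 < r) (hrρ : r ≤ ρ / 2)
    {u : Eu d → ℝ} (hm : Measurable u) (hu : MemLp u 2 (powerMeasure d γ)) {x : Eu d}
    (hx : x ∈ shell d ρ) : ‖u x‖ₑ ^ 2 ≤ 2 * osc r u x + 2 * ‖ballAverage r u x‖ₑ ^ 2 := by
  have hv0 : (volume (Metric.ball (0 : Eu d) r)).toReal ≠ 0 :=
    (ENNReal.toReal_pos (volume_ball_ne_zero hr) volume_ball_ne_top).ne'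
  have e : u x - ballAverage r u x = (volume (Metric.ball (0 : Eu d) r)).toReal⁻¹ *
      ∫ h in Metric.ball (0 : Eu d) r, -(u (x + h) - u x) := by
    unfold ballAverage
    have h1 : ∫ h in Metric.ball (0 : Eu d) r, -(u (x + h) - u x) =
        (volume (Metric.ball (0 : Eu d) r)).toReal * u x -
          ∫ h in Metric.ball (0 : Eu d) r, u (x + h) := by
      simp only [neg_sub]
      have hc : IntegrableOn (fun _ : Eu d => u x) (Metric.ball (0 : Eu d) r) volume :=
        integrableOn_const volume_ball_ne_top
      rw [integral_sub hc (integrableOn_ball_add hρ hrρ hu hx), setIntegral_const, smul_eq_mul]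
      rfl
    rw [h1, mul_sub, ← mul_assoc, inv_mul_cancel₀ hv0, one_mul]
  have h2 := enorm_add_sq_le (u x - ballAverage r u x) (ballAverage r u x)
  rw [sub_add_cancel] at h2
  refine h2.trans ?_
  have hmx : Measurable fun h => -(u (x + h) - u x) :=
    ((hm.comp (measurable_const.add measurable_id)).sub measurable_const).neg
  have h3 := enorm_sq_average_le hr hmx
  rw [← e] at h3
  simp only [enorm_neg] at h3
  unfold osc
  gcongr

lemma memLp_weight_indicator_ball [NeZero d] {γ ρ r c : ℝ} (hρ : 0 < ρ) (hrρ : r ≤ ρ / 2)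
    {x : Eu d} (hx : x ∈ shell d ρ) :
    MemLp (fun y => ‖y‖ ^ γ • (Metric.ball x r).indicator (fun _ => c) y) 2 (powerMeasure d γ) := by
  have hsub : Metric.ball x r ⊆ fatShell d ρ := fun y hy => by
    have := add_mem_fatShell hrρ hx (h := y - x) (by simpa [dist_eq_norm] using hy)
    simpa using this
  refine memLp_weight_smul ?_
  rw [memLp_indicator_iff_restrict measurableSet_ball]
  have : IsFiniteMeasure ((powerMeasure d (-γ)).restrict (Metric.ball x r)) := by
    refine ⟨?_⟩
    rw [← lintegral_one]
    refine (setLIntegral_powerMeasure_le hρ (-γ) measurableSet_ball hsub _).trans_lt ?_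
    refine ENNReal.mul_lt_top ENNReal.ofReal_lt_top ?_
    rw [lintegral_one, Measure.restrict_apply_univ]
    exact measure_ball_lt_top
  exact memLp_const c

/-- This writes the average as a pairing with a fixed element of `L²_γ`, so that it passes to weak
limits. -/
lemma ballAverage_eq_integral [NeZero d] {γ r : ℝ} (u : Eu d → ℝ) (x : Eu d) :
    ballAverage r u x = ∫ y, ⟪u y, ‖y‖ ^ γ • (Metric.ball x r).indicator
      (fun _ => (volume (Metric.ball (0 : Eu d) r)).toReal⁻¹) y⟫_ℝ ∂powerMeasure d γ := by
  rw [integral_inner_weight, ballAverage, ← integral_indicator measurableSet_ball,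
    ← integral_const_mul, ← integral_add_left_eq_self (fun y => ⟪u y, (Metric.ball x r).indicator
      (fun _ => (volume (Metric.ball (0 : Eu d) r)).toReal⁻¹) y⟫_ℝ) x]
  refine integral_congr_ae (Eventually.of_forall fun h => ?_)
  by_cases hh : h ∈ Metric.ball (0 : Eu d) r
  · have : x + h ∈ Metric.ball x r := by simpa using hh
    simp only [Set.indicator_of_mem hh, Set.indicator_of_mem this, RCLike.inner_apply,
      conj_trivial]
  · have : x + h ∉ Metric.ball x r := by simpa using hh
    simp only [Set.indicator_of_notMem hh, Set.indicator_of_notMem this, inner_zero_right, mul_zero]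

/-- Local compactness: weak convergence with bounded gradients implies strong convergence on
shells. -/
lemma tendsto_setLIntegral_shell [NeZero d] {β γ ρ : ℝ} (hρ : 0 < ρ) {u : ℕ → Eu d → ℝ}
    {W : ℕ → Eu d → Eu d} (h : ∀ n, HasH1Gradient d β γ (u n) (W n)) (hm : ∀ n, Measurable (u n))
    {K : ℝ≥0∞} (hK : K ≠ ⊤) (hu : ∀ n, ∫⁻ x, ‖u n x‖ₑ ^ 2 ∂powerMeasure d γ ≤ K)
    (hW : ∀ n, ∫⁻ x, ‖W n x‖ₑ ^ 2 ∂powerMeasure d β ≤ K)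
    (hweak : ∀ w, MemLp w 2 (powerMeasure d γ) →
      Tendsto (fun n => ∫ x, ⟪u n x, w x⟫_ℝ ∂powerMeasure d γ) atTop (𝓝 0)) :
    Tendsto (fun n => ∫⁻ x in shell d ρ, ‖u n x‖ₑ ^ 2 ∂powerMeasure d γ) atTop (𝓝 0) := by
  -- At fixed radius the averages tend to zero pointwise by weak convergence and are uniformly
  -- bounded on the shell, which has finite measure: dominated convergence.
  have hav : ∀ r : ℝ, 0 < r → r ≤ ρ / 2 → Tendsto (fun n => ∫⁻ x in shell d ρ,
      ‖ballAverage r (u n) x‖ₑ ^ 2 ∂powerMeasure d γ) atTop (𝓝 0) := by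
    intro r hr hrρ
    set B := ENNReal.ofReal ((volume (Metric.ball (0 : Eu d) 1)).toReal⁻¹ * 8 ^ |γ| *
      (ρ ^ γ / r ^ d)) * K with hB
    have hBtop : B ≠ ⊤ := ENNReal.mul_ne_top ENNReal.ofReal_ne_top hK
    have hfin : powerMeasure d γ (shell d ρ) ≠ ⊤ := by
      rw [← Measure.restrict_apply_univ, ← lintegral_one]
      refine ((setLIntegral_powerMeasure_le hρ γ (measurableSet_shell ρ)
        (shell_subset_fatShell hρ) _).trans_lt ?_).ne
      refine ENNReal.mul_lt_top ENNReal.ofReal_lt_top ?_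
      rw [lintegral_one, Measure.restrict_apply_univ]
      refine (measure_mono (t := Metric.ball 0 (2 * ρ)) fun x hx => ?_).trans_lt measure_ball_lt_top
      simpa using hx.2
    have hmA : ∀ n, Measurable (ballAverage r (u n)) := fun n => by
      unfold ballAverage
      refine Measurable.const_mul (StronglyMeasurable.measurable ?_) _
      refine StronglyMeasurable.integral_prod_right
        (f := fun (x : Eu d) (h : Eu d) => u n (x + h)) ?_
      exact ((hm n).comp (measurable_fst.add measurable_snd)).stronglyMeasurable
    have := tendsto_lintegral_of_dominated_convergence (μ := (powerMeasure d γ).restrict (shell d ρ))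
      (F := fun n x => ‖ballAverage r (u n) x‖ₑ ^ 2) (f := fun _ => 0) (fun _ => B)
      (fun n => (hmA n).enorm.pow_const 2)
      (fun n => by
        filter_upwards [ae_restrict_mem (measurableSet_shell ρ)] with x hx
        refine (enorm_sq_average_le hr (g := fun h => u n (x + h))
          ((hm n).comp (measurable_const.add measurable_id))).trans ?_
        refine (ball_average_le hρ hr hrρ (u n) (γ := γ) hx).trans ?_
        exact mul_le_mul le_rfl (hu n) zero_le zero_le)
      (by
        rw [lintegral_const, Measure.restrict_apply_univ]
        exact ENNReal.mul_ne_top hBtop hfin)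
      (by
        filter_upwards [ae_restrict_mem (measurableSet_shell ρ)] with x hx
        have h1 := hweak _ (memLp_weight_indicator_ball (γ := γ)
          (c := (volume (Metric.ball (0 : Eu d) r)).toReal⁻¹) hρ hrρ hx)
        simp only [← ballAverage_eq_integral] at h1
        have h2 := ((ENNReal.continuous_pow 2).tendsto _).comp ((continuous_enorm.tendsto _).comp h1)
        simpa [Function.comp_def] using h2)
    simpa using this
  have hbound : ∀ r : ℝ, 0 < r → r ≤ ρ / 2 → ∀ n,
      ∫⁻ x in shell d ρ, ‖u n x‖ₑ ^ 2 ∂powerMeasure d γ ≤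
        2 * (ENNReal.ofReal (8 ^ |γ| * 8 ^ |β| * (r ^ 2 * ρ ^ (β - γ))) * K) +
        2 * ∫⁻ x in shell d ρ, ‖ballAverage r (u n) x‖ₑ ^ 2 ∂powerMeasure d γ := by
    intro r hr hrρ n
    have hmosc : Measurable (osc r (u n)) := by
      unfold osc
      refine Measurable.const_mul ?_ _
      refine Measurable.lintegral_prod_right'
        (f := fun p : Eu d × Eu d => ‖u n (p.1 + p.2) - u n p.1‖ₑ ^ 2) ?_
      exact (((hm n).comp (measurable_fst.add measurable_snd)).sub
        ((hm n).comp measurable_fst)).enorm.pow_const 2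
    calc _ ≤ ∫⁻ x in shell d ρ, (2 * osc r (u n) x + 2 * ‖ballAverage r (u n) x‖ₑ ^ 2)
          ∂powerMeasure d γ := setLIntegral_mono' (measurableSet_shell ρ) fun x hx =>
            sq_le_osc_add_average hρ hr hrρ (hm n) (h n).memLp hx
      _ = 2 * ∫⁻ x in shell d ρ, osc r (u n) x ∂powerMeasure d γ +
          2 * ∫⁻ x in shell d ρ, ‖ballAverage r (u n) x‖ₑ ^ 2 ∂powerMeasure d γ := by
          rw [lintegral_add_left (hmosc.const_mul _), lintegral_const_mul' _ _ (by norm_num),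
            lintegral_const_mul' _ _ (by norm_num)]
      _ ≤ _ := by
          gcongr
          exact (setLIntegral_osc_le hρ hr hrρ (h n) (hm n)).trans
            (mul_le_mul le_rfl (hW n) zero_le zero_le)
  rw [ENNReal.tendsto_nhds_zero]
  intro ε hε
  -- The oscillation term is `O(r²)` uniformly in `n`, so `r` is fixed first and `n` is sent to
  -- infinity afterwards.
  have hr : Tendsto (fun r : ℝ => 2 * (ENNReal.ofReal (8 ^ |γ| * 8 ^ |β| * (r ^ 2 * ρ ^ (β - γ))) * K))
      (𝓝[>] 0) (𝓝 0) := by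
    have h1 : Tendsto (fun r : ℝ => 8 ^ |γ| * 8 ^ |β| * (r ^ 2 * ρ ^ (β - γ))) (𝓝[>] 0)
        (𝓝 (8 ^ |γ| * 8 ^ |β| * ((0 : ℝ) ^ 2 * ρ ^ (β - γ)))) := by
      refine tendsto_nhdsWithin_of_tendsto_nhds (Continuous.tendsto ?_ 0)
      fun_prop
    have h2 := ENNReal.Tendsto.const_mul (ENNReal.Tendsto.mul_const (ENNReal.tendsto_ofReal h1)
      (Or.inr hK)) (Or.inr (by norm_num : (2 : ℝ≥0∞) ≠ ⊤))
    simpa using h2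
  have hε2 : 0 < ε / 2 := ENNReal.half_pos hε.ne'
  obtain ⟨r, hr1, hr2, hr3⟩ := ((hr.eventually (ge_mem_nhds hε2)).and
    ((eventually_mem_nhdsWithin).and (nhdsWithin_le_nhds
      (ge_mem_nhds (by positivity : 0 < ρ / 2))))).exists
  have h3 := ENNReal.Tendsto.const_mul (hav r hr2 hr3) (Or.inr (by norm_num : (2 : ℝ≥0∞) ≠ ⊤))
  rw [mul_zero] at h3
  filter_upwards [h3.eventually (ge_mem_nhds hε2)] with n hn
  calc _ ≤ _ := hbound r hr2 hr3 n
    _ ≤ ε / 2 + ε / 2 := add_le_add hr1 hn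
    _ = ε := ENNReal.add_halves ε

end StrongConvergence

end WLS

namespace WLS

/-! ### Linear operations and dilations on weak gradients. -/

section LinearStructure

open Filter Topology
open scoped ENNReal InnerProductSpace

variable {d : ℕ}

lemma integrable_inner_of_memLp [NeZero d] {F : Type*} [NormedAddCommGroup F]
    [InnerProductSpace ℝ F] {a : ℝ} {f ψ : Eu d → F} (hf : MemLp f 2 (powerMeasure d a))
    (hψ : MemLp ψ 2 (powerMeasure d (-a))) : Integrable (fun x => ⟪f x, ψ x⟫_ℝ) := by
  have h1 : Integrable (fun x => ⟪f x, ‖x‖ ^ a • ψ x⟫_ℝ) (powerMeasure d a) := by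
    have h2 := memLp_weight_smul hψ
    have h3 := hf.norm.integrable_mul h2.norm
    exact h3.mono (hf.1.inner h2.1) (Eventually.of_forall fun x => by
      simpa using norm_inner_le_norm (𝕜 := ℝ) (f x) (‖x‖ ^ a • ψ x))
  unfold powerMeasure at h1
  rw [integrable_withDensity_iff_integrable_smul' (measurable_weight d a)
    (Eventually.of_forall fun x => ENNReal.ofReal_lt_top)] at h1
  refine h1.congr ?_
  filter_upwards [Measure.ae_ne (volume : Measure (Eu d)) 0] with x hx
  have hx0 : 0 < ‖x‖ := norm_pos_iff.2 hx
  rw [ENNReal.toReal_ofReal (by positivity), inner_smul_right, smul_eq_mul, ← mul_assoc,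
    ← Real.rpow_add hx0]
  simp

lemma HasH1Gradient.integrable_left [NeZero d] {β γ : ℝ} {f : Eu d → ℝ} {G : Eu d → Eu d}
    (h : HasH1Gradient d β γ f G) {φ : Eu d → ℝ} (hφ : IsTestFunction d β γ φ) (v : Eu d) :
    Integrable fun x => f x * fderiv ℝ φ x v := by
  have m1 : MemLp (fun x => fderiv ℝ φ x v) 2 (powerMeasure d (-γ)) :=
    (ContinuousLinearMap.apply ℝ ℝ v).comp_memLp' hφ.memLp_fderiv
  simpa [mul_comm] using integrable_inner_of_memLp h.memLp m1

lemma HasH1Gradient.integrable_right [NeZero d] {β γ : ℝ} {f : Eu d → ℝ} {G : Eu d → Eu d}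
    (h : HasH1Gradient d β γ f G) {φ : Eu d → ℝ} (hφ : IsTestFunction d β γ φ) (v : Eu d) :
    Integrable fun x => φ x * ⟪G x, v⟫_ℝ := by
  have m2 : MemLp (fun x => φ x • v) 2 (powerMeasure d (-β)) :=
    (ContinuousLinearMap.toSpanSingleton ℝ v).comp_memLp' hφ.memLp
  simpa [inner_smul_right] using integrable_inner_of_memLp h.memLp_gradient m2

lemma HasH1Gradient.sub [NeZero d] {β γ : ℝ} {f g : Eu d → ℝ} {G H : Eu d → Eu d}
    (hf : HasH1Gradient d β γ f G) (hg : HasH1Gradient d β γ g H) :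
    HasH1Gradient d β γ (f - g) (G - H) := by
  refine ⟨hf.memLp.sub hg.memLp, hf.memLp_gradient.sub hg.memLp_gradient, fun φ hφ v => ?_⟩
  have e1 : ∀ x, (f - g) x * fderiv ℝ φ x v = f x * fderiv ℝ φ x v - g x * fderiv ℝ φ x v :=
    fun x => by simp [sub_mul]
  have e2 : ∀ x, φ x * ⟪(G - H) x, v⟫_ℝ = φ x * ⟪G x, v⟫_ℝ - φ x * ⟪H x, v⟫_ℝ :=
    fun x => by simp [inner_sub_left, mul_sub]
  simp only [e1, e2]
  rw [integral_sub (hf.integrable_left hφ v) (hg.integrable_left hφ v),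
    integral_sub (hf.integrable_right hφ v) (hg.integrable_right hφ v),
    hf.integral_eq φ hφ v, hg.integral_eq φ hφ v]
  ring

lemma HasH1Gradient.congr [NeZero d] {β γ : ℝ} {f g : Eu d → ℝ} {G : Eu d → Eu d}
    (hf : HasH1Gradient d β γ f G) (hfg : f =ᵐ[volume] g) : HasH1Gradient d β γ g G := by
  refine ⟨(memLp_congr_ae ((powerMeasure_absolutelyContinuous d γ).ae_eq hfg)).1 hf.memLp,
    hf.memLp_gradient, fun φ hφ v => ?_⟩
  rw [← hf.integral_eq φ hφ v]
  refine integral_congr_ae ?_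
  filter_upwards [hfg] with x hx
  rw [hx]

lemma HasH1Gradient.const_smul {β γ : ℝ} {f : Eu d → ℝ} {G : Eu d → Eu d}
    (hf : HasH1Gradient d β γ f G) (s : ℝ) :
    HasH1Gradient d β γ (fun x => s * f x) (fun x => s • G x) := by
  refine ⟨hf.memLp.const_mul s, hf.memLp_gradient.const_smul s, fun φ hφ v => ?_⟩
  have e1 : ∀ x, s * f x * fderiv ℝ φ x v = s * (f x * fderiv ℝ φ x v) := fun x => by ring
  have e2 : ∀ x, φ x * ⟪s • G x, v⟫_ℝ = s * (φ x * ⟪G x, v⟫_ℝ) :=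
    fun x => by rw [real_inner_smul_left]; ring
  simp only [e1, e2]
  rw [integral_const_mul, integral_const_mul, hf.integral_eq φ hφ v]
  ring

lemma memLp_comp_dilation {F : Type*} [NormedAddCommGroup F] {a c : ℝ} (hc : 0 < c) {f : Eu d → F}
    (hf : MemLp f 2 (powerMeasure d a)) : MemLp (fun x => f (c • x)) 2 (powerMeasure d a) := by
  have hm : Measurable fun x : Eu d => c • x := by fun_prop
  have h1 : MemLp f 2 (Measure.map (fun x : Eu d => c • x) (powerMeasure d a)) := by
    rw [map_smul_powerMeasure a hc]
    exact hf.smul_measure ENNReal.ofReal_ne_top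
  exact h1.comp_of_map hm.aemeasurable

lemma integral_powerMeasure_dilation {F : Type*} [NormedAddCommGroup F] [NormedSpace ℝ F] {a c : ℝ}
    (hc : 0 < c) (g : Eu d → F) : ∫ x, g (c • x) ∂powerMeasure d a =
      c ^ (a - d) • ∫ x, g x ∂powerMeasure d a := by
  have he : MeasurableEmbedding fun x : Eu d => c • x :=
    (Homeomorph.smulOfNeZero c hc.ne').measurableEmbedding
  rw [← he.integral_map, map_smul_powerMeasure a hc, integral_smul_measure,
    ENNReal.toReal_ofReal (by positivity)]

lemma lintegral_powerMeasure_dilation {a c : ℝ} (hc : 0 < c) (g : Eu d → ℝ≥0∞) :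
    ∫⁻ x, g (c • x) ∂powerMeasure d a =
      ENNReal.ofReal (c ^ (a - d)) * ∫⁻ x, g x ∂powerMeasure d a := by
  have he : MeasurableEmbedding fun x : Eu d => c • x :=
    (Homeomorph.smulOfNeZero c hc.ne').measurableEmbedding
  rw [← he.lintegral_map, map_smul_powerMeasure a hc, lintegral_smul_measure, smul_eq_mul]

lemma integrable_powerMeasure_dilation {F : Type*} [NormedAddCommGroup F] {a c : ℝ}
    (hc : 0 < c) {g : Eu d → F} (hg : Integrable g (powerMeasure d a)) :
    Integrable (fun x => g (c • x)) (powerMeasure d a) := by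
  have hm : Measurable fun x : Eu d => c • x := by fun_prop
  have h1 : Integrable g (Measure.map (fun x : Eu d => c • x) (powerMeasure d a)) := by
    rw [map_smul_powerMeasure a hc]
    exact hg.smul_measure ENNReal.ofReal_ne_top
  exact h1.comp_measurable hm

/-- Test functions are rescaled by `c⁻¹`; their integrability conditions survive because the power
measures are homogeneous. -/
lemma HasH1Gradient.dilation {β γ c : ℝ} (hc : 0 < c) {f : Eu d → ℝ} {G : Eu d → Eu d}
    (hf : HasH1Gradient d β γ f G) :
    HasH1Gradient d β γ (fun x => f (c • x)) (fun x => c • G (c • x)) := by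
  refine ⟨memLp_comp_dilation hc hf.memLp, (memLp_comp_dilation hc hf.memLp_gradient).const_smul c,
    fun φ hφ v => ?_⟩
  set ψ : Eu d → ℝ := fun y => φ (c⁻¹ • y) with hψ
  have hder : ∀ y, fderiv ℝ ψ y = c⁻¹ • fderiv ℝ φ (c⁻¹ • y) := fun y => by
    rw [hψ, fderiv_comp_smul]
  have hψt : IsTestFunction d β γ ψ := by
    refine ⟨hφ.contDiff.comp (contDiff_const_smul _), ?_, memLp_comp_dilation (inv_pos.2 hc) hφ.memLp, ?_⟩
    · exact hφ.hasCompactSupport.comp_homeomorph (Homeomorph.smulOfNeZero c⁻¹ (inv_ne_zero hc.ne'))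
    · have : fderiv ℝ ψ = fun y => c⁻¹ • fderiv ℝ φ (c⁻¹ • y) := funext hder
      rw [this]
      exact (memLp_comp_dilation (inv_pos.2 hc) hφ.memLp_fderiv).const_smul c⁻¹
  have h := hf.integral_eq ψ hψt v
  have e1 : ∫ x, f (c • x) * fderiv ℝ φ x v = |(c ^ d)⁻¹| • ∫ y, c * (f y * fderiv ℝ ψ y v) := by
    have := Measure.integral_comp_smul (volume : Measure (Eu d))
      (fun y => c * (f y * fderiv ℝ ψ y v)) c
    rw [finrank_euclideanSpace_fin] at this
    rw [← this]
    refine integral_congr_ae (Eventually.of_forall fun x => ?_)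
    simp only [hder, smul_smul, inv_mul_cancel₀ hc.ne', one_smul, smul_apply,
      smul_eq_mul]
    field_simp
  have e2 : ∫ x, φ x * ⟪c • G (c • x), v⟫_ℝ = |(c ^ d)⁻¹| • ∫ y, c * (ψ y * ⟪G y, v⟫_ℝ) := by
    have := Measure.integral_comp_smul (volume : Measure (Eu d))
      (fun y => c * (ψ y * ⟪G y, v⟫_ℝ)) c
    rw [finrank_euclideanSpace_fin] at this
    rw [← this]
    refine integral_congr_ae (Eventually.of_forall fun x => ?_)
    simp only [hψ, smul_smul, inv_mul_cancel₀ hc.ne', one_smul, real_inner_smul_left]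
    ring
  rw [e1, e2, integral_const_mul, integral_const_mul, h]
  simp

end LinearStructure

/-! ### Global strong convergence. -/

section StrongLimit

open Filter Topology
open scoped ENNReal InnerProductSpace

variable {d : ℕ}

lemma lintegral_sub_sq_le {X F : Type*} [MeasurableSpace X] [NormedAddCommGroup F] {μ : Measure X}
    {f g : X → F} (hf : AEStronglyMeasurable f μ) :
    ∫⁻ x, ‖f x - g x‖ₑ ^ 2 ∂μ ≤ 2 * ∫⁻ x, ‖f x‖ₑ ^ 2 ∂μ + 2 * ∫⁻ x, ‖g x‖ₑ ^ 2 ∂μ := by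
  calc _ ≤ ∫⁻ x, (2 * ‖f x‖ₑ ^ 2 + 2 * ‖g x‖ₑ ^ 2) ∂μ := lintegral_mono fun x => by
        simpa [sub_eq_add_neg] using enorm_add_sq_le (f x) (-g x)
    _ = _ := by
        rw [lintegral_add_left' ((hf.enorm.pow_const 2).const_mul _),
          lintegral_const_mul' _ _ (by norm_num), lintegral_const_mul' _ _ (by norm_num)]

lemma tendsto_outer_mass {f : Eu d → ℝ} {γ : ℝ} (hf : MemLp f 2 (powerMeasure d γ))
    (hm : Measurable f) :
    Tendsto (fun n : ℕ => ∫⁻ x in {x | (n : ℝ) ≤ ‖x‖}, ‖f x‖ₑ ^ 2 ∂powerMeasure d γ) atTop (𝓝 0) := by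
  have hS : ∀ n : ℕ, MeasurableSet {x : Eu d | (n : ℝ) ≤ ‖x‖} := fun n =>
    measurableSet_le measurable_const measurable_norm
  have h := tendsto_lintegral_of_dominated_convergence (μ := powerMeasure d γ)
    (F := fun n : ℕ => ({x : Eu d | (n : ℝ) ≤ ‖x‖}).indicator fun x => ‖f x‖ₑ ^ 2) (f := fun _ => 0)
    (fun x => ‖f x‖ₑ ^ 2) (fun n => (hm.enorm.pow_const 2).indicator (hS n))
    (fun n => Eventually.of_forall fun x => Set.indicator_le_self _ _ x)
    ((memLp_two_iff_lintegral hf.1).1 hf).ne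
    (Eventually.of_forall fun x => by
      refine tendsto_const_nhds.congr' ?_
      filter_upwards [(tendsto_natCast_atTop_atTop (R := ℝ)).eventually_gt_atTop ‖x‖] with n hn
      rw [Set.indicator_of_notMem]
      simpa using hn)
  simp only [lintegral_zero] at h
  refine h.congr fun n => ?_
  rw [lintegral_indicator (hS n)]

/-- Weak convergence, together with bounds on the energy and on the negative part of the
entropy, implies strong convergence. -/
lemma tendsto_lintegral_sub_sq [NeZero d] {β γ : ℝ} (hγ : γ < d) (hα : 0 < β + 2 - γ)
    (hτ : 0 < decayExp d β γ) {f : ℕ → Eu d → ℝ} {G : ℕ → Eu d → Eu d} {f₀ : Eu d → ℝ}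
    {G₀ : Eu d → Eu d} (hf : ∀ n, InUnitBall d β γ (f n) (G n)) (hf₀ : InUnitBall d β γ f₀ G₀)
    (hweak : ∀ w, MemLp w 2 (powerMeasure d γ) → Tendsto (fun n => ∫ x, ⟪f n x, w x⟫_ℝ ∂powerMeasure d γ)
      atTop (𝓝 (∫ x, ⟪f₀ x, w x⟫_ℝ ∂powerMeasure d γ)))
    {N : ℝ} (hN : 0 < N)
    (hent : ∀ n, ∫⁻ x, ‖f n x‖ₑ ^ 2 * ENNReal.ofReal (-Real.log (f n x ^ 2)) ∂powerMeasure d γ ≤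
      ENNReal.ofReal N) :
    Tendsto (fun n => ∫⁻ x, ‖f n x - f₀ x‖ₑ ^ 2 ∂powerMeasure d γ) atTop (𝓝 0) := by
  set μ := powerMeasure d γ with hμ
  have hshell : ∀ ρ : ℝ, 0 < ρ →
      Tendsto (fun n => ∫⁻ x in shell d ρ, ‖f n x - f₀ x‖ₑ ^ 2 ∂μ) atTop (𝓝 0) := by
    intro ρ hρ
    refine tendsto_setLIntegral_shell (β := β) (W := fun n => G n - G₀) (K := 4) hρ
      (u := fun n => f n - f₀) (fun n => (hf n).grad.sub hf₀.grad)
      (fun n => (hf n).meas.sub hf₀.meas) (by norm_num) (fun n => ?_) (fun n => ?_) fun w hw => ?_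
    · refine (lintegral_sub_sq_le (hf n).grad.memLp.1).trans ?_
      calc _ ≤ 2 * 1 + 2 * (1 : ℝ≥0∞) := by
            refine add_le_add (mul_le_mul le_rfl (hf n).mass_le zero_le zero_le)
              (mul_le_mul le_rfl hf₀.mass_le zero_le zero_le)
        _ = 4 := by norm_num
    · refine (lintegral_sub_sq_le (hf n).grad.memLp_gradient.1).trans ?_
      calc _ ≤ 2 * 1 + 2 * (1 : ℝ≥0∞) := by
            refine add_le_add (mul_le_mul le_rfl (hf n).energy_le zero_le zero_le)
              (mul_le_mul le_rfl hf₀.energy_le zero_le zero_le)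
        _ = 4 := by norm_num
    · have h1 := (hweak w hw).sub_const (∫ x, ⟪f₀ x, w x⟫_ℝ ∂μ)
      rw [sub_self] at h1
      refine h1.congr fun n => ?_
      have i1 : ∀ g : Eu d → ℝ, MemLp g 2 μ → Integrable (fun x => ⟪g x, w x⟫_ℝ) μ := fun g hg => by
        refine (hg.integrable_mul hw).congr (Eventually.of_forall fun x => ?_)
        simp [mul_comm]
      rw [← integral_sub (i1 _ (hf n).grad.memLp) (i1 _ hf₀.grad.memLp)]
      refine integral_congr_ae (Eventually.of_forall fun x => ?_)
      simp only [Pi.sub_apply, inner_sub_left]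
  obtain ⟨σ, hσ, D, hD, Hin⟩ := inner_mass_le d β γ hγ hα
  rw [ENNReal.tendsto_nhds_zero]
  intro ε hε
  by_cases hεtop : ε = ⊤
  · exact Eventually.of_forall fun n => hεtop ▸ le_top
  -- Nine shares: four near the origin, four at infinity and one on the shells in between.
  set δ : ℝ := ε.toReal / 9 with hδ
  have hε' : 0 < ε.toReal := ENNReal.toReal_pos hε.ne' hεtop
  have hδ0 : 0 < δ := by positivity
  obtain ⟨ρ, hρ0, hρ⟩ : ∃ ρ : ℝ, 0 < ρ ∧ D * ρ ^ σ ≤ δ := by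
    refine ⟨(δ / D) ^ (1 / σ), by positivity, ?_⟩
    rw [← Real.rpow_mul (by positivity), one_div_mul_cancel hσ.ne', Real.rpow_one]
    apply le_of_eq; field_simp
  obtain ⟨R, hR0, HR⟩ := exists_radius_mass_le d β γ hγ hτ N δ hN hδ0
  have hδ' : (0 : ℝ≥0∞) < ENNReal.ofReal δ := ENNReal.ofReal_pos.2 hδ0
  obtain ⟨R', hR', hRR'⟩ := (((tendsto_outer_mass hf₀.grad.memLp hf₀.meas).eventually
    (ge_mem_nhds hδ')).and
    ((tendsto_natCast_atTop_atTop (R := ℝ)).eventually_ge_atTop R)).exists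
  -- Finitely many shells cover the region `ρ ≤ ‖x‖ < R'`, so local convergence on each of them is
  -- enough.
  obtain ⟨J, hJ⟩ := pow_unbounded_of_one_lt ((R' : ℝ) / ρ) one_lt_two
  rw [div_lt_iff₀ hρ0] at hJ
  have hcover : (Set.univ : Set (Eu d)) ⊆ ({x | ‖x‖ < ρ} ∪ {x | (R' : ℝ) ≤ ‖x‖}) ∪
      ⋃ j ∈ Finset.range J, shell d (ρ * 2 ^ j) := by
    intro x _
    by_cases h1 : ‖x‖ < ρ
    · exact Or.inl (Or.inl h1)
    by_cases h2 : (R' : ℝ) ≤ ‖x‖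
    · exact Or.inl (Or.inr h2)
    right
    obtain ⟨j, hj⟩ := Set.mem_iUnion.1 (outer_subset_iUnion_shell hρ0 (not_lt.1 h1))
    refine Set.mem_iUnion₂.2 ⟨j, Finset.mem_range.2 ?_, hj⟩
    by_contra hjJ
    have h3 : (2 : ℝ) ^ J ≤ 2 ^ j := pow_le_pow_right₀ one_le_two (not_lt.1 hjJ)
    have := hj.1
    nlinarith
  have hmid : Tendsto (fun n => ∑ j ∈ Finset.range J,
      ∫⁻ x in shell d (ρ * 2 ^ j), ‖f n x - f₀ x‖ₑ ^ 2 ∂μ) atTop (𝓝 0) := by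
    have := tendsto_finsetSum (Finset.range J) fun j _ => hshell (ρ * 2 ^ j) (by positivity)
    simpa using this
  filter_upwards [hmid.eventually (ge_mem_nhds hδ')] with n hn
  have hin : ∫⁻ x in {x | ‖x‖ < ρ}, ‖f n x - f₀ x‖ₑ ^ 2 ∂μ ≤
      2 * ENNReal.ofReal δ + 2 * ENNReal.ofReal δ := by
    refine (lintegral_sub_sq_le (hf n).grad.memLp.1.restrict).trans ?_
    refine add_le_add (mul_le_mul le_rfl ?_ zero_le zero_le) (mul_le_mul le_rfl ?_ zero_le zero_le)
    · exact (Hin _ _ (hf n) ρ hρ0).trans (ENNReal.ofReal_le_ofReal hρ)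
    · exact (Hin _ _ hf₀ ρ hρ0).trans (ENNReal.ofReal_le_ofReal hρ)
  have hout : ∫⁻ x in {x | (R' : ℝ) ≤ ‖x‖}, ‖f n x - f₀ x‖ₑ ^ 2 ∂μ ≤
      2 * ENNReal.ofReal δ + 2 * ENNReal.ofReal δ := by
    refine (lintegral_sub_sq_le (hf n).grad.memLp.1.restrict).trans ?_
    refine add_le_add (mul_le_mul le_rfl ?_ zero_le zero_le) (mul_le_mul le_rfl hR' zero_le zero_le)
    refine (lintegral_mono_set fun x hx => ?_).trans (HR _ _ (hf n) (hent n))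
    exact hRR'.trans hx
  calc _ = ∫⁻ x in Set.univ, ‖f n x - f₀ x‖ₑ ^ 2 ∂μ := by rw [Measure.restrict_univ]
    _ ≤ _ := lintegral_mono_set hcover
    _ ≤ (∫⁻ x in {x | ‖x‖ < ρ}, ‖f n x - f₀ x‖ₑ ^ 2 ∂μ +
        ∫⁻ x in {x | (R' : ℝ) ≤ ‖x‖}, ‖f n x - f₀ x‖ₑ ^ 2 ∂μ) +
        ∑ j ∈ Finset.range J, ∫⁻ x in shell d (ρ * 2 ^ j), ‖f n x - f₀ x‖ₑ ^ 2 ∂μ := by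
        refine (lintegral_union_le _ _ _).trans (add_le_add (lintegral_union_le _ _ _) ?_)
        have h4 : (μ.restrict (⋃ j ∈ Finset.range J, shell d (ρ * 2 ^ j))) ≤
            ∑ j ∈ Finset.range J, μ.restrict (shell d (ρ * 2 ^ j)) := by
          refine Measure.le_iff.2 fun s hs => ?_
          rw [Measure.restrict_apply hs, Set.inter_iUnion₂, Measure.finsetSum_apply]
          simp only [Measure.restrict_apply hs]
          exact measure_biUnion_finset_le _ _
        refine (lintegral_mono' h4 le_rfl).trans (le_of_eq ?_)
        exact lintegral_finsetSum_measure _ _ _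
    _ ≤ ((2 * ENNReal.ofReal δ + 2 * ENNReal.ofReal δ) +
        (2 * ENNReal.ofReal δ + 2 * ENNReal.ofReal δ)) + ENNReal.ofReal δ :=
        add_le_add (add_le_add hin hout) hn
    _ = 9 * ENNReal.ofReal δ := by ring
    _ = ε := by
        rw [← ENNReal.ofReal_ofNat, ← ENNReal.ofReal_mul (by norm_num), hδ,
          mul_div_cancel₀ _ (by norm_num), ENNReal.ofReal_toReal hεtop]

end StrongLimit

end WLS

namespace WLS

/-! ### Bounds and upper semicontinuity of the entropy. -/

section Entropy

open Filter Topology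
open scoped ENNReal InnerProductSpace

variable {d : ℕ}

/-- The entropy integrand `t² log t²`. -/
noncomputable def ent (t : ℝ) : ℝ := t ^ 2 * Real.log (t ^ 2)

lemma continuous_ent : Continuous ent := Real.continuous_mul_log.comp (continuous_pow 2)

/-- The part of the entropy integrand above the level `M`. -/
noncomputable def entAbove (M t : ℝ) : ℝ≥0∞ := ENNReal.ofReal (ent t - t ^ 2 * Real.log (M ^ 2))

/-- The part of the entropy integrand below the level `M`. -/
noncomputable def entBelow (M t : ℝ) : ℝ≥0∞ := ENNReal.ofReal (t ^ 2 * Real.log (M ^ 2) - ent t)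

lemma continuous_entBelow (M : ℝ) : Continuous (entBelow M) :=
  ENNReal.continuous_ofReal.comp
    (((continuous_pow 2).mul continuous_const).sub continuous_ent)

lemma enorm_sq_eq_ofReal (t : ℝ) : ‖t‖ₑ ^ 2 = ENNReal.ofReal (t ^ 2) := by
  rw [← sq_abs, ← Real.norm_eq_abs, ENNReal.ofReal_pow (norm_nonneg _), ofReal_norm]

lemma entAbove_eq {M : ℝ} (hM : 0 < M) (t : ℝ) :
    entAbove M t = ‖t‖ₑ ^ 2 * ENNReal.ofReal (Real.log (t ^ 2 / M ^ 2)) := by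
  rcases eq_or_ne t 0 with rfl | ht
  · simp [entAbove, ent]
  rw [enorm_sq_eq_ofReal, ← ENNReal.ofReal_mul (by positivity),
    Real.log_div (by positivity) (by positivity), entAbove, ent, mul_sub]

lemma ofReal_neg_ent (t : ℝ) :
    ‖t‖ₑ ^ 2 * ENNReal.ofReal (-Real.log (t ^ 2)) = ENNReal.ofReal (-ent t) := by
  rw [enorm_sq_eq_ofReal, ← ENNReal.ofReal_mul (by positivity), ent, mul_neg]

lemma ofReal_ent_le {M : ℝ} (hM : 1 ≤ M) (t : ℝ) :
    ENNReal.ofReal (ent t) ≤ entAbove M t + ‖t‖ₑ ^ 2 * ENNReal.ofReal (Real.log (M ^ 2)) := by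
  have hlog : 0 ≤ Real.log (M ^ 2) := Real.log_nonneg (one_le_pow₀ hM)
  rw [enorm_sq_eq_ofReal, ← ENNReal.ofReal_mul (by positivity), entAbove]
  refine le_trans (ENNReal.ofReal_le_ofReal ?_) ENNReal.ofReal_add_le
  linarith

/-- The part above the level `L` is controlled by `entropy_above_le`; below it the logarithm is at
most `log L²` and the mass at most one. -/
lemma lintegral_ofReal_ent_le (d : ℕ) [NeZero d] (β γ : ℝ) (hγ : γ < d) (hα : 0 < β + 2 - γ)
    (hτ : 0 < decayExp d β γ) : ∃ P : ℝ, 0 < P ∧ ∀ (f : Eu d → ℝ) (G : Eu d → Eu d),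
      InUnitBall d β γ f G →
        ∫⁻ x, ENNReal.ofReal (ent (f x)) ∂powerMeasure d γ ≤ ENNReal.ofReal P := by
  obtain ⟨L, hL, q, hq, C, hC, H⟩ := entropy_above_le d β γ hγ hα hτ
  have hlog : 0 ≤ Real.log (L ^ 2) := Real.log_nonneg (one_le_pow₀ hL)
  refine ⟨C * L ^ (-q) + Real.log (L ^ 2), by positivity, fun f G hf => ?_⟩
  calc _ ≤ ∫⁻ x, (‖f x‖ₑ ^ 2 * ENNReal.ofReal (Real.log (f x ^ 2 / L ^ 2)) +
        ‖f x‖ₑ ^ 2 * ENNReal.ofReal (Real.log (L ^ 2))) ∂powerMeasure d γ :=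
        lintegral_mono fun x => by
          rw [← entAbove_eq (by linarith)]; exact ofReal_ent_le hL _
    _ = ∫⁻ x, ‖f x‖ₑ ^ 2 * ENNReal.ofReal (Real.log (f x ^ 2 / L ^ 2)) ∂powerMeasure d γ +
        (∫⁻ x, ‖f x‖ₑ ^ 2 ∂powerMeasure d γ) * ENNReal.ofReal (Real.log (L ^ 2)) := by
        rw [lintegral_add_right _ ((hf.meas.enorm.pow_const 2).mul_const _),
          lintegral_mul_const' _ _ ENNReal.ofReal_ne_top]
    _ ≤ ENNReal.ofReal (C * L ^ (-q)) + 1 * ENNReal.ofReal (Real.log (L ^ 2)) :=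
        add_le_add (H L le_rfl f G hf) (mul_le_mul hf.mass_le le_rfl zero_le zero_le)
    _ = _ := by rw [one_mul, ← ENNReal.ofReal_add (by positivity) hlog]

lemma integral_le_of_lintegral_ofReal_le {X : Type*} [MeasurableSpace X] {μ : Measure X} {g : X → ℝ}
    (hg : Integrable g μ) {P : ℝ} (hP : 0 ≤ P)
    (h : ∫⁻ x, ENNReal.ofReal (g x) ∂μ ≤ ENNReal.ofReal P) : ∫ x, g x ∂μ ≤ P := by
  rw [integral_eq_lintegral_pos_part_sub_lintegral_neg_part hg]
  have h1 := ENNReal.toReal_mono ENNReal.ofReal_ne_top h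
  rw [ENNReal.toReal_ofReal hP] at h1
  linarith [ENNReal.toReal_nonneg (a := ∫⁻ x, ENNReal.ofReal (-g x) ∂μ)]

lemma lintegral_ofReal_neg_le {X : Type*} [MeasurableSpace X] {μ : Measure X} {g : X → ℝ}
    (hg : Integrable g μ) {P E : ℝ} (hP : 0 ≤ P)
    (h : ∫⁻ x, ENNReal.ofReal (g x) ∂μ ≤ ENNReal.ofReal P) (hE : E ≤ ∫ x, g x ∂μ) :
    ∫⁻ x, ENNReal.ofReal (-g x) ∂μ ≤ ENNReal.ofReal (P - E) := by
  rw [integral_eq_lintegral_pos_part_sub_lintegral_neg_part hg] at hE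
  have h1 := ENNReal.toReal_mono ENNReal.ofReal_ne_top h
  rw [ENNReal.toReal_ofReal hP] at h1
  have hfin : ∫⁻ x, ENNReal.ofReal (-g x) ∂μ ≠ ⊤ := hg.neg.lintegral_lt_top.ne
  rw [ENNReal.le_ofReal_iff_toReal_le hfin (by
    linarith [ENNReal.toReal_nonneg (a := ∫⁻ x, ENNReal.ofReal (-g x) ∂μ)])]
  linarith

/-- Upper semicontinuity of the entropy along strongly convergent sequences in the unit ball. -/
lemma entropy_upper_semicontinuous (d : ℕ) [NeZero d] (β γ : ℝ) (hγ : γ < d) (hα : 0 < β + 2 - γ)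
    (hτ : 0 < decayExp d β γ) {f : ℕ → Eu d → ℝ} {G : ℕ → Eu d → Eu d} {f₀ : Eu d → ℝ}
    {G₀ : Eu d → Eu d} (hf : ∀ n, InUnitBall d β γ (f n) (G n)) (hf₀ : InUnitBall d β γ f₀ G₀)
    (hmass : ∀ n, ∫ x, f n x ^ 2 ∂powerMeasure d γ = 1)
    (hmass₀ : ∫ x, f₀ x ^ 2 ∂powerMeasure d γ = 1)
    (hae : ∀ᵐ x ∂powerMeasure d γ, Tendsto (fun n => f n x) atTop (𝓝 (f₀ x)))
    (hint : ∀ n, Integrable (fun x => ent (f n x)) (powerMeasure d γ)) {S : ℝ} {e : ℕ → ℝ}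
    (he : Tendsto e atTop (𝓝 S)) (hS : ∀ n, e n ≤ ∫ x, ent (f n x) ∂powerMeasure d γ) :
    Integrable (fun x => ent (f₀ x)) (powerMeasure d γ) ∧
      S ≤ ∫ x, ent (f₀ x) ∂powerMeasure d γ := by
  obtain ⟨L, hL, q, hq, C, hC, H⟩ := entropy_above_le d β γ hγ hα hτ
  set μ := powerMeasure d γ with hμ
  have hsq : ∀ g : Eu d → ℝ, MemLp g 2 μ → Integrable (fun x => g x ^ 2) μ := fun g hg => by
    simpa using (memLp_two_iff_integrable_sq_norm hg.1).1 hg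
  have hentm : Measurable ent := continuous_ent.measurable
  -- Fatou applies to the nonnegative part below `M`. Its integral is controlled from above by the
  -- lower bound `e n` on the entropy, since the part above `M` is at most `C M^(-q)` uniformly in
  -- `n` and mass one turns the shift into exactly `log M²`.
  have main : ∀ M : ℝ, L ≤ M → ∫⁻ x, entBelow M (f₀ x) ∂μ ≤
      ENNReal.ofReal (C * M ^ (-q) - S + Real.log (M ^ 2)) := by
    intro M hM
    have hM0 : 0 < M := by linarith
    have h1 : ∀ n, ∫⁻ x, entBelow M (f n x) ∂μ ≤
        ENNReal.ofReal (C * M ^ (-q) - (e n - Real.log (M ^ 2))) := fun n => by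
      have i1 : Integrable (fun x => ent (f n x) - f n x ^ 2 * Real.log (M ^ 2)) μ :=
        (hint n).sub ((hsq _ (hf n).grad.memLp).mul_const _)
      have h2 := lintegral_ofReal_neg_le i1 (P := C * M ^ (-q)) (E := e n - Real.log (M ^ 2))
        (by positivity) (by
          refine le_trans (le_of_eq (lintegral_congr fun x => ?_)) (H M hM _ _ (hf n))
          rw [← entAbove_eq hM0, entAbove]) (by
          rw [integral_sub (hint n) ((hsq _ (hf n).grad.memLp).mul_const _), integral_mul_const,
            hmass n, one_mul]
          linarith [hS n])
      simpa only [neg_sub, entBelow] using h2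
    calc ∫⁻ x, entBelow M (f₀ x) ∂μ = ∫⁻ x, liminf (fun n => entBelow M (f n x)) atTop ∂μ := by
          refine lintegral_congr_ae ?_
          filter_upwards [hae] with x hx
          exact ((((continuous_entBelow M).tendsto _).comp hx).liminf_eq).symm
      _ ≤ liminf (fun n => ∫⁻ x, entBelow M (f n x) ∂μ) atTop :=
          lintegral_liminf_le fun n => (continuous_entBelow M).measurable.comp (hf n).meas
      _ ≤ liminf (fun n => ENNReal.ofReal (C * M ^ (-q) - (e n - Real.log (M ^ 2)))) atTop :=
          liminf_le_liminf (Eventually.of_forall h1)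
      _ = ENNReal.ofReal (C * M ^ (-q) - (S - Real.log (M ^ 2))) := by
          refine Tendsto.liminf_eq (ENNReal.tendsto_ofReal ?_)
          exact (he.sub_const _).const_sub _
      _ = _ := by congr 1; ring
  have i0 : ∀ M : ℝ, L ≤ M →
      Integrable (fun x => ent (f₀ x) - f₀ x ^ 2 * Real.log (M ^ 2)) μ := by
    intro M hM
    have hM0 : 0 < M := by linarith
    have hmeas : Measurable fun x => ent (f₀ x) - f₀ x ^ 2 * Real.log (M ^ 2) :=
      (hentm.comp hf₀.meas).sub ((hf₀.meas.pow_const 2).mul_const _)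
    refine ⟨hmeas.aestronglyMeasurable, ?_⟩
    have hle : ∀ y : ℝ, ‖y‖ₑ ≤ ENNReal.ofReal y + ENNReal.ofReal (-y) := fun y => by
      rw [← ofReal_norm, Real.norm_eq_abs]
      rcases abs_cases y with ⟨h, _⟩ | ⟨h, _⟩ <;> rw [h]
      · exact le_self_add
      · exact le_add_self
    refine (lintegral_mono fun x => hle _).trans_lt ?_
    rw [lintegral_add_left hmeas.ennreal_ofReal]
    refine ENNReal.add_lt_top.2 ⟨?_, ?_⟩
    · refine lt_of_le_of_lt ?_ (lt_of_le_of_lt (H M hM _ _ hf₀) ENNReal.ofReal_lt_top)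
      refine le_of_eq (lintegral_congr fun x => ?_)
      rw [← entAbove_eq hM0, entAbove]
    · simp only [neg_sub]
      exact (main M hM).trans_lt ENNReal.ofReal_lt_top
  have hi : Integrable (fun x => ent (f₀ x)) μ := by
    refine ((i0 L le_rfl).add ((hsq _ hf₀.grad.memLp).mul_const (Real.log (L ^ 2)))).congr
      (Eventually.of_forall fun x => ?_)
    simp
  refine ⟨hi, ?_⟩
  -- For `f₀` of mass one the terms `log M²` cancel, leaving an error `C M^(-q)` that vanishes as `M
  -- → ∞`. Large `M` also makes the bound in `main` a nonnegative real.
  have hM : ∀ᶠ M : ℝ in atTop, S - C * M ^ (-q) ≤ ∫ x, ent (f₀ x) ∂μ := by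
    filter_upwards [eventually_ge_atTop L, eventually_ge_atTop (Real.exp (|S| + 1))] with M hM hM2
    have hM0 : 0 < M := by linarith
    have hlog : S + 1 ≤ Real.log (M ^ 2) := by
      have h1 : |S| + 1 ≤ Real.log M := by
        rw [Real.le_log_iff_exp_le hM0]; exact hM2
      rw [Real.log_pow]
      push_cast
      linarith [le_abs_self S, abs_nonneg S]
    have h2 := integral_le_of_lintegral_ofReal_le (i0 M hM).neg
      (P := C * M ^ (-q) - S + Real.log (M ^ 2)) (by
        have : 0 ≤ C * M ^ (-q) := by positivity
        linarith) (by
        refine le_trans (le_of_eq (lintegral_congr fun x => ?_)) (main M hM)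
        simp [entBelow])
    simp only [Pi.neg_apply] at h2
    rw [integral_neg, integral_sub hi ((hsq _ hf₀.grad.memLp).mul_const _), integral_mul_const,
      hmass₀] at h2
    linarith
  have t2 : Tendsto (fun M : ℝ => S - C * M ^ (-q)) atTop (𝓝 S) := by
    have := ((tendsto_rpow_neg_atTop hq).const_mul C).const_sub S
    simpa using this
  exact le_of_tendsto t2 hM

/-! ### Positivity of the norms and normalization by scaling. -/

lemma sqNorm_nonneg {F : Type*} [NormedAddCommGroup F] (a : ℝ) (f : Eu d → F) :
    0 ≤ sqNorm d a f := integral_nonneg fun x => by positivity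

lemma ofReal_sqNorm {F : Type*} [NormedAddCommGroup F] {a : ℝ} {f : Eu d → F}
    (hf : MemLp f 2 (powerMeasure d a)) :
    ENNReal.ofReal (sqNorm d a f) = ∫⁻ x, ‖f x‖ₑ ^ 2 ∂powerMeasure d a :=
  ofReal_integral_norm_sq hf

lemma sqNorm_pos [NeZero d] {γ : ℝ} {f : Eu d → ℝ} (hf : MemLp f 2 (powerMeasure d γ))
    (h0 : ¬ f =ᵐ[volume] 0) : 0 < sqNorm d γ f := by
  refine lt_of_le_of_ne (sqNorm_nonneg _ _) fun h => h0 ?_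
  have h1 := ofReal_sqNorm hf
  rw [← h, ENNReal.ofReal_zero] at h1
  have h2 := (lintegral_eq_zero_iff' (hf.1.enorm.pow_const 2)).1 h1.symm
  have h3 : f =ᵐ[powerMeasure d γ] 0 := by
    filter_upwards [h2] with x hx
    simpa using hx
  exact (absolutelyContinuous_powerMeasure d γ).ae_eq h3

lemma sqNorm_gradient_pos [NeZero d] {β γ : ℝ} (hγ : γ < d) {f : Eu d → ℝ} {G : Eu d → Eu d}
    (hf : HasH1Gradient d β γ f G) (h0 : ¬ f =ᵐ[volume] 0) : 0 < sqNorm d β G := by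
  refine lt_of_le_of_ne (sqNorm_nonneg _ _) fun h => h0 ?_
  have hm : AEStronglyMeasurable f (volume : Measure (Eu d)) :=
    hf.memLp.1.mono_ac (absolutelyContinuous_powerMeasure d γ)
  refine hm.ae_eq_mk.trans ?_
  refine ae_eq_zero_of_gradient_eq_zero hγ (hf.congr hm.ae_eq_mk)
    hm.stronglyMeasurable_mk.measurable (G := G) ?_
  rw [← ofReal_sqNorm hf.memLp_gradient, ← h, ENNReal.ofReal_zero]

lemma sqNorm_dilation_mul {F : Type*} [NormedAddCommGroup F] [NormedSpace ℝ F] {a c : ℝ}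
    (hc : 0 < c) (s : ℝ) (f : Eu d → F) :
    sqNorm d a (fun x => s • f (c • x)) = s ^ 2 * c ^ (a - d) * sqNorm d a f := by
  unfold sqNorm
  have h := integral_powerMeasure_dilation (a := a) hc (fun x : Eu d => ‖f x‖ ^ 2)
  simp only [norm_smul, mul_pow, integral_const_mul]
  rw [h, Real.norm_eq_abs, sq_abs, smul_eq_mul, mul_assoc]

lemma ent_dilation {A s κ t : ℝ} (hA : 0 < A) (hκ : 0 < κ) (hs : s ^ 2 = κ / A) :
    ent (s * t) = κ * (|t| ^ 2 / A * Real.log (|t| ^ 2 / A) + |t| ^ 2 / A * Real.log κ) := by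
  rcases eq_or_ne t 0 with rfl | ht
  · simp [ent]
  have e : (s * t) ^ 2 = κ * (|t| ^ 2 / A) := by rw [mul_pow, hs, sq_abs]; ring
  rw [ent, e, Real.log_mul hκ.ne' (by positivity)]
  ring

/-- Every nonzero function can be normalized by scaling. -/
lemma exists_normalized [NeZero d] {β γ : ℝ} (hγ : γ < d) (hα : 0 < β + 2 - γ) {f : Eu d → ℝ}
    {G : Eu d → Eu d} (hf : HasH1Gradient d β γ f G) (h0 : ¬ f =ᵐ[volume] 0) :
    ∃ (g : Eu d → ℝ) (W : Eu d → Eu d), InUnitBall d β γ g W ∧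
      ∫ x, g x ^ 2 ∂powerMeasure d γ = 1 ∧
      (∫⁻ x, ENNReal.ofReal (ent (g x)) ∂powerMeasure d γ ≠ ⊤ →
        ∫⁻ x, ENNReal.ofReal (entropyDensity d γ f x) ∂powerMeasure d γ ≠ ⊤) ∧
      (Integrable (entropyDensity d γ f) (powerMeasure d γ) →
        Integrable (fun x => ent (g x)) (powerMeasure d γ) ∧
        ∫ x, ent (g x) ∂powerMeasure d γ = ∫ x, entropyDensity d γ f x ∂powerMeasure d γ -
          artificialDim d β γ / 2 * Real.log (sqNorm d β G / sqNorm d γ f)) := by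
  set A := sqNorm d γ f with hA
  set B := sqNorm d β G with hB
  have hA0 : 0 < A := sqNorm_pos hf.memLp h0
  have hB0 : 0 < B := sqNorm_gradient_pos hγ hf h0
  -- Scaling by `c` multiplies energy over mass by `c^(β+2-γ)`, so this choice equalizes them; `s`
  -- below then sets both to one.
  set c : ℝ := (A / B) ^ (β + 2 - γ)⁻¹ with hc
  have hc0 : 0 < c := by positivity
  have hcpow : c ^ (β + 2 - γ) = A / B := by
    rw [hc, ← Real.rpow_mul (by positivity), inv_mul_cancel₀ hα.ne', Real.rpow_one]
  set κ : ℝ := c ^ ((d : ℝ) - γ) with hκ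
  have hκ0 : 0 < κ := by positivity
  have hκ' : κ * c ^ (γ - d) = 1 := by
    rw [hκ, ← Real.rpow_add hc0]; simp
  set s : ℝ := Real.sqrt (κ / A) with hs
  have hs2 : s ^ 2 = κ / A := Real.sq_sqrt (by positivity)
  -- This identity is where the dimension `n` comes from: the entropy is shifted by `log κ = (d - γ)
  -- log c`.
  have hlogκ : Real.log κ = - (artificialDim d β γ / 2 * Real.log (B / A)) := by
    rw [hκ, Real.log_rpow hc0, hc, Real.log_rpow (by positivity), artificialDim,
      ← inv_div B A, Real.log_inv]
    field_simp
  have hfm : AEStronglyMeasurable f (volume : Measure (Eu d)) :=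
    hf.memLp.1.mono_ac (absolutelyContinuous_powerMeasure d γ)
  have hmk : f =ᵐ[powerMeasure d γ] hfm.mk f :=
    (powerMeasure_absolutelyContinuous d γ).ae_eq hfm.ae_eq_mk
  set f' := hfm.mk f with hf'
  have hgrad : HasH1Gradient d β γ f' G := hf.congr hfm.ae_eq_mk
  have hA' : sqNorm d γ f' = A := by
    rw [hA]; unfold sqNorm
    refine integral_congr_ae ?_
    filter_upwards [hmk] with x hx
    rw [hx]
  have hgW := (hgrad.dilation hc0).const_smul s
  have hmassg : sqNorm d γ (fun x => s * f' (c • x)) = 1 := by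
    have := sqNorm_dilation_mul (a := γ) hc0 s f'
    simp only [smul_eq_mul] at this
    rw [this, hs2, hA', div_mul_eq_mul_div, hκ']
    field_simp
  have henergy : sqNorm d β (fun x => s • c • G (c • x)) = 1 := by
    have := sqNorm_dilation_mul (a := β) hc0 (s * c) G
    simp only [mul_smul] at this
    rw [this, mul_pow, hs2, ← hB]
    have e : κ * c ^ 2 * c ^ (β - d) = A / B := by
      rw [hκ, ← Real.rpow_natCast c 2, ← Real.rpow_add hc0, ← Real.rpow_add hc0, ← hcpow]
      congr 1; push_cast; ring
    calc κ / A * c ^ 2 * c ^ (β - d) * B = (κ * c ^ 2 * c ^ (β - d)) * B / A := by ring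
      _ = 1 := by rw [e]; field_simp
  have hp : ∀ x, ent (s * f' x) = κ * (entropyDensity d γ f' x + |f' x| ^ 2 / A * Real.log κ) :=
    fun x => by rw [ent_dilation hA0 hκ0 hs2, entropyDensity, hA']
  have hed : entropyDensity d γ f =ᵐ[powerMeasure d γ] entropyDensity d γ f' := by
    filter_upwards [hmk] with x hx
    simp only [entropyDensity, hA', ← hA, hx]
  have hpi : Integrable (fun x => |f' x| ^ 2 / A * Real.log κ) (powerMeasure d γ) := by
    have := (memLp_two_iff_integrable_sq_norm hgrad.memLp.1).1 hgrad.memLp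
    simp only [Real.norm_eq_abs] at this
    exact (this.div_const A).mul_const _
  have hpint : ∫ x, |f' x| ^ 2 / A * Real.log κ ∂powerMeasure d γ = Real.log κ := by
    have : ∫ x, |f' x| ^ 2 ∂powerMeasure d γ = A := hA'
    rw [integral_mul_const, integral_div, this, div_self hA0.ne', one_mul]
  refine ⟨fun x => s * f' (c • x), fun x => s • c • G (c • x), ⟨hgW, ?_, ?_, ?_⟩, ?_, ?_, ?_⟩
  · exact (hfm.stronglyMeasurable_mk.measurable.comp (measurable_const_smul c)).const_mul s
  · rw [← ofReal_sqNorm hgW.memLp, hmassg, ENNReal.ofReal_one]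
  · rw [← ofReal_sqNorm hgW.memLp_gradient, henergy, ENNReal.ofReal_one]
  · rw [← hmassg]; unfold sqNorm
    refine integral_congr_ae (Eventually.of_forall fun x => ?_)
    simp only [Real.norm_eq_abs, sq_abs]
  · intro hfin
    rw [lintegral_powerMeasure_dilation hc0 (fun x => ENNReal.ofReal (ent (s * f' x)))] at hfin
    have hfin' : ∫⁻ x, ENNReal.ofReal (ent (s * f' x)) ∂powerMeasure d γ ≠ ⊤ := by
      intro htop
      rw [htop, ENNReal.mul_top (by simpa using Real.rpow_pos_of_pos hc0 _)] at hfin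
      exact hfin rfl
    rw [lintegral_congr_ae (g := fun x => ENNReal.ofReal (entropyDensity d γ f' x)) (by
      filter_upwards [hed] with x hx; rw [hx])]
    refine ne_top_of_le_ne_top (b := ENNReal.ofReal κ⁻¹ *
      ∫⁻ x, ENNReal.ofReal (ent (s * f' x)) ∂powerMeasure d γ +
      ∫⁻ x, ENNReal.ofReal (-(|f' x| ^ 2 / A * Real.log κ)) ∂powerMeasure d γ) ?_ ?_
    · exact ENNReal.add_ne_top.2 ⟨ENNReal.mul_ne_top ENNReal.ofReal_ne_top hfin',
        hpi.neg.lintegral_lt_top.ne⟩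
    · have hm : Measurable f' := hfm.stronglyMeasurable_mk.measurable
      have hm1 : Measurable fun x => ENNReal.ofReal κ⁻¹ * ENNReal.ofReal (ent (s * f' x)) :=
        ((continuous_ent.measurable.comp (hm.const_mul s)).ennreal_ofReal).const_mul _
      rw [← lintegral_const_mul' _ _ ENNReal.ofReal_ne_top, ← lintegral_add_left hm1]
      refine lintegral_mono fun x => ?_
      rw [← ENNReal.ofReal_mul (by positivity)]
      refine le_trans (ENNReal.ofReal_le_ofReal ?_) ENNReal.ofReal_add_le
      rw [hp, ← mul_assoc, inv_mul_cancel₀ hκ0.ne']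
      linarith
  · intro hint
    have hint' : Integrable (entropyDensity d γ f') (powerMeasure d γ) := hint.congr hed
    have hi2 : Integrable (fun x => ent (s * f' x)) (powerMeasure d γ) := by
      refine ((hint'.add hpi).const_mul κ).congr (Eventually.of_forall fun x => ?_)
      simp only [hp, Pi.add_apply]
    refine ⟨integrable_powerMeasure_dilation (g := fun x => ent (s * f' x)) hc0 hi2, ?_⟩
    rw [integral_powerMeasure_dilation hc0 (fun x => ent (s * f' x))]
    simp only [hp]
    rw [integral_const_mul, integral_add hint' hpi, hpint, smul_eq_mul, ← mul_assoc,
      mul_comm _ κ, hκ', one_mul, integral_congr_ae hed, hlogκ]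
    ring

end Entropy

end WLS

namespace WLS

/-! ### The optimal constant and the maximizer. -/

section Existence

open Filter Topology
open scoped ENNReal InnerProductSpace

variable {d : ℕ}

/-- The `L²` statement is applied to `√|g|`. -/
lemma integrable_powerMeasure_of_tsupport {g : Eu d → ℝ} (hg : Continuous g)
    (hc : HasCompactSupport g) (h0 : (0 : Eu d) ∉ tsupport g) (a : ℝ) :
    Integrable g (powerMeasure d a) := by
  have hsub : tsupport (fun x => Real.sqrt |g x|) ⊆ tsupport g :=
    closure_mono fun x hx => by
      rw [Function.mem_support] at hx ⊢
      intro h; exact hx (by simp [h])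
  have h1 := memLp_powerMeasure_of_tsupport (g := fun x => Real.sqrt |g x|)
    (Real.continuous_sqrt.comp hg.abs)
    (hc.of_isClosed_subset (isClosed_tsupport _) hsub) (fun h => h0 (hsub h)) a
  have h2 := (memLp_two_iff_integrable_sq_norm h1.1).1 h1
  simp only [Real.norm_eq_abs, sq_abs, Real.sq_sqrt (abs_nonneg _)] at h2
  exact (integrable_norm_iff hg.aestronglyMeasurable).1 h2

lemma hasH1Gradient_of_contDiff (β γ : ℝ) {f : Eu d → ℝ} (hf : ContDiff ℝ ∞ f)
    (hc : HasCompactSupport f) (h0 : (0 : Eu d) ∉ tsupport f) :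
    HasH1Gradient d β γ f fun x => (InnerProductSpace.toDual ℝ (Eu d)).symm (fderiv ℝ f x) := by
  have hf' : Continuous (fderiv ℝ f) := hf.continuous_fderiv (by simp)
  have hm := memLp_powerMeasure_of_tsupport hf' (hc.fderiv (𝕜 := ℝ))
    (fun h => h0 (tsupport_fderiv_subset ℝ h)) β
  refine ⟨memLp_powerMeasure_of_tsupport hf.continuous hc h0 γ, ?_, fun φ hφ v => ?_⟩
  · refine (memLp_congr_norm hm.1 ?_ (Eventually.of_forall fun x => ?_)).1 hm
    · exact ((InnerProductSpace.toDual ℝ (Eu d)).symm.continuous.comp hf').aestronglyMeasurable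
    · simp
  · have hφ' : Continuous (fderiv ℝ φ) := hφ.contDiff.continuous_fderiv (by simp)
    have hφc := hφ.contDiff.continuous
    have hfc := hf.continuous
    have e : ∀ x, φ x * ⟪(InnerProductSpace.toDual ℝ (Eu d)).symm (fderiv ℝ f x), v⟫_ℝ =
        fderiv ℝ f x v * φ x := fun x => by
      rw [InnerProductSpace.toDual_symm_apply, mul_comm]
    simp only [e]
    refine integral_mul_fderiv_eq_neg_fderiv_mul_of_integrable ?_ ?_ ?_
      (fun x _ => hf.differentiable (by simp) x) (fun x _ => hφ.contDiff.differentiable (by simp) x)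
    · exact ((hf'.clm_apply continuous_const).mul hφc).integrable_of_hasCompactSupport
        (hφ.hasCompactSupport.mul_left)
    · exact (hfc.mul (hφ'.clm_apply continuous_const)).integrable_of_hasCompactSupport
        hc.mul_right
    · exact (hfc.mul hφc).integrable_of_hasCompactSupport hc.mul_right

/-- A function with finite entropy is needed to bound admissible constants from below. A bump around
a unit vector, of radius `1/2`, avoids the singular origin. -/
lemma exists_integrable_entropyDensity [NeZero d] (β γ : ℝ) :
    ∃ (f : Eu d → ℝ) (G : Eu d → Eu d), HasH1Gradient d β γ f G ∧ ¬ f =ᵐ[volume] 0 ∧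
      Integrable (entropyDensity d γ f) (powerMeasure d γ) := by
  obtain ⟨x₀, hx₀⟩ := exists_norm_eq (Eu d) zero_le_one
  let φ : ContDiffBump x₀ := ⟨1 / 4, 1 / 2, by norm_num, by norm_num⟩
  have h0 : (0 : Eu d) ∉ tsupport φ := by
    rw [φ.tsupport_eq, Metric.mem_closedBall, dist_comm, dist_zero_right, hx₀]
    change ¬ (1 : ℝ) ≤ 1 / 2
    norm_num
  refine ⟨φ, _, hasH1Gradient_of_contDiff β γ φ.contDiff φ.hasCompactSupport h0, ?_, ?_⟩
  · intro h
    have h1 : (φ : Eu d → ℝ) = 0 :=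
      (φ.continuous.ae_eq_iff_eq volume continuous_const).1 h
    have h2 : φ x₀ = 1 := φ.one_of_mem_closedBall (by simp [φ.rIn_pos.le])
    rw [h1] at h2
    simp at h2
  · have hcont : Continuous (entropyDensity d γ φ) := by
      have : Continuous fun x => |φ x| ^ 2 / sqNorm d γ φ :=
        (φ.continuous.abs.pow 2).div_const _
      exact Real.continuous_mul_log.comp this
    have hsub : tsupport (entropyDensity d γ φ) ⊆ tsupport φ := closure_mono fun x hx => by
      rw [Function.mem_support] at hx ⊢
      intro h; exact hx (by simp [entropyDensity, h])
    exact integrable_powerMeasure_of_tsupport hcont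
      (φ.hasCompactSupport.of_isClosed_subset (isClosed_tsupport _) hsub) (fun h => h0 (hsub h)) γ

/-- Combining `γ - 2 < β` with `β < γ - 2γ/d` gives `γ/d < 1`. -/
lemma InRange.lt_dim [NeZero d] {β γ : ℝ} (h : InRange d β γ) : γ < d := by
  have hd : (0 : ℝ) < d := by exact_mod_cast NeZero.pos d
  have h1 : γ - 2 < ((d : ℝ) - 2) / d * γ := h.1.trans h.2.1
  have h2 : ((d : ℝ) - 2) / d * γ = γ - 2 * (γ / d) := by field_simp
  have h3 : γ / d < 1 := by linarith
  rwa [div_lt_one hd] at h3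

lemma inequalityHolds_of_bound [NeZero d] {β γ P : ℝ} (hγ : γ < d) (hα : 0 < β + 2 - γ)
    (hP0 : 0 ≤ P) (hP : ∀ (f : Eu d → ℝ) (G : Eu d → Eu d), InUnitBall d β γ f G →
      ∫⁻ x, ENNReal.ofReal (ent (f x)) ∂powerMeasure d γ ≤ ENNReal.ofReal P) :
    InequalityHolds d β γ P := by
  intro f G hf h0
  obtain ⟨g, W, hg, -, hfin, hent⟩ := exists_normalized hγ hα hf h0
  have hPg := hP g W hg
  refine ⟨hfin (ne_top_of_le_ne_top ENNReal.ofReal_ne_top hPg), fun hint => ?_⟩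
  obtain ⟨hi, he⟩ := hent hint
  have := integral_le_of_lintegral_ofReal_le hi hP0 hPg
  unfold rightHandSide
  linarith

/-- The infimum of the constants for which the inequality holds is attained. -/
lemma isLeast_optimalConstant [NeZero d] {β γ P : ℝ} (hP : InequalityHolds d β γ P) :
    IsLeast {C : ℝ | InequalityHolds d β γ C} (optimalConstant d β γ) := by
  obtain ⟨f₁, G₁, hf₁, hf₁0, hint₁⟩ := exists_integrable_entropyDensity (d := d) β γ
  have hbdd : BddBelow {C : ℝ | InequalityHolds d β γ C} := by
    refine ⟨∫ x, entropyDensity d γ f₁ x ∂powerMeasure d γ -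
      artificialDim d β γ / 2 * Real.log (sqNorm d β G₁ / sqNorm d γ f₁), fun C hC => ?_⟩
    have := (hC f₁ G₁ hf₁ hf₁0).2 hint₁
    unfold rightHandSide at this
    linarith
  refine ⟨fun f G hf h0 => ⟨(hP f G hf h0).1, fun hint => ?_⟩, fun C hC => csInf_le hbdd hC⟩
  have : ∫ x, entropyDensity d γ f x ∂powerMeasure d γ -
      artificialDim d β γ / 2 * Real.log (sqNorm d β G / sqNorm d γ f) ≤ optimalConstant d β γ := by
    refine le_csInf ⟨P, hP⟩ fun C hC => ?_
    have := (hC f G hf h0).2 hint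
    unfold rightHandSide at this
    linarith
  unfold rightHandSide
  linarith

/-- Each constant `S - 1/(n+1)` lies below the least admissible one, so some function violates its
inequality; that function is then normalized. -/
lemma exists_maximizing_sequence [NeZero d] {β γ : ℝ} (hγ : γ < d) (hα : 0 < β + 2 - γ)
    (hS : IsLeast {C : ℝ | InequalityHolds d β γ C} (optimalConstant d β γ)) :
    ∃ (f : ℕ → Eu d → ℝ) (G : ℕ → Eu d → Eu d), ∀ n, InUnitBall d β γ (f n) (G n) ∧
      ∫ x, f n x ^ 2 ∂powerMeasure d γ = 1 ∧
      Integrable (fun x => ent (f n x)) (powerMeasure d γ) ∧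
      optimalConstant d β γ - 1 / ((n : ℝ) + 1) ≤ ∫ x, ent (f n x) ∂powerMeasure d γ := by
  have key : ∀ n : ℕ, ∃ (f : Eu d → ℝ) (G : Eu d → Eu d), InUnitBall d β γ f G ∧
      ∫ x, f x ^ 2 ∂powerMeasure d γ = 1 ∧
      Integrable (fun x => ent (f x)) (powerMeasure d γ) ∧
      optimalConstant d β γ - 1 / ((n : ℝ) + 1) ≤ ∫ x, ent (f x) ∂powerMeasure d γ := by
    intro n
    have hn : ¬ InequalityHolds d β γ (optimalConstant d β γ - 1 / ((n : ℝ) + 1)) := fun h => by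
      have h1 := hS.2 h
      have h2 : 0 < 1 / ((n : ℝ) + 1) := by positivity
      linarith
    unfold InequalityHolds at hn
    push Not at hn
    obtain ⟨f, G, hf, h0, hn⟩ := hn
    obtain ⟨hint, hlt⟩ := hn (hS.1 f G hf h0).1
    obtain ⟨g, W, hg, hmass, -, hent⟩ := exists_normalized hγ hα hf h0
    obtain ⟨hi, he⟩ := hent hint
    refine ⟨g, W, hg, hmass, hi, ?_⟩
    unfold rightHandSide at hlt
    linarith
  choose f G h using key
  exact ⟨f, G, h⟩

/-- Young's inequality gives `1 ≤ s ∫ |f₀|² + s/(s-1) ∫ |f n - f₀|²`; let `n → ∞`, then `s → 1`. -/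
lemma mass_limit {X : Type*} [MeasurableSpace X] {μ : Measure X} {f : ℕ → X → ℝ} {f₀ : X → ℝ}
    (hf₀ : Measurable f₀)
    (h1 : ∀ n, ∫⁻ x, ‖f n x‖ₑ ^ 2 ∂μ = 1) (h₀ : ∫⁻ x, ‖f₀ x‖ₑ ^ 2 ∂μ ≤ 1)
    (hlim : Tendsto (fun n => ∫⁻ x, ‖f n x - f₀ x‖ₑ ^ 2 ∂μ) atTop (𝓝 0)) :
    ∫⁻ x, ‖f₀ x‖ₑ ^ 2 ∂μ = 1 := by
  refine le_antisymm h₀ ?_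
  have hs : ∀ s : ℝ, 1 < s → 1 ≤ ENNReal.ofReal s * ∫⁻ x, ‖f₀ x‖ₑ ^ 2 ∂μ := by
    intro s hs
    have hbound : ∀ n, 1 ≤ ENNReal.ofReal s * ∫⁻ x, ‖f₀ x‖ₑ ^ 2 ∂μ +
        ENNReal.ofReal (s / (s - 1)) * ∫⁻ x, ‖f n x - f₀ x‖ₑ ^ 2 ∂μ := fun n => by
      rw [← h1 n, ← lintegral_const_mul' _ _ ENNReal.ofReal_ne_top,
        ← lintegral_const_mul' _ _ ENNReal.ofReal_ne_top,
        ← lintegral_add_left ((hf₀.enorm.pow_const 2).const_mul _)]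
      refine lintegral_mono fun x => ?_
      have := enorm_add_sq_le_of_one_lt hs (f₀ x) (f n x - f₀ x)
      rwa [add_sub_cancel] at this
    have h2 := (ENNReal.Tendsto.const_mul hlim (Or.inr (ENNReal.ofReal_ne_top (r := s / (s - 1))))).const_add
      (ENNReal.ofReal s * ∫⁻ x, ‖f₀ x‖ₑ ^ 2 ∂μ)
    rw [mul_zero, add_zero] at h2
    exact ge_of_tendsto' h2 hbound
  have hlim1 : Tendsto (fun s : ℝ => ENNReal.ofReal s * ∫⁻ x, ‖f₀ x‖ₑ ^ 2 ∂μ) (𝓝[>] 1)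
      (𝓝 (ENNReal.ofReal 1 * ∫⁻ x, ‖f₀ x‖ₑ ^ 2 ∂μ)) :=
    ENNReal.Tendsto.mul_const (ENNReal.tendsto_ofReal
      (tendsto_nhdsWithin_of_tendsto_nhds tendsto_id))
      (Or.inr (ne_top_of_le_ne_top ENNReal.one_ne_top h₀))
  rw [ENNReal.ofReal_one, one_mul] at hlim1
  refine ge_of_tendsto hlim1 ?_
  filter_upwards [self_mem_nhdsWithin] with s hs1
  exact hs s hs1

/-- Existence of a normalized maximizer of the entropy. -/
lemma exists_maximizer [NeZero d] {β γ P : ℝ} (hγ : γ < d) (hα : 0 < β + 2 - γ)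
    (hτ : 0 < decayExp d β γ) (hP0 : 0 ≤ P)
    (hP : ∀ (f : Eu d → ℝ) (G : Eu d → Eu d), InUnitBall d β γ f G →
      ∫⁻ x, ENNReal.ofReal (ent (f x)) ∂powerMeasure d γ ≤ ENNReal.ofReal P)
    (hS : IsLeast {C : ℝ | InequalityHolds d β γ C} (optimalConstant d β γ)) :
    ∃ (f : Eu d → ℝ) (G : Eu d → Eu d), InUnitBall d β γ f G ∧
      sqNorm d γ f = 1 ∧ Integrable (fun x => ent (f x)) (powerMeasure d γ) ∧
      optimalConstant d β γ ≤ ∫ x, ent (f x) ∂powerMeasure d γ := by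
  set S := optimalConstant d β γ
  obtain ⟨f, G, hfG⟩ := exists_maximizing_sequence hγ hα hS
  have hf := fun n => (hfG n).1
  have hmass := fun n => (hfG n).2.1
  have hint := fun n => (hfG n).2.2.1
  have hE := fun n => (hfG n).2.2.2
  have hSn : ∀ n : ℕ, S - 1 ≤ S - 1 / ((n : ℝ) + 1) := fun n => by
    have : 1 / ((n : ℝ) + 1) ≤ 1 := by
      rw [div_le_one (by positivity)]
      linarith [(Nat.cast_nonneg n : (0 : ℝ) ≤ n)]
    linarith
  obtain ⟨φ₁, f₀, hφ₁, hf₀s, hf₀m, hf₀1, hf₀lim⟩ := exists_weakly_convergent_subseq_memLp f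
    (fun n => (hf n).grad.memLp) fun n => (hf n).mass_le
  obtain ⟨φ₂, G₀, hφ₂, hG₀s, hG₀m, hG₀1, hG₀lim⟩ := exists_weakly_convergent_subseq_memLp
    (fun n => G (φ₁ n)) (fun n => (hf (φ₁ n)).grad.memLp_gradient) fun n => (hf (φ₁ n)).energy_le
  have hf₀lim' : ∀ w, MemLp w 2 (powerMeasure d γ) →
      Tendsto (fun n => ∫ x, ⟪f (φ₁ (φ₂ n)) x, w x⟫_ℝ ∂powerMeasure d γ) atTop
        (𝓝 (∫ x, ⟪f₀ x, w x⟫_ℝ ∂powerMeasure d γ)) := fun w hw =>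
    (hf₀lim w hw).comp hφ₂.tendsto_atTop
  have hgrad₀ : HasH1Gradient d β γ f₀ G₀ :=
    hasH1Gradient_of_weak_limit (fun n => (hf (φ₁ (φ₂ n))).grad) hf₀m hG₀m hf₀lim' hG₀lim
  have hf₀ : InUnitBall d β γ f₀ G₀ := ⟨hgrad₀, hf₀s.measurable, hf₀1, hG₀1⟩
  have hstrong := tendsto_lintegral_sub_sq hγ hα hτ (fun n => hf (φ₁ (φ₂ n))) hf₀ hf₀lim'
    -- Any positive number at least `P - (S - 1)` works; the latter bounds the negative part, as the
    -- entropy is at least `S - 1` and its positive part at most `P`.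
    (N := P - (S - 1) + (|P - (S - 1)| + 1)) (by
      linarith [neg_abs_le (P - (S - 1))]) (fun n => by
      have h1 := lintegral_ofReal_neg_le (hint (φ₁ (φ₂ n))) hP0 (hP _ _ (hf (φ₁ (φ₂ n))))
        ((hSn _).trans (hE (φ₁ (φ₂ n))))
      simp only [ofReal_neg_ent]
      refine h1.trans (ENNReal.ofReal_le_ofReal ?_)
      linarith [abs_nonneg (P - (S - 1))])
  have hmass' : ∀ n, ∫⁻ x, ‖f n x‖ₑ ^ 2 ∂powerMeasure d γ = 1 := fun n => by
    rw [← ofReal_integral_norm_sq (hf n).grad.memLp, ← ENNReal.ofReal_one, ← hmass n]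
    simp
  have hmass₀' := mass_limit hf₀.meas (fun n => hmass' _) hf₀1 hstrong
  have hmass₀ : sqNorm d γ f₀ = 1 := by
    have h := ofReal_sqNorm hf₀m
    rw [hmass₀', ENNReal.ofReal_eq_one] at h
    exact h
  have hLp : Tendsto (fun n => eLpNorm (f (φ₁ (φ₂ n)) - f₀) 2 (powerMeasure d γ)) atTop (𝓝 0) := by
    have h1 : ∀ g : Eu d → ℝ, eLpNorm g 2 (powerMeasure d γ) =
        (∫⁻ x, ‖g x‖ₑ ^ 2 ∂powerMeasure d γ) ^ (1 / 2 : ℝ) := fun g => by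
      rw [eLpNorm_eq_lintegral_rpow_enorm_toReal (by norm_num) (by norm_num)]
      simp
    simp only [h1, Pi.sub_apply]
    have h2 := (ENNReal.continuous_rpow_const (y := 1 / 2)).tendsto 0 |>.comp hstrong
    rwa [ENNReal.zero_rpow_of_pos (by norm_num)] at h2
  obtain ⟨φ₃, hφ₃, hae⟩ := (tendstoInMeasure_of_tendsto_eLpNorm (by norm_num)
    (fun n => (hf (φ₁ (φ₂ n))).meas.aestronglyMeasurable) hf₀.meas.aestronglyMeasurable
    hLp).exists_seq_tendsto_ae
  have hφ : StrictMono fun n => φ₁ (φ₂ (φ₃ n)) := hφ₁.comp (hφ₂.comp hφ₃)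
  have he : Tendsto (fun n => S - 1 / (((φ₁ (φ₂ (φ₃ n)) : ℕ) : ℝ) + 1)) atTop (𝓝 S) := by
    have := (tendsto_one_div_add_atTop_nhds_zero_nat (𝕜 := ℝ)).comp hφ.tendsto_atTop
    simpa using this.const_sub S
  obtain ⟨hi, hle⟩ := entropy_upper_semicontinuous d β γ hγ hα hτ
    (fun n => hf (φ₁ (φ₂ (φ₃ n)))) hf₀ (fun n => hmass _)
    (by rw [← hmass₀]; unfold sqNorm; simp) hae (fun n => hint _) he (fun n => hE _)
  exact ⟨f₀, G₀, hf₀, hmass₀, hi, hle⟩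

end Existence

end WLS

/-- The weighted logarithmic Sobolev inequality has a (finite) optimal constant, and equality
with this constant is achieved by a nonzero function in `H¹_{β,γ}(ℝ^d)`. -/
theorem proposition2p2 (d : ℕ) (hd : 1 ≤ d) (β γ : ℝ) (hβγ : WLS.InRange d β γ) :
    IsLeast {C : ℝ | WLS.InequalityHolds d β γ C} (WLS.optimalConstant d β γ) ∧
    ∃ (u : EuclideanSpace ℝ (Fin d) → ℝ)
      (G : EuclideanSpace ℝ (Fin d) → EuclideanSpace ℝ (Fin d)),
      WLS.HasH1Gradient d β γ u G ∧ ¬ (u =ᵐ[volume] 0) ∧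
      Integrable (WLS.entropyDensity d γ u) (WLS.powerMeasure d γ) ∧
      ∫ x, WLS.entropyDensity d γ u x ∂(WLS.powerMeasure d γ) =
        WLS.rightHandSide d β γ (WLS.optimalConstant d β γ) u G := by
  have : NeZero d := ⟨by omega⟩
  have hγ : γ < d := hβγ.lt_dim
  have hα : 0 < β + 2 - γ := by linarith [hβγ.1]
  have hτ : 0 < WLS.decayExp d β γ := sub_pos.2 hβγ.2.1
  obtain ⟨P, hP0, hP⟩ := WLS.lintegral_ofReal_ent_le d β γ hγ hα hτ
  have hS := WLS.isLeast_optimalConstant (WLS.inequalityHolds_of_bound hγ hα hP0.le hP)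
  refine ⟨hS, ?_⟩
  obtain ⟨u, G, hu, hmass, hint, hle⟩ := WLS.exists_maximizer hγ hα hτ hP0.le hP hS
  have hu0 : ¬ u =ᵐ[volume] 0 := fun h => by
    have h1 : WLS.sqNorm d γ u = 0 := by
      unfold WLS.sqNorm
      rw [integral_congr_ae (g := fun _ => (0 : ℝ)), integral_zero]
      filter_upwards [(WLS.powerMeasure_absolutelyContinuous d γ).ae_eq h] with x hx
      simp [hx]
    linarith
  have hent : WLS.entropyDensity d γ u = fun x => WLS.ent (u x) := by
    funext x
    simp [WLS.entropyDensity, WLS.ent, hmass]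
  have hint' : Integrable (WLS.entropyDensity d γ u) (WLS.powerMeasure d γ) := hent ▸ hint
  refine ⟨u, G, hu.grad, hu0, hint', le_antisymm ((hS.1 u G hu.grad hu0).2 hint') ?_⟩
  -- Only energy at most one survives the weak limit. It suffices: the logarithmic term is then
  -- nonpositive, so the right-hand side is at most the optimal constant, hence at most the entropy
  -- of `u`.
  have hG1 : WLS.sqNorm d β G ≤ 1 := by
    rw [← ENNReal.ofReal_le_one, WLS.ofReal_sqNorm hu.grad.memLp_gradient]
    exact hu.energy_le
  have hlog : Real.log (WLS.sqNorm d β G / WLS.sqNorm d γ u) ≤ 0 := by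
    rw [hmass, div_one]
    exact Real.log_nonpos (WLS.sqNorm_nonneg β G) hG1
  have hn : 0 ≤ WLS.artificialDim d β γ / 2 := by
    unfold WLS.artificialDim
    have : 0 < (d : ℝ) - γ := by linarith
    positivity
  rw [hent]
  unfold WLS.rightHandSide
  nlinarith [mul_nonneg_of_nonpos_of_nonpos (neg_nonpos.2 hn) hlog]
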